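/- Let $K$ be a commutative artinian local ring and let $\Lambda$ be an Artin $K$-algebra, i.e. a $K$-algebra that is finitely generated as a $K$-module. Assume that $\Lambda$ is connected, basic, not simple, and selfinjective. Let $\mathrm{mod}\text{-}\Lambda$ be the category of finitely generated right $\Lambda$-modules, $\mathcal{P}_\Lambda$ its full subcategory of projective modules, $\mathscr{K}(\mathrm{mod}\text{-}\Lambda)$ the homotopy category of cochain complexes over $\mathrm{mod}\text{-}\Lambda$, and $\mathscr{K}^{\mathrm b}(\mathcal{P}_\Lambda)$ its full subcategory of bounded complexes over $\mathcal{P}_\Lambda$ (up to isomorphism). Modules are regarded as complexes concentrated in degree $0$. Let $P_1,\dots,P_n$ be a complete set of nonisomorphic indecomposable modules in $\mathcal{P}_\Lambda$, and assume $n>1$. Let $S\in\mathrm{mod}\text{-}\Lambda$ be a simple module with $\mathrm{Ext}^1_\Lambda(S,S)=0$ whose injective envelope $E(S)$ is isomorphic to its projective cover $P(S)$, and let $t$ be the index with $P_t\cong P(S)$. Let $0\to S\to E^0\xrightarrow{f}E^1$ be a minimal injective presentation (it is exact, $S\to E^0$ is an injective envelope, and so is the inclusion $\operatorname{Im} f\to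 E^1$), let $E^\bullet$ be the mapping cone of $f$ (with $E^0$ in degree $-1$ and $E^1$ in degree $0$), and set \[ T^\bullet = T_1\oplus E^\bullet,\qquad T_1=\bigoplus_{i\neq t}P_i . \] Then: 1. $T^\bullet$ is a tilting complex for $\Lambda$: it belongs to $\mathscr{K}^{\mathrm b}(\mathcal{P}_\Lambda)$, one has $\mathrm{Hom}_{\mathscr{K}(\mathrm{mod}\text{-}\Lambda)}(T^\bullet,T^\bullet[j])=0$ for all $j\neq 0$, and the smallest full triangulated subcategory (closed under isomorphisms) of $\mathscr{K}(\mathrm{mod}\text{-}\Lambda)$ that contains all direct summands of finite direct sums of copies of $T^\bullet$ is $\mathscr{K}^{\mathrm b}(\mathcal{P}_\Lambda)$. 2. $\Gamma=\mathrm{End}_{\mathscr{K}(\mathrm{mod}\text{-}\Lambda)}(T^\bullet)$ is a selfinjective Artin $K$-algebra. 3. The Nakayama permutation of $\Gamma$ coincides with that of $\Lambda$. Precisely, put $T_i^\bullet=P_i$ for $i\ne t$, $T_t^\bullet=E^\bullet$ and $Q_i=\mathrm{Hom}_{\mathscr{K}(\mathrm{mod}\text{-}\Lambda)}(T^\bullet,T_i^\bullet)$.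 Then $Q_1,\dots,Q_n$ is a complete set of nonisomorphic indecomposable finitely generated projective right $\Gamma$-modules, and there is a permutation $\sigma$ of $\{1,\dots,n\}$ such that, for all $i$, $\mathrm{soc}(P_i)\cong \mathrm{top}(P_{\sigma(i)})$ and $\mathrm{soc}(Q_i)\cong\mathrm{top}(Q_{\sigma(i)})$. -/

import Mathlib

open CategoryTheory CategoryTheory.Limits

universe v u

noncomputable section

namespace Reflection

/-! ### Rings and modules

Right modules over a ring `A` are modules over `Aᵐᵒᵖ`. -/

section Modules

/-- `A` is nonzero and is not a product of two nonzero rings: its only central idempotents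
are `0` and `1`. -/
def IsConnectedRing (A : Type u) [Ring A] : Prop :=
  Nontrivial A ∧ ∀ e : A, IsIdempotentElem e → e ∈ Subring.center A → e = 0 ∨ e = 1

/-- `A`, as a right module over itself, is a finite direct sum of pairwise nonisomorphic
indecomposable modules. -/
def IsBasicRing (A : Type u) [Ring A] : Prop :=
  ∃ (m : ℕ) (M : Fin m → ModuleCat.{u} Aᵐᵒᵖ),
    (∀ i, Indecomposable (M i)) ∧
    (∀ i j, Nonempty (M i ≅ M j) → i = j) ∧
    Nonempty (A ≃ₗ[Aᵐᵒᵖ] (∀ i, M i))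

/-- `A` is injective as a right module over itself. -/
def IsSelfInjective (A : Type u) [Ring A] : Prop :=
  Module.Injective Aᵐᵒᵖ A

variable {R : Type u} [Ring R]

/-- `ι : M → E` is an injective envelope: `E` is injective, and `ι` is an essential
monomorphism. -/
structure IsInjectiveEnvelope {M E : Type u} [AddCommGroup M] [Module R M]
    [AddCommGroup E] [Module R E] (ι : M →ₗ[R] E) : Prop where
  injective_module : Module.Injective R E
  injective : Function.Injective ι
  essential : ∀ N : Submodule R E, N ⊓ LinearMap.range ι = ⊥ → N = ⊥

/-- `π : P → M` is a projective cover: `P` is projective, and `π` is an epimorphism with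
superfluous kernel. -/
structure IsProjectiveCover {P M : Type u} [AddCommGroup P] [Module R P]
    [AddCommGroup M] [Module R M] (π : P →ₗ[R] M) : Prop where
  projective_module : Module.Projective R P
  surjective : Function.Surjective π
  superfluous : ∀ N : Submodule R P, N ⊔ LinearMap.ker π = ⊤ → N = ⊤

/-- `0 → M → E⁰ → E¹` is a minimal injective presentation of `M`: it is exact, `M → E⁰` is an
injective envelope, and so is the inclusion of the image of `E⁰` (that is, of `E⁰ / M`)
into `E¹`. -/
structure IsMinimalInjectivePresentation {M E₀ E₁ : Type u} [AddCommGroup M] [Module R M]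
    [AddCommGroup E₀] [Module R E₀] [AddCommGroup E₁] [Module R E₁]
    (s : M →ₗ[R] E₀) (f : E₀ →ₗ[R] E₁) : Prop where
  exact : Function.Exact s f
  envelope₀ : IsInjectiveEnvelope s
  envelope₁ : IsInjectiveEnvelope (LinearMap.range f).subtype

variable (R) in
/-- The socle of a module: the sum of its simple submodules. -/
def socle (M : Type u) [AddCommGroup M] [Module R M] : Submodule R M :=
  sSup {N : Submodule R M | IsSimpleModule R N}

variable (R) in
/-- The top of a module: its quotient by the radical. -/
abbrev top (M : Type u) [AddCommGroup M] [Module R M] : Type u :=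
  M ⧸ Module.jacobson R M

/-- `P` is a complete set of nonisomorphic indecomposable finitely generated projective
`R`-modules. -/
structure IsCompleteSetOfIndecProj {ι : Type} (P : ι → ModuleCat.{u} R) : Prop where
  finite : ∀ i, Module.Finite R (P i)
  projective : ∀ i, Module.Projective R (P i)
  indecomposable : ∀ i, Indecomposable (P i)
  nonisomorphic : ∀ i j, Nonempty (P i ≅ P j) → i = j
  complete : ∀ M : ModuleCat.{u} R, Module.Finite R M → Module.Projective R M →
    Indecomposable M → ∃ i, Nonempty (M ≅ P i)

/-- `σ` is the Nakayama permutation with respect to the indecomposable projective modules `P i`: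
the socle of `P i` is isomorphic to the top of `P (σ i)`. -/
def IsNakayamaPermutation {ι : Type} (P : ι → ModuleCat.{u} R) (σ : Equiv.Perm ι) : Prop :=
  ∀ i, Nonempty (socle R (P i) ≃ₗ[R] top R (P (σ i)))

end Modules

/-! ### The category of finitely generated modules -/

section FG

instance isFG_isClosedUnderFiniteProducts (R : Type u) [Ring R] :
    (ModuleCat.isFG.{u} R).IsClosedUnderFiniteProducts where
  isClosedUnderLimitsOfShape J _ :=
    { limitsOfShape_le := by
        rintro X ⟨p⟩
        have h (j : J) : Module.Finite R (p.diag.obj ⟨j⟩) := p.prop_diag_obj ⟨j⟩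
        have e : X ≅ ∏ᶜ (fun j : J => p.diag.obj ⟨j⟩) :=
          p.isLimit.conePointUniqueUpToIso (limit.isLimit p.diag) ≪≫
            HasLimit.isoOfNatIso Discrete.natIsoFunctor
        exact (Module.Finite.equiv_iff e.toLinearEquiv).mpr inferInstance }

instance hasFiniteBiproducts_fgModuleCat (R : Type u) [Ring R] :
    HasFiniteBiproducts (FGModuleCat.{u} R) :=
  HasFiniteBiproducts.of_hasFiniteProducts

instance hasBinaryBiproducts_fgModuleCat (R : Type u) [Ring R] :
    HasBinaryBiproducts (FGModuleCat.{u} R) :=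
  hasBinaryBiproducts_of_finite_biproducts _

instance hasZeroObject_fgModuleCat (R : Type u) [Ring R] :
    HasZeroObject (FGModuleCat.{u} R) :=
  hasZeroObject_of_hasTerminal_object

/-- For a `K`-algebra `A`, the category of `A`-modules is `K`-linear: `(k • f) x = k • f x`, where
`K` acts on modules through `K → A`. -/
instance linearOfAlgebra (K : Type v) [CommRing K] (A : Type u) [Ring A] [Algebra K A] :
    Linear K (ModuleCat.{u} A) :=
  letI (M : ModuleCat.{u} A) : Module K M := Module.restrictScalars K A M
  haveI (M : ModuleCat.{u} A) : IsScalarTower K A M := IsScalarTower.restrictScalars K A M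
  { homModule _ _ := inferInstance }

end FG

/-! ### Triangulated categories -/

section Triangulated

variable {C : Type*} [Category* C] [HasZeroObject C] [HasShift C ℤ] [Preadditive C]
  [∀ n : ℤ, (shiftFunctor C n).Additive] [Pretriangulated C]

/-- `add T`: direct summands of finite direct sums of copies of `T`. -/
def addClosure [HasFiniteBiproducts C] (T : C) : ObjectProperty C := fun X =>
  ∃ (m : ℕ) (Y : C), Nonempty ((X ⊞ Y) ≅ ⨁ (fun _ : Fin m => T))

/-- The smallest full triangulated subcategory, closed under isomorphisms, that contains `P`
(no closure under direct summands is built in). -/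
def triangulatedHull (P : ObjectProperty C) : ObjectProperty C := fun X =>
  ∀ Q : ObjectProperty C, Q.IsTriangulated → Q.IsClosedUnderIsomorphisms → P ≤ Q → Q X

end Triangulated

/-! ### Tilting complexes over a ring `A` -/

section Tilting

/-- The homotopy category of cochain complexes of finitely generated right `A`-modules. -/
abbrev KMod (A : Type u) [Ring A] : Type (u + 1) :=
  HomotopyCategory (FGModuleCat.{u} Aᵐᵒᵖ) (ComplexShape.up ℤ)

instance hasFiniteBiproducts_kMod (A : Type u) [Ring A] : HasFiniteBiproducts (KMod A) :=
  haveI : HasBinaryProducts (KMod A) := inferInstance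
  haveI : HasTerminal (KMod A) := inferInstance
  haveI : HasFiniteProducts (KMod A) := hasFiniteProducts_of_has_binary_and_terminal
  HasFiniteBiproducts.of_hasFiniteProducts

variable (A : Type u) [Ring A]

/-- The bounded homotopy category of finitely generated projective right `A`-modules, as a full
subcategory of `KMod A` (closed under isomorphisms). -/
def boundedProjectives : ObjectProperty (KMod A) := fun X =>
  ∃ Y : CochainComplex (FGModuleCat.{u} Aᵐᵒᵖ) ℤ,
    (∀ n, Module.Projective Aᵐᵒᵖ (Y.X n)) ∧
    (∃ a b : ℤ, ∀ n, n < a ∨ b < n → IsZero (Y.X n)) ∧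
    Nonempty (X ≅ (HomotopyCategory.quotient _ _).obj Y)

variable {A}

/-- `T` is a tilting complex for `A`: it is a bounded complex of finitely generated projective
modules, `Hom(T, T[j]) = 0` for `j ≠ 0`, and `add T` generates the bounded homotopy category of
finitely generated projectives as a triangulated category. -/
structure IsTiltingComplex (T : KMod A) : Prop where
  mem : boundedProjectives A T
  hom_shift_eq_zero : ∀ j : ℤ, j ≠ 0 → ∀ g : T ⟶ T⟦j⟧, g = 0
  generates : triangulatedHull (addClosure T) = boundedProjectives A

/-- A module, as a complex concentrated in degree zero. -/
abbrev stalk (M : FGModuleCat.{u} Aᵐᵒᵖ) : KMod A :=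
  (HomotopyCategory.singleFunctor (FGModuleCat.{u} Aᵐᵒᵖ) 0).obj M

/-- The mapping cone of a homomorphism of modules; its source is in degree `-1` and its target in
degree `0`. -/
def coneComplex {E₀ E₁ : FGModuleCat.{u} Aᵐᵒᵖ} (f : E₀ ⟶ E₁) : KMod A :=
  (HomotopyCategory.quotient _ _).obj
    (CochainComplex.mappingCone
      ((CochainComplex.singleFunctor (FGModuleCat.{u} Aᵐᵒᵖ) 0).map f))

variable {n : ℕ} (P : Fin n → FGModuleCat.{u} Aᵐᵒᵖ) (t : Fin n)
  {E₀ E₁ : FGModuleCat.{u} Aᵐᵒᵖ} (f : E₀ ⟶ E₁)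

/-- The complex `T = (⨁_{i ≠ t} P i) ⊕ E`, where `E` is the mapping cone of `f`. -/
def reflectionComplex : KMod A :=
  stalk (⨁ fun i : {i : Fin n // i ≠ t} => P i) ⊞ coneComplex f

/-- The summand of `reflectionComplex P t f` that belongs to the index `i`: it is `P i` for
`i ≠ t`, and the mapping cone of `f` for `i = t`. -/
def reflectionSummand (i : Fin n) : KMod A :=
  if i = t then coneComplex f else stalk (P i)

/-- The right module `Hom(T, Tᵢ)` over `End T`, where `T = reflectionComplex P t f` and `Tᵢ` is
its summand with index `i`. -/
def reflectionProjective (i : Fin n) : ModuleCat.{u} (End (reflectionComplex P t f))ᵐᵒᵖ :=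
  (preadditiveCoyonedaObj (reflectionComplex P t f)).obj (reflectionSummand P t f i)

end Tilting

end Reflection

end

/-! Over the selfinjective artinian ring Λ, finitely generated projective and injective modules
coincide, and the indecomposable ones P_i have simple socles, permuted by σ: soc P_i ≅ top P_{σ i}
(`exists_nakayama`). The module E⁰ ≅ P_t has top and socle S, so σ t = t. Three facts about S carry
the proof. First, Ext¹(S,S) = 0 keeps S out of the socle of E¹: the preimage in E⁰ of a copy of S in
the image of f would be a self-extension of S, which would split, against the simple socle of E⁰.
Second, if S were a quotient of the projective module E¹, then P_t, whose socle is S, would be a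
summand of E¹; hence S does not occur in the top of E¹, and E¹ lies in add T₁. Third, E⁰ is not
simple, because a simple module that is projective and injective cuts out a central idempotent,
against connectedness and n > 1 (`exists_hom_ne_zero_of_connected`). `IsReflectionFamily` collects
these facts.

Tilting: the computations with the cone E use only its triangle E⁰ → E¹ → E → E⁰[1] and the
vanishing of maps between different shifts of modules (`IsConeOf`, `HomShiftVanishes`). Outside
degree zero two kinds of maps could survive. A map from E⁰ to T₁ or E¹ is not injective, so it kills
soc E⁰ = ker f and extends along f, which makes it null-homotopic. A map from T₁ or E¹ to E⁰ that is
killed by f lands in S, which is not a quotient of its source. For generation, E¹ lies in add T₁, so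
the triangle returns E⁰ ≅ P_t, and brutal truncations build every bounded complex from its terms.

Selfinjectivity: an artinian ring is selfinjective if homomorphisms from each simple module, left or
right, to the ring form a module of length at most one; counting lengths then yields Baer's
criterion (`isSelfInjective_of_hom_simple`). For the endomorphism ring of a sum of objects T_i with
local endomorphism rings it suffices to have maps T_{σ i} → T_i that nonisomorphisms annihilate and
to which every nonzero map into T_i or out of T_{σ i} can be completed (`IsUniversalSocleMap`,
`IsNakayamaFamily`). The same maps exhibit σ as the Nakayama permutation of Γ. For i ≠ t the socle
map P_{σ i} → P_i still works. For the cone, extend the top-to-socle map E⁰ → S → E⁰ along f to w :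
E¹ → E⁰; the map E → E¹ → E obtained from w followed by f is the one required
(`isUniversalSocleMap_cone`), the completions coming from `exists_of_hom_to_injective` and
`exists_of_hom_from_projective`. -/

noncomputable section

namespace Reflection

open Pretriangulated

set_option linter.unusedSectionVars false

/-! ### A criterion for selfinjectivity -/

section QuasiFrobenius

variable {A B : Type*} [Ring A] [Ring B] {U : Type*} [AddCommGroup U] [Module A U] [Module B U]
  [SMulCommClass A B U]

variable (B U) in
/-- Precomposition, as a linear map for the second module structure on the target. -/
def precompLinear {M N : Type*} [AddCommGroup M] [Module A M] [AddCommGroup N] [Module A N]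
    (g : M →ₗ[A] N) : (N →ₗ[A] U) →ₗ[B] (M →ₗ[A] U) where
  toFun f := f ∘ₗ g
  map_add' _ _ := rfl
  map_smul' _ _ := rfl

theorem precompLinear_exact {M : Type*} [AddCommGroup M] [Module A M] (N : Submodule A M) :
    Function.Exact (precompLinear B U N.mkQ) (precompLinear B U N.subtype) := by
  intro f
  constructor
  · intro h
    refine ⟨N.liftQ f fun x hx => ?_, ?_⟩
    · exact DFunLike.congr_fun h (⟨x, hx⟩ : N)
    · ext x; rfl
  · rintro ⟨g, rfl⟩
    ext x
    exact (congrArg g ((Submodule.Quotient.mk_eq_zero N).mpr x.2)).trans (map_zero g)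

theorem precompLinear_mkQ_injective {M : Type*} [AddCommGroup M] [Module A M]
    (N : Submodule A M) : Function.Injective (precompLinear B U N.mkQ) := by
  intro f g h
  ext x
  exact DFunLike.congr_fun h x

/-- Restriction to `N` need not be surjective, so its image takes the place of `Hom(N, U)`.
Comparing lengths later forces this image to be everything. -/
theorem length_hom_eq_add {M : Type*} [AddCommGroup M] [Module A M] (N : Submodule A M) :
    Module.length B (M →ₗ[A] U) = Module.length B ((M ⧸ N) →ₗ[A] U) +
      Module.length B (LinearMap.range (precompLinear B U N.subtype)) := by
  refine Module.length_eq_add_of_exact (precompLinear B U N.mkQ)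
    (precompLinear B U N.subtype).rangeRestrict (precompLinear_mkQ_injective N)
    (LinearMap.surjective_rangeRestrict _) ?_
  intro f
  rw [← precompLinear_exact (B := B) (U := U) N f, ← Subtype.coe_inj]
  rfl

theorem length_le_one_of_forall_smul {M : Type*} [AddCommGroup M] [Module B M]
    (h : ∀ x y : M, x ≠ 0 → ∃ b : B, y = b • x) : Module.length B M ≤ 1 := by
  rcases subsingleton_or_nontrivial M with hM | hM
  · rw [Module.length_eq_zero_iff.mpr hM]; exact zero_le
  · have : IsSimpleModule B M := by
      rw [isSimpleModule_iff_toSpanSingleton_surjective]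
      refine ⟨hM, fun x hx y => ?_⟩
      obtain ⟨b, rfl⟩ := h x y hx
      exact ⟨b, rfl⟩
    exact (Module.length_eq_one_iff.mpr this).le

/-- If `Hom(S, U)` has length at most one for every simple module `S`, then
the length of `Hom(M, U)` is at most the length of `M`. -/
theorem length_hom_le
    (h : ∀ (S : Type u) [AddCommGroup S] [Module A S] [IsSimpleModule A S] (φ ψ : S →ₗ[A] U),
      φ ≠ 0 → ∃ b : B, ψ = b • φ)
    {M : Type u} [AddCommGroup M] [Module A M] (hM : IsFiniteLength A M) :
    Module.length B (M →ₗ[A] U) ≤ Module.length A M := by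
  induction hM with
  | of_subsingleton =>
    rw [Module.length_eq_zero_iff.mpr inferInstance]; exact zero_le
  | @of_simple_quotient M _ _ N _ hN ih =>
    have h1 : Module.length A (M ⧸ N) = 1 := Module.length_eq_one_iff.mpr inferInstance
    rw [length_hom_eq_add N, Module.length_eq_add_of_exact N.subtype N.mkQ
      N.injective_subtype N.mkQ_surjective (LinearMap.exact_subtype_mkQ N), add_comm, h1]
    refine add_le_add ((Module.length_le_of_injective (Submodule.subtype _)
      (Submodule.injective_subtype _)).trans ih) (length_le_one_of_forall_smul ?_)
    exact fun x y hx => h (M ⧸ N) x y hx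

end QuasiFrobenius

/-- An artinian ring is selfinjective if for simple right and left modules `S`, the module
`Hom(S, A)` is zero or simple. -/
theorem isSelfInjective_of_hom_simple {A : Type u} [Ring A] [IsArtinianRing A]
    [IsArtinianRing Aᵐᵒᵖ]
    (hr : ∀ (S : Type u) [AddCommGroup S] [Module Aᵐᵒᵖ S] [IsSimpleModule Aᵐᵒᵖ S]
      (φ ψ : S →ₗ[Aᵐᵒᵖ] A), φ ≠ 0 → ∃ a : A, ψ = a • φ)
    (hl : ∀ (S : Type u) [AddCommGroup S] [Module A S] [IsSimpleModule A S]
      (φ ψ : S →ₗ[A] A), φ ≠ 0 → ∃ a : Aᵐᵒᵖ, ψ = a • φ) : IsSelfInjective A := by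
  let e : Aᵐᵒᵖ ≃ₗ[Aᵐᵒᵖ] A :=
    { MulOpposite.opAddEquiv.symm with
      map_smul' := fun a b => rfl }
  have : IsArtinian Aᵐᵒᵖ A := isArtinian_of_linearEquiv e
  have : IsNoetherian Aᵐᵒᵖ A := isNoetherian_of_linearEquiv e
  have finA : IsFiniteLength A A :=
    isFiniteLength_iff_isNoetherian_isArtinian.mpr ⟨inferInstance, inferInstance⟩
  have finO : IsFiniteLength Aᵐᵒᵖ A :=
    isFiniteLength_iff_isNoetherian_isArtinian.mpr ⟨inferInstance, inferInstance⟩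
  let e₁ : A ≃ₗ[Aᵐᵒᵖ] (A →ₗ[A] A) :=
    { toFun := fun a => LinearMap.toSpanSingleton A A a
      map_add' := fun a b => by ext; simp
      map_smul' := fun a b => by ext; simp
      invFun := fun f => f 1
      left_inv := fun a => by simp
      right_inv := fun f => by ext; simp }
  let e₂ : A ≃ₗ[A] (Aᵐᵒᵖ →ₗ[Aᵐᵒᵖ] A) :=
    { toFun := fun a => LinearMap.toSpanSingleton Aᵐᵒᵖ A a
      map_add' := fun a b => by ext; simp
      map_smul' := fun a b => by ext; simp
      invFun := fun f => f 1
      left_inv := fun a => by simp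
      right_inv := fun f => by ext; simp }
  -- Endomorphisms of the left regular module form the right regular module. So the bound for left
  -- modules compares the right length of the ring with its left length, which is what makes the
  -- count for right ideals tight.
  have le₁ : Module.length Aᵐᵒᵖ A ≤ Module.length A A := by
    rw [e₁.length_eq]; exact length_hom_le (B := Aᵐᵒᵖ) hl finA
  have le₂ : Module.length Aᵐᵒᵖ Aᵐᵒᵖ ≤ Module.length A (Aᵐᵒᵖ →ₗ[Aᵐᵒᵖ] A) := by
    rw [← e₂.length_eq, e.length_eq]; exact le₁
  refine Module.Baer.injective fun I g => ?_
  have finI : IsFiniteLength Aᵐᵒᵖ I :=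
    isFiniteLength_iff_isNoetherian_isArtinian.mpr ⟨inferInstance, inferInstance⟩
  have finQ : IsFiniteLength Aᵐᵒᵖ (Aᵐᵒᵖ ⧸ I) :=
    isFiniteLength_iff_isNoetherian_isArtinian.mpr ⟨inferInstance, inferInstance⟩
  have bI := length_hom_le (B := A) hr finI
  have bQ := length_hom_le (B := A) hr finQ
  rw [length_hom_eq_add I, Module.length_eq_add_of_exact I.subtype I.mkQ
    I.injective_subtype I.mkQ_surjective (LinearMap.exact_subtype_mkQ I)] at le₂
  have tI := Module.length_ne_top_iff.mpr finI
  have tQ := Module.length_ne_top_iff.mpr finQ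
  have hIA : Module.length A (I →ₗ[Aᵐᵒᵖ] A) ≠ ⊤ := ne_top_of_le_ne_top tI bI
  -- If some map on `I` did not extend, the bounds for `I` and for the quotient by `I` would add up
  -- to a strict inequality against `le₂`; all lengths are finite.
  have htop : LinearMap.range (precompLinear A A I.subtype) = ⊤ := by
    by_contra hne
    obtain ⟨h1, h2⟩ := isFiniteLength_iff_isNoetherian_isArtinian.mp
      (Module.length_ne_top_iff.mp hIA)
    have hlt := Submodule.length_lt hne
    have : Module.length A ((Aᵐᵒᵖ ⧸ I) →ₗ[Aᵐᵒᵖ] A) +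
        Module.length A (LinearMap.range (precompLinear A A I.subtype)) <
        Module.length Aᵐᵒᵖ I + Module.length Aᵐᵒᵖ (Aᵐᵒᵖ ⧸ I) := by
      rw [add_comm (Module.length Aᵐᵒᵖ I)]
      exact ENat.add_lt_add_of_le_of_lt (ne_top_of_le_ne_top tQ bQ) bQ (hlt.trans_le bI)
    exact absurd le₂ (not_le.mpr this)
  obtain ⟨g', hg'⟩ := LinearMap.range_eq_top.mp htop g
  exact ⟨g', fun x hx => DFunLike.congr_fun hg' ⟨x, hx⟩⟩

/-! ### Modules with local endomorphism ring -/

section LocalEnd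

variable {R : Type u} [Ring R]

/-- Fitting's lemma: the module is the direct sum of the kernel and the image of a high power of
`g`, so `g` is injective, hence bijective, or nilpotent. -/
theorem isLocalRing_end_of_isCompl {M : Type u} [AddCommGroup M] [Module R M] [IsArtinian R M]
    [IsNoetherian R M] [Nontrivial M]
    (h : ∀ p q : Submodule R M, IsCompl p q → p = ⊥ ∨ q = ⊥) :
    IsLocalRing (Module.End R M) := by
  refine IsLocalRing.of_isUnit_or_isUnit_one_sub_self fun g => ?_
  obtain ⟨m, hm⟩ := Filter.eventually_atTop.mp g.eventually_isCompl_ker_pow_range_pow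
  have hm' := hm (m + 1) (Nat.le_succ m)
  rcases h _ _ hm' with h0 | h0
  · left
    rw [Module.End.isUnit_iff]
    have : Function.Injective g := by
      have h1 : Function.Injective (g ^ (m + 1)) := LinearMap.ker_eq_bot.mp h0
      rw [pow_succ, Module.End.mul_eq_comp, LinearMap.coe_comp] at h1
      exact h1.of_comp
    exact IsArtinian.bijective_of_injective_endomorphism g this
  · right
    exact IsNilpotent.isUnit_one_sub ⟨m + 1, LinearMap.range_eq_bot.mp h0⟩

theorem eq_bot_or_eq_bot_of_indecomposable {M : ModuleCat.{u} R} (hM : Indecomposable M)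
    {p q : Submodule R M} (h : IsCompl p q) : p = ⊥ ∨ q = ⊥ := by
  have e : M ≅ (ModuleCat.of R p ⊞ ModuleCat.of R q) :=
    (Submodule.prodEquivOfIsCompl p q h).symm.toModuleIso ≪≫
      (ModuleCat.biprodIsoProd (ModuleCat.of R p) (ModuleCat.of R q)).symm
  rcases hM.2 _ _ e with h0 | h0
  · left
    rw [← Submodule.subsingleton_iff_eq_bot]
    exact ModuleCat.subsingleton_of_isZero h0
  · right
    rw [← Submodule.subsingleton_iff_eq_bot]
    exact ModuleCat.subsingleton_of_isZero h0

theorem nontrivial_of_indecomposable {M : ModuleCat.{u} R} (hM : Indecomposable M) :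
    Nontrivial M := by
  by_contra h
  rw [not_nontrivial_iff_subsingleton] at h
  exact hM.1 (ModuleCat.isZero_of_subsingleton M)

theorem isLocalRing_end_of_indecomposable {M : ModuleCat.{u} R} (hM : Indecomposable M)
    [IsArtinian R M] [IsNoetherian R M] : IsLocalRing (Module.End R M) :=
  have := nontrivial_of_indecomposable hM
  isLocalRing_end_of_isCompl fun _ _ => eq_bot_or_eq_bot_of_indecomposable hM

variable {M : Type u} [AddCommGroup M] [Module R M]

theorem bijective_or_bijective_one_sub [IsLocalRing (Module.End R M)] (g : M →ₗ[R] M) :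
    Function.Bijective g ∨ Function.Bijective (LinearMap.id - g : M →ₗ[R] M) := by
  rcases IsLocalRing.isUnit_or_isUnit_of_add_one
    (add_sub_cancel (g : Module.End R M) 1) with h | h
  · exact .inl ((Module.End.isUnit_iff _).mp h)
  · exact .inr ((Module.End.isUnit_iff _).mp h)

theorem nontrivial_of_isLocalRing_end (h : IsLocalRing (Module.End R M)) : Nontrivial M := by
  by_contra hM
  rw [not_nontrivial_iff_subsingleton] at hM
  exact zero_ne_one (α := Module.End R M) (by ext x; exact Subsingleton.elim _ _)

/-- A projective module with local endomorphism ring has at most one maximal submodule; more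
generally, the sum of two proper submodules is proper. -/
theorem sup_ne_top_of_projective [Module.Projective R M] [IsLocalRing (Module.End R M)]
    {N N' : Submodule R M} (hN : N ≠ ⊤) (hN' : N' ≠ ⊤) : N ⊔ N' ≠ ⊤ := by
  intro h
  have hs : Function.Surjective (N.mkQ ∘ₗ N'.subtype) := by
    intro y
    obtain ⟨x, rfl⟩ := N.mkQ_surjective y
    obtain ⟨a, ha, b, hb, rfl⟩ := Submodule.mem_sup.mp (h ▸ Submodule.mem_top : x ∈ N ⊔ N')
    refine ⟨⟨b, hb⟩, ?_⟩
    simpa using ha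
  -- The lift is an endomorphism with image in `N'` that agrees with the identity modulo `N`; as the
  -- endomorphism ring is local, it or its difference from the identity is bijective.
  obtain ⟨g, hg⟩ := Module.projective_lifting_property _ N.mkQ hs
  have h1 : LinearMap.range (N'.subtype ∘ₗ g) ≤ N' := by
    rintro _ ⟨x, rfl⟩; exact (g x).2
  have h2 : LinearMap.range (LinearMap.id - N'.subtype ∘ₗ g) ≤ N := by
    rintro _ ⟨x, rfl⟩
    have := DFunLike.congr_fun hg x
    rw [LinearMap.sub_apply, ← Submodule.Quotient.mk_eq_zero, Submodule.Quotient.mk_sub,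
      sub_eq_zero]
    exact this.symm
  rcases bijective_or_bijective_one_sub (N'.subtype ∘ₗ g) with hb | hb
  · exact hN' (top_le_iff.mp ((LinearMap.range_eq_top.mpr hb.2).symm.le.trans h1))
  · exact hN (top_le_iff.mp ((LinearMap.range_eq_top.mpr hb.2).symm.le.trans h2))

theorem eq_of_isCoatom_of_projective [Module.Projective R M] [IsLocalRing (Module.End R M)]
    {N N' : Submodule R M} (hN : IsCoatom N) (hN' : IsCoatom N') : N = N' := by
  by_contra hne
  exact sup_ne_top_of_projective hN.1 hN'.1 (hN.sup_eq_top_of_ne hN' hne)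

theorem jacobson_eq_of_isCoatom [Module.Projective R M] [IsLocalRing (Module.End R M)]
    {N : Submodule R M} (hN : IsCoatom N) : Module.jacobson R M = N := by
  refine le_antisymm (sInf_le hN) (le_sInf fun N' hN' => ?_)
  rw [eq_of_isCoatom_of_projective hN hN']

theorem isCoatom_jacobson [Module.Finite R M] [Module.Projective R M]
    [IsLocalRing (Module.End R M)] : IsCoatom (Module.jacobson R M) := by
  have := nontrivial_of_isLocalRing_end (R := R) (M := M) inferInstance
  obtain ⟨N, hN, -⟩ := (eq_top_or_exists_le_coatom (⊥ : Submodule R M)).resolve_left bot_ne_top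
  rwa [jacobson_eq_of_isCoatom hN]

theorem le_jacobson_of_ne_top [Module.Finite R M] [Module.Projective R M]
    [IsLocalRing (Module.End R M)] {N : Submodule R M} (hN : N ≠ ⊤) :
    N ≤ Module.jacobson R M := by
  obtain ⟨L, hL, hNL⟩ := (eq_top_or_exists_le_coatom N).resolve_left hN
  rwa [jacobson_eq_of_isCoatom hL]

/-- An injective module with local endomorphism ring is uniform. -/
theorem inf_ne_bot_of_injective [Module.Injective R M] [IsLocalRing (Module.End R M)]
    {N N' : Submodule R M} (hN : N ≠ ⊥) (hN' : N' ≠ ⊥) : N ⊓ N' ≠ ⊥ := by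
  intro h
  have hd : Disjoint N N' := disjoint_iff.mpr h
  let i : N × N' →ₗ[R] M := N.subtype.coprod N'.subtype
  have hi : Function.Injective i := by
    rw [← LinearMap.ker_eq_bot, LinearMap.ker_coprod_of_disjoint_range]
    · simp
    · simpa using hd
  -- The extension of the projection of `N ⊕ N'` to `N` kills `N'`, while its difference from the
  -- identity kills `N`. One of the two maps is bijective.
  obtain ⟨g, hg⟩ := Module.Injective.extension_property R M _ _ i hi
    (N.subtype ∘ₗ LinearMap.fst R N N')
  rcases bijective_or_bijective_one_sub g with hb | hb
  · refine hN' ((Submodule.eq_bot_iff _).mpr fun x hx => hb.1 ?_)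
    simpa [i] using DFunLike.congr_fun hg (0, ⟨x, hx⟩)
  · refine hN ((Submodule.eq_bot_iff _).mpr fun x hx => hb.1 ?_)
    have := DFunLike.congr_fun hg (⟨x, hx⟩, 0)
    simp [i] at this
    simp [this]

/-- If `M` has a smallest nonzero submodule, which is the image of `P → M` with `P` projective
and local, then the socle of `M` is the top of `P`. -/
theorem socle_equiv_top {P : Type u} [AddCommGroup P] [Module R P] [Module.Projective R P]
    [IsLocalRing (Module.End R P)] (φ : P →ₗ[R] M) (h0 : φ ≠ 0)
    (h : ∀ N : Submodule R M, N ≠ ⊥ → LinearMap.range φ ≤ N) :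
    Nonempty (socle R M ≃ₗ[R] top R P) := by
  have hatom : IsAtom (LinearMap.range φ) := by
    refine ⟨fun h1 => h0 (LinearMap.range_eq_bot.mp h1), fun N hN => ?_⟩
    by_contra hne
    exact absurd (h N hne) (not_le_of_gt hN)
  have hs : IsSimpleModule R (LinearMap.range φ) := isSimpleModule_iff_isAtom.mpr hatom
  have hsoc : socle R M = LinearMap.range φ := by
    refine le_antisymm (sSup_le fun N hN => ?_) (le_sSup hs)
    have hN' : IsAtom N := isSimpleModule_iff_isAtom.mp hN
    exact ((hN'.le_iff_eq hatom.1).mp (h N hN'.1)).symm.le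
  have hk : IsCoatom (LinearMap.ker φ) := by
    rw [← isSimpleModule_iff_isCoatom]
    exact IsSimpleModule.congr φ.quotKerEquivRange
  have hj := jacobson_eq_of_isCoatom hk
  exact ⟨(LinearEquiv.ofEq _ _ hsoc).trans
    (φ.quotKerEquivRange.symm.trans (Submodule.quotEquivOfEq _ _ hj.symm))⟩

/-- If a projective module with local endomorphism ring and another projective module both map
onto a simple module, then the former is a direct summand of the latter. -/
theorem exists_retraction_of_simple {P V : Type u} [AddCommGroup P] [Module R P]
    [Module.Projective R P] [IsLocalRing (Module.End R P)] [Module.Projective R M]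
    [AddCommGroup V] [Module R V] [IsSimpleModule R V]
    (p : P →ₗ[R] V) (hp : p ≠ 0) (q : M →ₗ[R] V) (hq : q ≠ 0) :
    ∃ (α : P →ₗ[R] M) (β : M →ₗ[R] P), β ∘ₗ α = LinearMap.id := by
  obtain ⟨α, hα⟩ := Module.projective_lifting_property q p (LinearMap.surjective_of_ne_zero hq)
  obtain ⟨β, hβ⟩ := Module.projective_lifting_property p q (LinearMap.surjective_of_ne_zero hp)
  -- The endomorphism `β α` is compatible with `p`, so `1 - β α` has its image in the kernel of `p`
  -- and cannot be onto.
  rcases bijective_or_bijective_one_sub (β ∘ₗ α) with h | h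
  · let e := LinearEquiv.ofBijective _ h
    refine ⟨α, e.symm.toLinearMap ∘ₗ β, ?_⟩
    ext x
    exact e.symm_apply_apply x
  · exfalso
    apply hp
    ext x
    obtain ⟨y, rfl⟩ := h.2 x
    have h1 : p (β (α y)) = p y := by
      rw [← LinearMap.comp_apply, hβ, ← LinearMap.comp_apply, hα]
    simp [h1]

end LocalEnd

/-! ### Decomposing finitely generated projective modules over artinian rings -/

section Complete

variable {R : Type u} [Ring R]

/-- A retraction `β α = 1` splits the module. -/
def equivProdOfRetraction {P M : Type u} [AddCommGroup P] [Module R P] [AddCommGroup M]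
    [Module R M] (α : P →ₗ[R] M) (β : M →ₗ[R] P) (h : β ∘ₗ α = LinearMap.id) :
    M ≃ₗ[R] P × LinearMap.ker β :=
  have hx (x : P) : β (α x) = x := DFunLike.congr_fun h x
  { toFun := fun m => (β m, ⟨m - α (β m), by simp [hx]⟩)
    map_add' := fun x y => by ext <;> simp; abel
    map_smul' := fun r x => by ext <;> simp [smul_sub]
    invFun := fun m => α m.1 + m.2
    left_inv := fun m => by simp
    right_inv := fun ⟨x, k, hk⟩ => by
      have hk' : β k = 0 := hk
      ext <;> simp [hx, hk'] }

theorem bijective_of_retraction {M : ModuleCat.{u} R} (hM : Indecomposable M) {P : Type u}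
    [AddCommGroup P] [Module R P] (hP : Nontrivial P) (α : P →ₗ[R] M) (β : M →ₗ[R] P)
    (h : β ∘ₗ α = LinearMap.id) : Function.Bijective β := by
  have hx (x : P) : β (α x) = x := DFunLike.congr_fun h x
  have hc : IsCompl (LinearMap.range α) (LinearMap.ker β) := by
    constructor
    · rw [Submodule.disjoint_def]
      rintro _ ⟨x, rfl⟩ h0
      rw [LinearMap.mem_ker, hx] at h0
      rw [h0, map_zero]
    · rw [codisjoint_iff, eq_top_iff]
      intro m _
      exact Submodule.mem_sup.mpr ⟨α (β m), ⟨_, rfl⟩, m - α (β m), by simp [hx], by abel⟩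
  refine ⟨?_, fun x => ⟨α x, hx x⟩⟩
  rcases eq_bot_or_eq_bot_of_indecomposable hM hc with h0 | h0
  · obtain ⟨x, hx0⟩ := exists_ne (0 : P)
    refine absurd ?_ hx0
    rw [← hx x, LinearMap.range_eq_bot.mp h0]; simp
  · exact LinearMap.ker_eq_bot.mp h0

/-- Every simple module is a quotient of an indecomposable projective module. -/
theorem IsCompleteSetOfIndecProj.exists_hom_ne_zero [IsArtinianRing R] {ι : Type}
    {P : ι → ModuleCat.{u} R} (hP : IsCompleteSetOfIndecProj P)
    (V : Type u) [AddCommGroup V] [Module R V] [IsSimpleModule R V] :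
    ∃ (i : ι) (p : P i →ₗ[R] V), p ≠ 0 := by
  -- Induction on the length of a projective module with a nonzero map to `V`: if it decomposes, the
  -- map is nonzero on one of two shorter summands. The induction is applied to the regular module,
  -- mapped to `V` by sending 1 to a nonzero element.
  have key : ∀ (d : ℕ∞) (X : ModuleCat.{u} R) (_ : Module.Finite R X) (_ : Module.Projective R X)
      (p : X →ₗ[R] V), p ≠ 0 → Module.length R X = d → ∃ (i : ι) (p : P i →ₗ[R] V), p ≠ 0 := by
    intro d
    induction d using WellFoundedLT.induction with
    | _ d ih =>
      intro X _ _ p hp hd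
      have hX : ¬ IsZero X := fun h => hp (by
        ext x
        have := ModuleCat.subsingleton_of_isZero h
        rw [Subsingleton.elim x 0]; simp)
      by_cases hI : Indecomposable X
      · obtain ⟨i, ⟨e⟩⟩ := hP.complete X inferInstance inferInstance hI
        refine ⟨i, p ∘ₗ e.toLinearEquiv.symm.toLinearMap, fun h => hp ?_⟩
        ext x
        simpa using DFunLike.congr_fun h (e.toLinearEquiv x)
      · rw [Indecomposable] at hI
        push Not at hI
        obtain ⟨Y, Z, e, hY, hZ⟩ := hI hX
        let e' : X ≃ₗ[R] Y × Z := (e ≪≫ ModuleCat.biprodIsoProd Y Z).toLinearEquiv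
        have hYn : Nontrivial Y := by
          by_contra h
          rw [not_nontrivial_iff_subsingleton] at h
          exact hY (ModuleCat.isZero_of_subsingleton Y)
        have hZn : Nontrivial Z := by
          by_contra h
          rw [not_nontrivial_iff_subsingleton] at h
          exact hZ (ModuleCat.isZero_of_subsingleton Z)
        have hYf : Module.Finite R Y := Module.Finite.of_surjective
          (LinearMap.fst R Y Z ∘ₗ e'.toLinearMap)
          ((LinearMap.fst_surjective (R := R)).comp e'.surjective)
        have hZf : Module.Finite R Z := Module.Finite.of_surjective
          (LinearMap.snd R Y Z ∘ₗ e'.toLinearMap)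
          ((LinearMap.snd_surjective (R := R)).comp e'.surjective)
        have hYZ : Module.Projective R (Y × Z) := Module.Projective.of_equiv e'
        have hYp : Module.Projective R Y := Module.Projective.of_split (LinearMap.inl R Y Z)
          (LinearMap.fst R Y Z) (by ext; simp)
        have hZp : Module.Projective R Z := Module.Projective.of_split (LinearMap.inr R Y Z)
          (LinearMap.snd R Y Z) (by ext; simp)
        have hYl : Module.length R Y ≠ 0 := (Module.length_pos (R := R)).ne'
        have hZl : Module.length R Z ≠ 0 := (Module.length_pos (R := R)).ne'
        have hlen : Module.length R Y + Module.length R Z = d := by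
          rw [← Module.length_prod R, ← e'.length_eq, hd]
        have h1 : Module.length R Y < d := by
          rw [← hlen]
          simpa using ENat.add_lt_add_of_le_of_lt (Module.length_ne_top (R := R) (M := Y)) le_rfl
            (pos_iff_ne_zero.mpr hZl)
        have h2 : Module.length R Z < d := by
          rw [← hlen]
          simpa using ENat.add_lt_add_of_lt_of_le (Module.length_ne_top (R := R) (M := Z))
            (pos_iff_ne_zero.mpr hYl) le_rfl
        by_cases hpY : p ∘ₗ e'.symm.toLinearMap ∘ₗ LinearMap.inl R Y Z = 0
        · by_cases hpZ : p ∘ₗ e'.symm.toLinearMap ∘ₗ LinearMap.inr R Y Z = 0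
          · exfalso
            apply hp
            have : p ∘ₗ e'.symm.toLinearMap = 0 := by
              apply LinearMap.prod_ext
              · simpa [LinearMap.comp_assoc] using hpY
              · simpa [LinearMap.comp_assoc] using hpZ
            ext x
            simpa using DFunLike.congr_fun this (e' x)
          · exact ih _ h2 Z inferInstance inferInstance _ hpZ rfl
        · exact ih _ h1 Y inferInstance inferInstance _ hpY rfl
  have := IsSimpleModule.nontrivial R V
  obtain ⟨x, hx⟩ := exists_ne (0 : V)
  refine key _ (ModuleCat.of R R) inferInstance inferInstance (LinearMap.toSpanSingleton R V x)
    (fun h => hx ?_) rfl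
  simpa using DFunLike.congr_fun h (1 : R)

/-- Over an artinian ring, finitely generated projective modules are finite direct sums of modules
from a family of projective modules with local endomorphism rings that generates the simple
modules. -/
theorem projective_induction [IsArtinianRing R] {ι : Type*} (P : ι → ModuleCat.{u} R)
    [∀ i, Module.Projective R (P i)] [∀ i, IsLocalRing (Module.End R (P i))]
    (Q : ModuleCat.{u} R → Prop)
    (h_zero : ∀ M : ModuleCat.{u} R, Subsingleton M → Q M)
    (h_sum : ∀ (i : ι) (M N : ModuleCat.{u} R), Module.Finite R N → Module.Projective R N → Q N →
      (M ≃ₗ[R] P i × N) → Q M)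
    (M : ModuleCat.{u} R) [Module.Finite R M] [Module.Projective R M]
    (hM : ∀ (V : Type u) [AddCommGroup V] [Module R V] [IsSimpleModule R V] (q : M →ₗ[R] V),
      q ≠ 0 → ∃ (i : ι) (p : P i →ₗ[R] V), p ≠ 0) : Q M := by
  have key : ∀ (d : ℕ∞) (M : ModuleCat.{u} R) (_ : Module.Finite R M) (_ : Module.Projective R M)
      (_ : ∀ (V : Type u) [AddCommGroup V] [Module R V] [IsSimpleModule R V] (q : M →ₗ[R] V),
        q ≠ 0 → ∃ (i : ι) (p : P i →ₗ[R] V), p ≠ 0), Module.length R M = d → Q M := by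
    intro d
    induction d using WellFoundedLT.induction with
    | _ d ih =>
      intro M _ _ hM hd
      rcases subsingleton_or_nontrivial M with h | h
      · exact h_zero M h
      obtain ⟨L, hL, -⟩ :=
        (eq_top_or_exists_le_coatom (⊥ : Submodule R M)).resolve_left bot_ne_top
      have hV : IsSimpleModule R (M ⧸ L) := isSimpleModule_iff_isCoatom.mpr hL
      have hq : L.mkQ ≠ 0 := fun h0 => hL.1 (by
        rw [← Submodule.ker_mkQ L, h0, LinearMap.ker_zero])
      obtain ⟨i, p, hp⟩ := hM (M ⧸ L) L.mkQ hq
      obtain ⟨α, β, hβ⟩ := exists_retraction_of_simple p hp L.mkQ hq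
      let e := equivProdOfRetraction α β hβ
      have : Module.Projective R (P i × LinearMap.ker β) := Module.Projective.of_equiv e
      have hpr : Module.Projective R (LinearMap.ker β) := Module.Projective.of_split
        (LinearMap.inr R (P i) _) (LinearMap.snd R (P i) _) (by ext; simp)
      have hfi : Module.Finite R (LinearMap.ker β) := inferInstance
      -- The complement of the summand `P i` is shorter, and its maps to simple modules extend by
      -- zero to `M`, so it inherits the hypothesis on simple quotients.
      refine h_sum i M (ModuleCat.of R (LinearMap.ker β)) hfi hpr ?_ e
      refine ih _ ?_ (ModuleCat.of R (LinearMap.ker β)) hfi hpr ?_ rfl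
      · rw [← hd]
        refine Submodule.length_lt fun h0 => ?_
        have := nontrivial_of_isLocalRing_end (R := R) (M := P i) inferInstance
        obtain ⟨x, hx⟩ := exists_ne (0 : P i)
        apply hx
        rw [LinearMap.ker_eq_top] at h0
        simpa [h0] using (DFunLike.congr_fun hβ x).symm
      · intro V _ _ _ q hq
        refine hM V (q ∘ₗ LinearMap.snd R _ _ ∘ₗ e.toLinearMap) fun h0 => hq ?_
        ext x
        simpa using DFunLike.congr_fun h0 (e.symm (0, x))
  exact key _ M inferInstance inferInstance hM rfl

end Complete

/-! ### Socle elements in rings with a complete set of idempotents -/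

section SocleElements

variable {B : Type u} [Ring B] {ι : Type} [Fintype ι]

/-- `x` belongs to `a B b`, and `N` annihilates it from both sides. -/
structure IsSocleElement (N : Set B) (a b x : B) : Prop where
  mul_left : a * x = x
  mul_right : x * b = x
  ann_left : ∀ y ∈ N, y * x = 0
  ann_right : ∀ y ∈ N, x * y = 0

/-- A simple module has a generator `s` fixed by `e (τ i)` that every homomorphism to the ring must
send to a socle element in the same corner. Two such elements differ by a right factor as soon as
the first is nonzero, and this factor then relates the two homomorphisms on all of `S`. -/
theorem hom_simple_of_socleElements (e : ι → B) (e_sum : ∑ i, e i = 1) (τ : Equiv.Perm ι)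
    (N : Set B) (hN : ∀ y ∈ N, ∀ b, IsUnit (1 - b * y))
    (e_mem : ∀ i j b, i ≠ j → e i * b * e j ∈ N)
    (h_exists : ∀ i x, x * e i = x → x ≠ 0 →
      ∃ h, h * x ≠ 0 ∧ IsSocleElement N (e (τ i)) (e i) (h * x))
    (h_mul : ∀ i x y, IsSocleElement N (e (τ i)) (e i) x → IsSocleElement N (e (τ i)) (e i) y →
      x ≠ 0 → ∃ g, y = x * g)
    (e_idem : ∀ i, e i * e i = e i)
    {S : Type u} [AddCommGroup S] [Module B S] [IsSimpleModule B S] (φ ψ : S →ₗ[B] B)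
    (hφ : φ ≠ 0) : ∃ g, ∀ s, ψ s = φ s * g := by
  have gen (s t : S) (hs : s ≠ 0) : ∃ b : B, b • s = t :=
    (isSimpleModule_iff_toSpanSingleton_surjective.mp inferInstance).2 s hs t
  -- Nakayama: if `y • s` were nonzero, it would generate `s` back by some `b`, so that the unit `1
  -- - b * y` would kill `s`.
  have ann (y : B) (hy : y ∈ N) (s : S) : y • s = 0 := by
    by_contra hne
    obtain ⟨b, hb⟩ := gen _ s hne
    have h0 : (1 - b * y) • s = 0 := by rw [sub_smul, one_smul, mul_smul, hb, sub_self]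
    have hs : s = 0 := by
      obtain ⟨c, hc⟩ := (hN y hy b).exists_left_inv
      rw [← one_smul B s, ← hc, mul_smul, h0, smul_zero]
    exact hne (by rw [hs, smul_zero])
  obtain ⟨s₀, hs₀⟩ : ∃ s, φ s ≠ 0 := by
    by_contra! h
    exact hφ (LinearMap.ext h)
  obtain ⟨i, hi⟩ : ∃ i, φ s₀ * e i ≠ 0 := by
    by_contra! h
    apply hs₀
    rw [← mul_one (φ s₀), ← e_sum, Finset.mul_sum, Finset.sum_eq_zero fun i _ => h i]
  obtain ⟨h, hne, hsoc⟩ := h_exists i (φ s₀ * e i) (by rw [mul_assoc, e_idem]) hi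
  set s := (e (τ i) * h) • s₀ with hs
  have hφs : φ s * e i ≠ 0 := by
    rw [hs, map_smul, smul_eq_mul, mul_assoc, mul_assoc, hsoc.mul_left]
    exact hne
  have hs0 : s ≠ 0 := fun h0 => hφs (by rw [h0, map_zero, zero_mul])
  have hes : e (τ i) • s = s := by rw [hs, smul_smul, ← mul_assoc, e_idem]
  have key (χ : S →ₗ[B] B) : IsSocleElement N (e (τ i)) (e i) (χ s) := by
    have hez : e (τ i) * χ s = χ s := by rw [← smul_eq_mul, ← map_smul, hes]
    have hann (y : B) (hy : y ∈ N) : y * χ s = 0 := by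
      rw [← smul_eq_mul, ← map_smul, ann y hy, map_zero]
    -- A nonzero component in another column `k` would be moved by `h_exists` into the corner of `τ
    -- k`. That passage goes through an element between distinct idempotents, which lies in `N` and
    -- kills the component.
    have h1 (k : ι) (hk : k ≠ i) : χ s * e k = 0 := by
      by_contra hne
      obtain ⟨g, hg, hg'⟩ := h_exists k (χ s * e k) (by rw [mul_assoc, e_idem]) hne
      apply hg
      rw [← hg'.mul_left, ← hez]
      have : e (τ k) * (g * (e (τ i) * χ s * e k)) =
          (e (τ k) * g * e (τ i)) * χ s * e k := by simp only [mul_assoc]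
      rw [this, hann _ (e_mem _ _ _ (fun h => hk (τ.injective h))), zero_mul]
    have h2 : χ s * e i = χ s := by
      conv_rhs => rw [← mul_one (χ s), ← e_sum, Finset.mul_sum]
      rw [Finset.sum_eq_single i (fun k _ hk => h1 k hk) (fun h => absurd (Finset.mem_univ i) h)]
    -- Annihilation from the right is known only after multiplication by some `g`. By simplicity `s`
    -- is a multiple of `g • s`, so `χ s` is a left multiple of a socle element.
    refine ⟨hez, h2, hann, fun y hy => ?_⟩
    by_cases hz : χ s = 0
    · rw [hz, zero_mul]
    obtain ⟨g, hg, hg'⟩ := h_exists i (χ s) h2 hz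
    have hgs : g • s ≠ 0 := fun h0 => hg (by rw [← smul_eq_mul, ← map_smul, h0, map_zero])
    obtain ⟨r, hr⟩ := gen _ s hgs
    have : χ s = r * (g * χ s) := by
      conv_lhs => rw [← hr, map_smul, map_smul, smul_eq_mul, smul_eq_mul]
    rw [this, mul_assoc, hg'.ann_right y hy, mul_zero]
  obtain ⟨g, hg⟩ := h_mul i _ _ (key φ) (key ψ) (fun h0 => hφs (by rw [h0, zero_mul]))
  refine ⟨g, fun t => ?_⟩
  obtain ⟨b, rfl⟩ := gen s t hs0
  rw [map_smul ψ b s, map_smul φ b s, hg, smul_eq_mul, smul_eq_mul, mul_assoc]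

end SocleElements

/-! ### Families of objects with a Nakayama permutation -/

section Categories

variable {C : Type*} [Category.{u} C] [Preadditive C]

theorem isIso_or_isIso_one_sub {X : C} [IsLocalRing (End X)] (g : X ⟶ X) :
    IsIso g ∨ IsIso (𝟙 X - g) := by
  rcases IsLocalRing.isUnit_or_isUnit_of_add_one
    (add_sub_cancel (show End X from g) (1 : End X)) with h | h
  · exact .inl ((isUnit_iff_isIso _).mp h)
  · exact .inr ((isUnit_iff_isIso _).mp h)

/-- Jacobson's identity: if `c` inverts `1 - vu`, then `1 + ucv` inverts `1 - uv`, with products in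
diagrammatic order. -/
theorem isIso_one_sub_comp {X Y : C} (u : X ⟶ Y) (v : Y ⟶ X) [IsIso (𝟙 Y - v ≫ u)] :
    IsIso (𝟙 X - u ≫ v) := by
  set c := inv (𝟙 Y - v ≫ u) with hc
  have h1 : c - v ≫ u ≫ c = 𝟙 Y := by
    have := IsIso.hom_inv_id (𝟙 Y - v ≫ u)
    rwa [Preadditive.sub_comp, Category.id_comp, Category.assoc] at this
  have h2 : c - c ≫ v ≫ u = 𝟙 Y := by
    have := IsIso.inv_hom_id (𝟙 Y - v ≫ u)
    rwa [Preadditive.comp_sub, Category.comp_id] at this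
  refine ⟨𝟙 X + u ≫ c ≫ v, ?_, ?_⟩
  · have : u ≫ (c - v ≫ u ≫ c) ≫ v = u ≫ v := by rw [h1, Category.id_comp]
    simp only [Preadditive.sub_comp, Preadditive.comp_sub, Category.assoc] at this
    simp only [Preadditive.sub_comp, Preadditive.comp_add, Category.assoc, Category.id_comp,
      Category.comp_id]
    rw [← this]; abel
  · have : u ≫ (c - c ≫ v ≫ u) ≫ v = u ≫ v := by rw [h2, Category.id_comp]
    simp only [Preadditive.sub_comp, Preadditive.comp_sub, Category.assoc] at this
    simp only [Preadditive.add_comp, Preadditive.comp_sub, Category.assoc, Category.id_comp,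
      Category.comp_id]
    rw [sub_eq_iff_eq_add] at this
    rw [this]; abel

theorem id_ne_zero_of_isLocalRing_end (X : C) [IsLocalRing (End X)] : 𝟙 X ≠ 0 :=
  fun h => one_ne_zero (α := End X) h

/-- If a composition through an object with local endomorphism ring is an isomorphism, then both
factors are. -/
theorem isIso_of_isIso_comp_of_local {X Y Z : C} [IsLocalRing (End Y)] (hX : 𝟙 X ≠ 0)
    (g : X ⟶ Y) (h : Y ⟶ Z) [IsIso (g ≫ h)] : IsIso g ∧ IsIso h := by
  let r := h ≫ inv (g ≫ h)
  have hr : g ≫ r = 𝟙 X := by simp [r, ← Category.assoc]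
  have hrg : IsIso g := by
    -- `r ≫ g` is an idempotent of a local ring; if its complement were invertible, `g` would
    -- vanish, and so would the identity of `X`.
    rcases isIso_or_isIso_one_sub (r ≫ g) with h' | h'
    · have : r ≫ g = 𝟙 Y := by
        rw [← cancel_epi (r ≫ g), Category.assoc, reassoc_of% hr, Category.comp_id]
      exact ⟨r, hr, this⟩
    · exfalso
      have : g ≫ (𝟙 Y - r ≫ g) = 0 := by
        rw [Preadditive.comp_sub, Category.comp_id, reassoc_of% hr, sub_self]
      have hg : g = 0 := by rwa [Preadditive.IsIso.comp_right_eq_zero] at this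
      apply hX
      rw [← hr, hg, zero_comp]
  exact ⟨hrg, IsIso.of_isIso_comp_left g h⟩

theorem indecomposable_of_isLocalRing_end [HasBinaryBiproducts C] (X : C) [IsLocalRing (End X)] :
    Indecomposable X := by
  have hX := id_ne_zero_of_isLocalRing_end X
  refine ⟨fun h => hX (h.eq_of_src _ _), fun Y Z e => ?_⟩
  by_contra! h
  have h1 : IsIso ((biprod.inl ≫ e.inv) ≫ (e.hom ≫ biprod.fst) : Y ⟶ Y) := by
    simp only [Category.assoc, Iso.inv_hom_id_assoc, biprod.inl_fst]; infer_instance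
  have h2 := (isIso_of_isIso_comp_of_local (X := Y)
    (fun h0 => h.1 ((IsZero.iff_id_eq_zero Y).mpr h0)) (biprod.inl ≫ e.inv)
    (e.hom ≫ biprod.fst)).2
  have h3 : IsIso (biprod.fst : Y ⊞ Z ⟶ Y) := IsIso.of_isIso_comp_left e.hom _
  have h4 : (biprod.inr : Z ⟶ Y ⊞ Z) = 0 := by
    rw [← cancel_mono (biprod.fst : Y ⊞ Z ⟶ Y)]; simp
  apply h.2
  rw [IsZero.iff_id_eq_zero, ← biprod.inr_snd (X := Y), h4, zero_comp]

theorem indecomposable_of_isLocalRing_module_end {R : Type u} [Ring R] (M : ModuleCat.{u} R)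
    [h : IsLocalRing (Module.End R M)] : Indecomposable M :=
  have hiso (g : M →ₗ[R] M) (hg : Function.Bijective g) : IsUnit (M := End M) (ModuleCat.ofHom g) :=
    (isUnit_iff_isIso _).mpr ((ConcreteCategory.isIso_iff_bijective _).mpr hg)
  have : Nontrivial (End M) := by
    refine ⟨0, 1, fun h0 => zero_ne_one (α := Module.End R M) ?_⟩
    exact congrArg ModuleCat.Hom.hom h0
  have : IsLocalRing (End M) := by
    refine IsLocalRing.of_isUnit_or_isUnit_one_sub_self fun g => ?_
    rcases bijective_or_bijective_one_sub g.hom with h | h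
    · exact .inl (hiso _ h)
    · exact .inr (hiso _ h)
  indecomposable_of_isLocalRing_end M

/-! #### The functor `Hom(X, -)` on `add X` -/

/-- `Y` is a direct summand of a finite direct sum of copies of `X`. -/
def InAdd (X Y : C) : Prop :=
  ∃ (m : ℕ) (s : Fin m → (Y ⟶ X)) (r : Fin m → (X ⟶ Y)), ∑ k, s k ≫ r k = 𝟙 Y

theorem map_comp_hom {X Y Z : C} (φ : (X ⟶ Y) →ₗ[(End X)ᵐᵒᵖ] (X ⟶ Z)) (a : X ⟶ X)
    (g : X ⟶ Y) : φ (a ≫ g) = a ≫ φ g :=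
  φ.map_smul (MulOpposite.op a) g

/-- Fullness of `Hom(X, -)` on `add X`: every `y` is the sum of the `(y s_k) r_k` with `y s_k` in
`End X`, so linearity determines `φ` by its values on the `r_k`. Together with `InAdd.hom_ext` this
carries module-theoretic decompositions back to `C`. -/
theorem InAdd.exists_hom {X Y Z : C} (hY : InAdd X Y) (φ : (X ⟶ Y) →ₗ[(End X)ᵐᵒᵖ] (X ⟶ Z)) :
    ∃ g : Y ⟶ Z, ∀ y, φ y = y ≫ g := by
  obtain ⟨m, s, r, h⟩ := hY
  refine ⟨∑ k, s k ≫ φ (r k), fun y => ?_⟩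
  have h1 : y = ∑ k, (y ≫ s k) ≫ r k := by
    simp only [Category.assoc, ← Preadditive.comp_sum, h, Category.comp_id]
  conv_lhs => rw [h1]
  rw [map_sum, Preadditive.comp_sum]
  exact Finset.sum_congr rfl fun k _ => (map_comp_hom φ _ _).trans (Category.assoc _ _ _)

theorem InAdd.hom_ext {X Y Z : C} (hY : InAdd X Y) {g g' : Y ⟶ Z}
    (h : ∀ y : X ⟶ Y, y ≫ g = y ≫ g') : g = g' := by
  obtain ⟨m, s, r, hs⟩ := hY
  rw [← Category.id_comp g, ← Category.id_comp g', ← hs]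
  simp only [Preadditive.sum_comp, Category.assoc, h]

theorem InAdd.nonempty_iso {X Y Z : C} (hY : InAdd X Y) (hZ : InAdd X Z)
    (e : (X ⟶ Y) ≃ₗ[(End X)ᵐᵒᵖ] (X ⟶ Z)) : Nonempty (Y ≅ Z) := by
  obtain ⟨g, hg⟩ := hY.exists_hom e.toLinearMap
  obtain ⟨g', hg'⟩ := hZ.exists_hom e.symm.toLinearMap
  refine ⟨⟨g, g', hY.hom_ext fun y => ?_, hZ.hom_ext fun y => ?_⟩⟩
  · rw [← Category.assoc, ← hg, ← hg']; simp
  · rw [← Category.assoc, ← hg', ← hg]; simp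

/-- The regular right module of `End X`. -/
def endEquivHom (X : C) : (End X)ᵐᵒᵖ ≃ₗ[(End X)ᵐᵒᵖ] (X ⟶ X) where
  toFun a := a.unop
  map_add' _ _ := rfl
  map_smul' _ _ := rfl
  invFun a := MulOpposite.op a
  left_inv _ := rfl
  right_inv _ := rfl

/-- Postcomposition as a map of right `End X`-modules. -/
def postcomp (X : C) {Y Z : C} (g : Y ⟶ Z) : (X ⟶ Y) →ₗ[(End X)ᵐᵒᵖ] (X ⟶ Z) where
  toFun y := y ≫ g
  map_add' _ _ := Preadditive.add_comp _ _ _ _ _ _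
  map_smul' _ _ := Category.assoc _ _ _

@[simp]
theorem postcomp_apply (X : C) {Y Z : C} (g : Y ⟶ Z) (y : X ⟶ Y) : postcomp X g y = y ≫ g := rfl

theorem InAdd.finite_and_projective {X Y : C} (hY : InAdd X Y) :
    Module.Finite (End X)ᵐᵒᵖ (X ⟶ Y) ∧ Module.Projective (End X)ᵐᵒᵖ (X ⟶ Y) := by
  obtain ⟨m, s, r, h⟩ := hY
  let i : (X ⟶ Y) →ₗ[(End X)ᵐᵒᵖ] (Fin m → (End X)ᵐᵒᵖ) :=
    LinearMap.pi fun k => (endEquivHom X).symm.toLinearMap ∘ₗ postcomp X (s k)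
  let p : (Fin m → (End X)ᵐᵒᵖ) →ₗ[(End X)ᵐᵒᵖ] (X ⟶ Y) :=
    ∑ k, postcomp X (r k) ∘ₗ (endEquivHom X).toLinearMap ∘ₗ LinearMap.proj k
  have hpi : p ∘ₗ i = LinearMap.id := by
    ext y
    simp [p, i, ← Preadditive.comp_sum, h]
  exact ⟨Module.Finite.of_surjective p fun y => ⟨i y, DFunLike.congr_fun hpi y⟩,
    Module.Projective.of_split i p hpi⟩

theorem InAdd.isLocalRing_end {X Y : C} (hY : InAdd X Y) [IsLocalRing (End Y)] :
    IsLocalRing (Module.End (End X)ᵐᵒᵖ (X ⟶ Y)) := by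
  have : Nontrivial (Module.End (End X)ᵐᵒᵖ (X ⟶ Y)) := by
    refine ⟨0, 1, fun h => id_ne_zero_of_isLocalRing_end Y (hY.hom_ext fun y => ?_)⟩
    rw [Category.comp_id, comp_zero]
    exact (DFunLike.congr_fun h y).symm
  refine IsLocalRing.of_isUnit_or_isUnit_one_sub_self fun φ => ?_
  obtain ⟨g, hg⟩ := hY.exists_hom φ
  rcases isIso_or_isIso_one_sub g with h | h
  · left
    rw [Module.End.isUnit_iff]
    refine ⟨fun a b hab => ?_, fun b => ⟨b ≫ inv g, ?_⟩⟩
    · rw [hg, hg, cancel_mono] at hab; exact hab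
    · rw [hg]; simp
  · right
    have hg' (y : X ⟶ Y) : (1 - φ) y = y ≫ (𝟙 Y - g) := by
      rw [LinearMap.sub_apply, hg, Preadditive.comp_sub, Category.comp_id]; rfl
    rw [Module.End.isUnit_iff]
    refine ⟨fun a b hab => ?_, fun b => ⟨b ≫ inv (𝟙 Y - g), ?_⟩⟩
    · rw [hg', hg', cancel_mono] at hab; exact hab
    · rw [hg', Category.assoc, IsIso.inv_hom_id, Category.comp_id]

end Categories

/-! ### Socle maps and the endomorphism ring of a direct sum -/

section NakayamaFamily

variable {C : Type*} [Category.{u} C] [Preadditive C] {ι : Type}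

/-- A morphism between members of the family `T` that is annihilated by all nonisomorphisms
between members of `T`, on both sides. -/
structure IsSocleMap (T : ι → C) {i j : ι} (x : T i ⟶ T j) : Prop where
  comp_left : ∀ (k : ι) (h : T k ⟶ T i), ¬ IsIso h → h ≫ x = 0
  comp_right : ∀ (k : ι) (g : T j ⟶ T k), ¬ IsIso g → x ≫ g = 0

/-- A family of pairwise nonisomorphic objects with local endomorphism rings, in which the nonzero
morphisms to `T i` and from `T (σ i)` are detected by the nonzero socle maps `T (σ i) ⟶ T i`. -/
structure IsNakayamaFamily (T : ι → C) (σ : Equiv.Perm ι) : Prop where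
  local_end : ∀ i, IsLocalRing (End (T i))
  nonisomorphic : ∀ i j, Nonempty (T i ≅ T j) → i = j
  exists_left : ∀ {i j : ι} (x : T j ⟶ T i), x ≠ 0 →
    ∃ h : T (σ i) ⟶ T j, h ≫ x ≠ 0 ∧ IsSocleMap T (h ≫ x)
  exists_right : ∀ {i j : ι} (x : T (σ j) ⟶ T i), x ≠ 0 →
    ∃ g : T i ⟶ T j, x ≫ g ≠ 0 ∧ IsSocleMap T (x ≫ g)
  factor_left : ∀ {i : ι} (x y : T (σ i) ⟶ T i), IsSocleMap T x → IsSocleMap T y → x ≠ 0 →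
    ∃ h : T (σ i) ⟶ T (σ i), y = h ≫ x
  factor_right : ∀ {i : ι} (x y : T (σ i) ⟶ T i), IsSocleMap T x → IsSocleMap T y → x ≠ 0 →
    ∃ g : T i ⟶ T i, y = x ≫ g

/-- A decomposition of `X` as a direct sum of the objects `T i`. -/
structure Decomposition [Fintype ι] (X : C) (T : ι → C) where
  inj : ∀ i, T i ⟶ X
  proj : ∀ i, X ⟶ T i
  inj_proj : ∀ i, inj i ≫ proj i = 𝟙 (T i)
  total : ∑ i, proj i ≫ inj i = 𝟙 X

attribute [simp] Decomposition.inj_proj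

variable {X : C} {T : ι → C} {σ : Equiv.Perm ι}

namespace Decomposition

variable [Fintype ι] (D : Decomposition X T)

theorem inj_proj_assoc (i : ι) {Z : C} (g : T i ⟶ Z) : D.inj i ≫ D.proj i ≫ g = g := by
  rw [← Category.assoc, D.inj_proj, Category.id_comp]

include D in
theorem inAdd (i : ι) : InAdd X (T i) :=
  ⟨1, fun _ => D.inj i, fun _ => D.proj i, by simp⟩

theorem exists_inj_comp_ne_zero {Z : C} {x : X ⟶ Z} (hx : x ≠ 0) : ∃ i, D.inj i ≫ x ≠ 0 := by
  by_contra! h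
  apply hx
  rw [← Category.id_comp x, ← D.total, Preadditive.sum_comp]
  exact Finset.sum_eq_zero fun i _ => by rw [Category.assoc, h, comp_zero]

theorem exists_comp_proj_ne_zero {Z : C} {x : Z ⟶ X} (hx : x ≠ 0) : ∃ i, x ≫ D.proj i ≠ 0 := by
  by_contra! h
  apply hx
  rw [← Category.comp_id x, ← D.total, Preadditive.comp_sum]
  exact Finset.sum_eq_zero fun i _ => by rw [← Category.assoc, h, zero_comp]

theorem comp_ne_zero_of_ne_zero {i j : ι} {x : T i ⟶ T j} (hx : x ≠ 0) :
    (D.proj i ≫ x ≫ D.inj j : End X) ≠ 0 := by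
  intro h
  apply hx
  have := congrArg (fun z => D.inj i ≫ z ≫ D.proj j) h
  simpa [D.inj_proj_assoc] using this

/-- A morphism between summands, as an endomorphism of the direct sum. -/
def ofHom {i j : ι} (x : T i ⟶ T j) : End X := D.proj i ≫ x ≫ D.inj j

/-- The idempotent of `End X` that belongs to the summand `T i`. -/
def idem (i : ι) : End X := D.proj i ≫ D.inj i

theorem idem_mul_idem (i : ι) : D.idem i * D.idem i = D.idem i := by
  rw [End.mul_def, idem, Category.assoc, inj_proj_assoc]

theorem sum_idem : ∑ i, D.idem i = 1 := D.total

/-- The endomorphisms of `X` that come from nonisomorphisms between summands. -/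
def radicalSet : Set (End X) :=
  {y | ∃ (j k : ι) (h : T j ⟶ T k), ¬ IsIso h ∧ y = D.proj j ≫ h ≫ D.inj k}

include D in
theorem exists_hom_simple_ne_zero (V : Type u) [AddCommGroup V] [Module (End X)ᵐᵒᵖ V]
    [IsSimpleModule (End X)ᵐᵒᵖ V] :
    ∃ (i : ι) (p : (preadditiveCoyonedaObj X).obj (T i) →ₗ[(End X)ᵐᵒᵖ] V), p ≠ 0 := by
  have := IsSimpleModule.nontrivial (End X)ᵐᵒᵖ V
  obtain ⟨s, hs⟩ := exists_ne (0 : V)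
  by_contra! h
  apply hs
  have h1 (i : ι) : MulOpposite.op (D.idem i) • s = 0 :=
    DFunLike.congr_fun (h i (LinearMap.toSpanSingleton (End X)ᵐᵒᵖ V s ∘ₗ
      (endEquivHom X).symm.toLinearMap ∘ₗ postcomp X (D.inj i))) (D.proj i)
  have h2 : ∑ i, MulOpposite.op (D.idem i) = 1 := by
    have := congrArg MulOpposite.opAddEquiv D.sum_idem
    rwa [map_sum] at this
  rw [← one_smul (End X)ᵐᵒᵖ s, ← h2, Finset.sum_smul, Finset.sum_eq_zero fun i _ => h1 i]

end Decomposition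

namespace IsNakayamaFamily

variable (hT : IsNakayamaFamily T σ)
include hT

theorem not_isIso {i j : ι} (hij : i ≠ j) (h : T i ⟶ T j) : ¬ IsIso h :=
  fun _ => hij (hT.nonisomorphic i j ⟨asIso h⟩)

theorem not_isIso_comp {i j k : ι} {g : T i ⟶ T j} {h : T j ⟶ T k}
    (hgh : ¬ IsIso g ∨ ¬ IsIso h) : ¬ IsIso (g ≫ h) := by
  have := hT.local_end
  intro hiso
  have := isIso_of_isIso_comp_of_local (id_ne_zero_of_isLocalRing_end (T i)) g h
  tauto

variable [Fintype ι] (D : Decomposition X T)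

/-- By Jacobson's identity the question moves from `End X` to the local ring `End (T k)` or `End (T
j)`, where a composite with the nonisomorphism `h` is not invertible. So these elements lie in the
Jacobson radical. -/
theorem isIso_one_sub_of_mem_radicalSet {y : End X} (hy : y ∈ D.radicalSet) (b : X ⟶ X) :
    IsIso (𝟙 X - y ≫ b) ∧ IsIso (𝟙 X - b ≫ y) := by
  obtain ⟨j, k, h, hh, rfl⟩ := hy
  have := hT.local_end
  constructor
  · have h1 : IsIso (𝟙 (T k) - (D.inj k ≫ b) ≫ (D.proj j ≫ h)) := by
      refine (isIso_or_isIso_one_sub _).resolve_left ?_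
      have := hT.not_isIso_comp (g := D.inj k ≫ b ≫ D.proj j) (.inr hh)
      simpa only [Category.assoc] using this
    have := isIso_one_sub_comp (D.proj j ≫ h) (D.inj k ≫ b)
    simpa only [Category.assoc] using this
  · have h1 : IsIso (𝟙 (T j) - (h ≫ D.inj k) ≫ (b ≫ D.proj j)) := by
      refine (isIso_or_isIso_one_sub _).resolve_left ?_
      have := hT.not_isIso_comp (h := D.inj k ≫ b ≫ D.proj j) (.inl hh)
      simpa only [Category.assoc] using this
    have := isIso_one_sub_comp (b ≫ D.proj j) (h ≫ D.inj k)
    simpa only [Category.assoc] using this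

/-- Multiplication in `End X` is composition in reverse order, so left multiplication is
postcomposition and the idempotent of the target stands on the left. -/
theorem isSocleElement_iff {i j : ι} (x : T i ⟶ T j) :
    IsSocleElement D.radicalSet (D.idem j) (D.idem i) (D.proj i ≫ x ≫ D.inj j) ↔
      IsSocleMap T x := by
  constructor
  · intro h
    refine ⟨fun k y hy => ?_, fun k y hy => ?_⟩
    · have := h.ann_right _ ⟨k, i, y, hy, rfl⟩
      rw [End.mul_def] at this
      have := congrArg (fun z => D.inj k ≫ z ≫ D.proj j) this
      simpa [D.inj_proj_assoc] using this
    · have := h.ann_left _ ⟨j, k, y, hy, rfl⟩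
      rw [End.mul_def] at this
      have := congrArg (fun z => D.inj i ≫ z ≫ D.proj k) this
      simpa [D.inj_proj_assoc] using this
  · intro h
    refine ⟨?_, ?_, ?_, ?_⟩
    · simp [End.mul_def, Decomposition.idem, D.inj_proj_assoc]
    · simp [End.mul_def, Decomposition.idem, D.inj_proj_assoc]
    · rintro _ ⟨a, b, y, hy, rfl⟩
      have h1 := h.comp_right b ((D.inj j ≫ D.proj a) ≫ y) (hT.not_isIso_comp (.inr hy))
      rw [End.mul_def]
      calc _ = D.proj i ≫ (x ≫ (D.inj j ≫ D.proj a) ≫ y) ≫ D.inj b := by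
            simp only [Category.assoc]
        _ = 0 := by rw [h1, zero_comp, comp_zero]
    · rintro _ ⟨a, b, y, hy, rfl⟩
      have h1 := h.comp_left a (y ≫ (D.inj b ≫ D.proj i)) (hT.not_isIso_comp (.inl hy))
      rw [End.mul_def]
      calc _ = D.proj a ≫ ((y ≫ (D.inj b ≫ D.proj i)) ≫ x) ≫ D.inj j := by
            simp only [Category.assoc]
        _ = 0 := by rw [h1, zero_comp, comp_zero]

theorem exists_of_isSocleElement {i j : ι} {x : End X}
    (hx : IsSocleElement D.radicalSet (D.idem j) (D.idem i) x) :
    ∃ y : T i ⟶ T j, IsSocleMap T y ∧ x = D.proj i ≫ y ≫ D.inj j := by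
  have h : x = D.proj i ≫ (D.inj i ≫ x ≫ D.proj j) ≫ D.inj j := by
    have h1 := hx.mul_left
    have h2 := hx.mul_right
    rw [End.mul_def] at h1 h2
    conv_lhs => rw [← h1, ← h2]
    simp only [Decomposition.idem, Category.assoc]
  exact ⟨_, (hT.isSocleElement_iff D _).mp (h ▸ hx), h⟩

include D in
/-- The endomorphism ring of the direct sum of a Nakayama family is selfinjective. -/
theorem isSelfInjective [IsArtinianRing (End X)] [IsArtinianRing (End X)ᵐᵒᵖ] :
    IsSelfInjective (End X) := by
  have idem_mem (i j : ι) (b : End X) (hij : i ≠ j) : D.idem i * b * D.idem j ∈ D.radicalSet :=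
    ⟨j, i, D.inj j ≫ b ≫ D.proj i, hT.not_isIso hij.symm _, by
      simp only [End.mul_def, Decomposition.idem, Category.assoc]⟩
  apply isSelfInjective_of_hom_simple
  · intro S _ _ _ φ ψ hφ
    -- Right modules are treated as left modules over the opposite ring, where left multiplication
    -- is precomposition. Hence maps into `T i` are completed from `T (σ i)`, and the permutation is
    -- `σ`.
    let e : End X ≃ₗ[(End X)ᵐᵒᵖ] (End X)ᵐᵒᵖ :=
      { toFun := MulOpposite.op
        map_add' := fun _ _ => rfl
        map_smul' := fun _ _ => rfl
        invFun := MulOpposite.unop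
        left_inv := fun _ => rfl
        right_inv := fun _ => rfl }
    have hiff {a b x : End X} : IsSocleElement (MulOpposite.op '' D.radicalSet)
        (MulOpposite.op a) (MulOpposite.op b) (MulOpposite.op x) ↔
        IsSocleElement D.radicalSet b a x := by
      constructor
      · intro h
        refine ⟨?_, ?_, ?_, ?_⟩
        · exact MulOpposite.op_injective h.mul_right
        · exact MulOpposite.op_injective h.mul_left
        · exact fun y hy => MulOpposite.op_injective (h.ann_right _ ⟨y, hy, rfl⟩)
        · exact fun y hy => MulOpposite.op_injective (h.ann_left _ ⟨y, hy, rfl⟩)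
      · intro h
        refine ⟨?_, ?_, ?_, ?_⟩
        · exact congrArg MulOpposite.op h.mul_right
        · exact congrArg MulOpposite.op h.mul_left
        · rintro _ ⟨y, hy, rfl⟩
          exact congrArg MulOpposite.op (h.ann_right y hy)
        · rintro _ ⟨y, hy, rfl⟩
          exact congrArg MulOpposite.op (h.ann_left y hy)
    suffices h : ∃ g, ∀ s, (e.toLinearMap ∘ₗ ψ) s = (e.toLinearMap ∘ₗ φ) s * g by
      obtain ⟨g, hg⟩ := h
      exact ⟨g.unop, LinearMap.ext fun s => MulOpposite.op_injective (hg s)⟩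
    refine hom_simple_of_socleElements (B := (End X)ᵐᵒᵖ)
      (fun i => MulOpposite.op (D.idem i)) ?_ σ (MulOpposite.op '' D.radicalSet) ?_ ?_ ?_ ?_ ?_
      (e.toLinearMap ∘ₗ φ) (e.toLinearMap ∘ₗ ψ) ?_
    · have := congrArg MulOpposite.opAddEquiv D.sum_idem
      rwa [map_sum] at this
    · rintro _ ⟨y, hy, rfl⟩ b
      have := (hT.isIso_one_sub_of_mem_radicalSet D hy b.unop).2
      exact IsUnit.op ((isUnit_iff_isIso _).mpr this : IsUnit (1 - y * b.unop))
    · intro i j b hij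
      exact ⟨D.idem j * b.unop * D.idem i, idem_mem j i _ hij.symm, by
        rw [MulOpposite.op_mul, MulOpposite.op_mul, MulOpposite.op_unop, mul_assoc]⟩
    · intro i x hx hx0
      have hx1 : x.unop ≫ D.idem i = x.unop := congrArg MulOpposite.unop hx
      have hx2 : x.unop ≫ D.proj i ≠ 0 := by
        intro h0
        apply hx0
        apply MulOpposite.unop_injective
        rw [← hx1, Decomposition.idem, ← Category.assoc, h0, zero_comp]; rfl
      obtain ⟨j, hj⟩ := D.exists_inj_comp_ne_zero hx2
      obtain ⟨h, hne, hsoc⟩ := hT.exists_left _ hj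
      refine ⟨MulOpposite.op (D.ofHom h), ?_⟩
      have heq : MulOpposite.op (D.ofHom h) * x =
          MulOpposite.op (D.proj (σ i) ≫ (h ≫ D.inj j ≫ x.unop ≫ D.proj i) ≫ D.inj i) := by
        apply MulOpposite.unop_injective
        change (D.proj (σ i) ≫ h ≫ D.inj j) ≫ x.unop = _
        conv_lhs => rw [← hx1]
        simp only [Decomposition.idem, Category.assoc]; rfl
      rw [heq]
      refine ⟨fun h0 => D.comp_ne_zero_of_ne_zero hne (MulOpposite.op_injective h0), ?_⟩
      exact hiff.mpr ((hT.isSocleElement_iff D _).mpr hsoc)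
    · intro i x y hx hy hx0
      obtain ⟨x', hx', hxx'⟩ := hT.exists_of_isSocleElement D (hiff.mp hx)
      obtain ⟨y', hy', hyy'⟩ := hT.exists_of_isSocleElement D (hiff.mp hy)
      have hx0' : x' ≠ 0 := by
        rintro rfl
        apply hx0
        apply MulOpposite.unop_injective
        rw [MulOpposite.unop_zero]
        exact hxx'.trans (by rw [zero_comp, comp_zero])
      obtain ⟨g, rfl⟩ := hT.factor_right x' y' hx' hy' hx0'
      refine ⟨MulOpposite.op (D.proj i ≫ g ≫ D.inj i), ?_⟩
      apply MulOpposite.unop_injective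
      change _ = x.unop ≫ D.proj i ≫ g ≫ D.inj i
      rw [show x.unop = _ from hxx']
      refine hyy'.trans ?_
      simp only [Category.assoc, D.inj_proj_assoc]
    · intro i
      exact congrArg MulOpposite.op (D.idem_mul_idem i)
    · exact fun h => hφ (LinearMap.ext fun s => e.injective (DFunLike.congr_fun h s))
  · intro S _ _ _ φ ψ hφ
    suffices h : ∃ g, ∀ s, ψ s = φ s * g by
      obtain ⟨g, hg⟩ := h
      exact ⟨MulOpposite.op g, LinearMap.ext hg⟩
    -- For left modules, maps out of `T (σ i)` are completed to `T i`, so the permutation is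
    -- inverted.
    refine hom_simple_of_socleElements (B := End X) D.idem D.sum_idem σ.symm
      D.radicalSet ?_ idem_mem ?_ ?_ D.idem_mul_idem φ ψ hφ
    · intro y hy b
      have := (hT.isIso_one_sub_of_mem_radicalSet D hy b).1
      exact ((isUnit_iff_isIso _).mpr this : IsUnit (1 - b * y))
    · intro i x hx hx0
      obtain ⟨i, rfl⟩ := σ.surjective i
      rw [Equiv.symm_apply_apply]
      have hx1 : D.idem (σ i) ≫ x = x := hx
      have hx2 : D.inj (σ i) ≫ x ≠ 0 := by
        intro h0
        apply hx0
        rw [← hx1, Decomposition.idem, Category.assoc, h0, comp_zero]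
      obtain ⟨j, hj⟩ := D.exists_comp_proj_ne_zero hx2
      obtain ⟨g, hne, hsoc⟩ := hT.exists_right _ hj
      refine ⟨D.ofHom g, ?_⟩
      have heq : D.ofHom g * x =
          D.proj (σ i) ≫ (((D.inj (σ i) ≫ x) ≫ D.proj j) ≫ g) ≫ D.inj i := by
        change x ≫ D.proj j ≫ g ≫ D.inj i = _
        conv_lhs => rw [← hx1]
        simp only [Decomposition.idem, Category.assoc]
      rw [heq]
      exact ⟨D.comp_ne_zero_of_ne_zero hne, (hT.isSocleElement_iff D _).mpr hsoc⟩
    · intro i x y hx hy hx0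
      obtain ⟨i, rfl⟩ := σ.surjective i
      rw [Equiv.symm_apply_apply] at hx hy
      obtain ⟨x', hx', rfl⟩ := hT.exists_of_isSocleElement D hx
      obtain ⟨y', hy', rfl⟩ := hT.exists_of_isSocleElement D hy
      have hx0' : x' ≠ 0 := by
        rintro rfl
        apply hx0
        rw [zero_comp, comp_zero]
      obtain ⟨h, rfl⟩ := hT.factor_left x' y' hx' hy' hx0'
      refine ⟨D.proj (σ i) ≫ h ≫ D.inj (σ i), ?_⟩
      change _ = (D.proj (σ i) ≫ h ≫ D.inj (σ i)) ≫ D.proj (σ i) ≫ x' ≫ D.inj i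
      simp only [Category.assoc, D.inj_proj_assoc]

include D in
theorem isLocalRing_end_hom (i : ι) :
    IsLocalRing (Module.End (End X)ᵐᵒᵖ ((preadditiveCoyonedaObj X).obj (T i))) :=
  have := hT.local_end i
  (D.inAdd i).isLocalRing_end

-- For completeness, a simple quotient of `M` is also a quotient of some `Hom(X, T i)`. Both modules
-- are projective and the latter has a local endomorphism ring, so it is a summand of `M`, hence
-- isomorphic to the indecomposable module `M`.
include D in
theorem isCompleteSetOfIndecProj [IsArtinianRing (End X)ᵐᵒᵖ] :
    IsCompleteSetOfIndecProj fun i => (preadditiveCoyonedaObj X).obj (T i) where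
  finite i := (D.inAdd i).finite_and_projective.1
  projective i := (D.inAdd i).finite_and_projective.2
  indecomposable i := by
    have := hT.isLocalRing_end_hom D i
    exact indecomposable_of_isLocalRing_module_end _
  nonisomorphic i j := by
    rintro ⟨e⟩
    exact hT.nonisomorphic i j ((D.inAdd i).nonempty_iso (D.inAdd j) e.toLinearEquiv)
  complete M _ _ hM := by
    have := nontrivial_of_indecomposable hM
    obtain ⟨L, hL, -⟩ :=
      (eq_top_or_exists_le_coatom (⊥ : Submodule (End X)ᵐᵒᵖ M)).resolve_left bot_ne_top
    have hV : IsSimpleModule (End X)ᵐᵒᵖ (M ⧸ L) := isSimpleModule_iff_isCoatom.mpr hL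
    have hq : L.mkQ ≠ 0 := fun h0 => hL.1 (by
      rw [← Submodule.ker_mkQ L, h0, LinearMap.ker_zero])
    obtain ⟨i, p, hp⟩ := D.exists_hom_simple_ne_zero (M ⧸ L)
    have this' := hT.isLocalRing_end_hom D i
    have : Module.Projective (End X)ᵐᵒᵖ ((preadditiveCoyonedaObj X).obj (T i)) :=
      (D.inAdd i).finite_and_projective.2
    obtain ⟨α, β, hβ⟩ := exists_retraction_of_simple p hp L.mkQ hq
    exact ⟨i, ⟨(LinearEquiv.ofBijective β
      (bijective_of_retraction hM (nontrivial_of_isLocalRing_end this') α β hβ)).toModuleIso⟩⟩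

-- The image of postcomposition with a socle map `x` lies in every nonzero submodule: a nonzero
-- element can be precomposed to a nonzero socle map, and `x` is a multiple of that one.
include D in
theorem socle_hom_equiv_top_hom (i : ι) :
    Nonempty (socle (End X)ᵐᵒᵖ (X ⟶ T i) ≃ₗ[(End X)ᵐᵒᵖ] top (End X)ᵐᵒᵖ (X ⟶ T (σ i))) := by
  have : IsLocalRing (Module.End (End X)ᵐᵒᵖ (X ⟶ T (σ i))) := hT.isLocalRing_end_hom D (σ i)
  have : Module.Projective (End X)ᵐᵒᵖ (X ⟶ T (σ i)) := (D.inAdd (σ i)).finite_and_projective.2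
  have := hT.local_end i
  obtain ⟨x, hx0, hx⟩ := hT.exists_left (𝟙 (T i)) (id_ne_zero_of_isLocalRing_end _)
  rw [Category.comp_id] at hx0 hx
  refine socle_equiv_top (postcomp X x) (fun h0 => hx0 ?_) fun N hN => ?_
  · have : D.proj (σ i) ≫ x = 0 := DFunLike.congr_fun h0 (D.proj (σ i))
    rw [← D.inj_proj_assoc (σ i) x, this, comp_zero]
  · obtain ⟨y, hy, hy0⟩ := (Submodule.ne_bot_iff _).mp hN
    obtain ⟨j, hj⟩ := D.exists_inj_comp_ne_zero (x := y) hy0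
    obtain ⟨h, hne, hsoc⟩ := hT.exists_left _ hj
    obtain ⟨g, hg⟩ := hT.factor_left _ x hsoc hx hne
    rintro _ ⟨z, rfl⟩
    have h1 : z ≫ x = (z ≫ g ≫ h ≫ D.inj j) ≫ y := by
      rw [hg]
      simp only [Category.assoc]
    rw [postcomp_apply, h1]
    exact N.smul_mem (MulOpposite.op (z ≫ g ≫ h ≫ D.inj j)) hy

include D in
theorem isNakayamaPermutation :
    IsNakayamaPermutation (fun i => (preadditiveCoyonedaObj X).obj (T i)) σ :=
  hT.socle_hom_equiv_top_hom D

end IsNakayamaFamily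

end NakayamaFamily

/-! ### Modules over selfinjective artinian rings -/

section SelfInjective

variable {R : Type u} [Ring R]

theorem injective_of_retract {M N : Type u} [AddCommGroup M] [Module R M] [AddCommGroup N]
    [Module R N] [Module.Injective R N] (i : M →ₗ[R] N) (r : N →ₗ[R] M)
    (h : r ∘ₗ i = LinearMap.id) : Module.Injective R M where
  out X Y _ _ _ _ g hg k := by
    obtain ⟨l, hl⟩ := Module.Injective.out g hg (i ∘ₗ k)
    refine ⟨r ∘ₗ l, fun x => ?_⟩
    have := DFunLike.congr_fun h (k x)
    simpa [hl] using this

theorem injective_of_finite_projective [Module.Injective R R] (M : Type u) [AddCommGroup M]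
    [Module R M] [Module.Finite R M] [Module.Projective R M] : Module.Injective R M := by
  obtain ⟨m, p, hp⟩ := Module.Finite.exists_fin' R M
  obtain ⟨i, hi⟩ := Module.projective_lifting_property p LinearMap.id hp
  exact injective_of_retract i p hi

/-- A homomorphism to an injective module factors through any homomorphism with smaller kernel. -/
theorem exists_factor_of_ker_le {M N I : Type u} [AddCommGroup M] [Module R M] [AddCommGroup N]
    [Module R N] [AddCommGroup I] [Module R I] [Module.Injective R I] (f : M →ₗ[R] N)
    (g : M →ₗ[R] I) (h : LinearMap.ker f ≤ LinearMap.ker g) : ∃ b : N →ₗ[R] I, b ∘ₗ f = g := by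
  obtain ⟨b, hb⟩ := Module.Injective.out (LinearMap.range f).subtype
    (LinearMap.range f).injective_subtype
    ((LinearMap.ker f).liftQ g h ∘ₗ f.quotKerEquivRange.symm.toLinearMap)
  refine ⟨b, LinearMap.ext fun x => ?_⟩
  refine (hb ⟨f x, x, rfl⟩).trans ?_
  have : f.quotKerEquivRange.symm ⟨f x, x, rfl⟩ = (LinearMap.ker f).mkQ x := by
    rw [LinearEquiv.symm_apply_eq]; rfl
  simp [this]

/-- A homomorphism from a projective module factors through any homomorphism with larger image. -/
theorem exists_factor_of_range_le {P M N : Type u} [AddCommGroup M] [Module R M] [AddCommGroup N]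
    [Module R N] [AddCommGroup P] [Module R P] [Module.Projective R P] (f : M →ₗ[R] N)
    (g : P →ₗ[R] N) (h : LinearMap.range g ≤ LinearMap.range f) :
    ∃ b : P →ₗ[R] M, f ∘ₗ b = g := by
  obtain ⟨b, hb⟩ := Module.projective_lifting_property f.rangeRestrict
    (g.codRestrict (LinearMap.range f) fun x => h ⟨x, rfl⟩) f.surjective_rangeRestrict
  refine ⟨b, LinearMap.ext fun x => ?_⟩
  exact congrArg Subtype.val (DFunLike.congr_fun hb x)

/-- Over an artinian ring `X / rad X` is semisimple. Its quotient `Y / p(rad X)` is then semisimple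
too, and so has zero radical. -/
theorem jacobson_le_map_of_surjective [IsArtinianRing R] {X Y : Type u} [AddCommGroup X]
    [Module R X] [AddCommGroup Y] [Module R Y] [Module.Finite R X] (p : X →ₗ[R] Y)
    (hp : Function.Surjective p) :
    Module.jacobson R Y ≤ (Module.jacobson R X).map p := by
  apply Module.jacobson_le_of_eq_bot
  have hss : IsSemisimpleModule R (X ⧸ Module.jacobson R X) := by
    rw [IsArtinian.isSemisimpleModule_iff_jacobson]
    exact Module.jacobson_quotient_jacobson R X
  let q : (X ⧸ Module.jacobson R X) →ₗ[R] (Y ⧸ (Module.jacobson R X).map p) :=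
    Submodule.mapQ _ _ p (Submodule.le_comap_map _ _)
  have hq : Function.Surjective q := by
    intro y
    obtain ⟨y, rfl⟩ := Submodule.mkQ_surjective _ y
    obtain ⟨x, rfl⟩ := hp y
    exact ⟨Submodule.mkQ _ x, rfl⟩
  have : IsSemisimpleModule R (Y ⧸ (Module.jacobson R X).map p) :=
    IsSemisimpleModule.of_surjective q hq
  exact IsSemisimpleModule.jacobson_eq_bot _ _

/-- A nonzero homomorphism from a local projective module to a simple module has the radical as
its kernel. -/
theorem ker_eq_jacobson {P V : Type u} [AddCommGroup P] [Module R P] [Module.Projective R P]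
    [IsLocalRing (Module.End R P)] [AddCommGroup V] [Module R V] [IsSimpleModule R V]
    {p : P →ₗ[R] V} (hp : p ≠ 0) : LinearMap.ker p = Module.jacobson R P := by
  refine (jacobson_eq_of_isCoatom ?_).symm
  rw [← isSimpleModule_iff_isCoatom]
  exact IsSimpleModule.congr
    (p.quotKerEquivOfSurjective (LinearMap.surjective_of_ne_zero hp))

/-- Two simple quotients of a local projective module are isomorphic. -/
theorem exists_equiv_of_simple {P V W : Type u} [AddCommGroup P] [Module R P]
    [Module.Projective R P] [IsLocalRing (Module.End R P)] [AddCommGroup V] [Module R V]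
    [IsSimpleModule R V] [AddCommGroup W] [Module R W] [IsSimpleModule R W]
    {p : P →ₗ[R] V} (hp : p ≠ 0) {q : P →ₗ[R] W} (hq : q ≠ 0) : Nonempty (V ≃ₗ[R] W) :=
  ⟨(p.quotKerEquivOfSurjective (LinearMap.surjective_of_ne_zero hp)).symm.trans
    ((Submodule.quotEquivOfEq _ _ ((ker_eq_jacobson hp).trans (ker_eq_jacobson hq).symm)).trans
      (q.quotKerEquivOfSurjective (LinearMap.surjective_of_ne_zero hq)))⟩

/-- A homomorphism from a local projective module to a finitely generated module maps to the
radical, unless it is visible on a simple quotient. -/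
theorem range_le_jacobson_or_exists {P S Y : Type u} [AddCommGroup P] [Module R P]
    [Module.Projective R P] [IsLocalRing (Module.End R P)] [AddCommGroup S] [Module R S]
    [IsSimpleModule R S] [AddCommGroup Y] [Module R Y] {p : P →ₗ[R] S} (hp : p ≠ 0)
    (g : P →ₗ[R] Y) :
    LinearMap.range g ≤ Module.jacobson R Y ∨ ∃ κ : Y →ₗ[R] S, κ ∘ₗ g ≠ 0 := by
  by_contra! h
  refine h.1 (le_sInf fun L hL => ?_)
  by_contra hle
  have : IsSimpleModule R (Y ⧸ L) := isSimpleModule_iff_isCoatom.mpr hL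
  have hq : L.mkQ ∘ₗ g ≠ 0 := by
    intro h0
    apply hle
    rintro _ ⟨x, rfl⟩
    rw [← Submodule.Quotient.mk_eq_zero]
    exact DFunLike.congr_fun h0 x
  obtain ⟨e⟩ := exists_equiv_of_simple hq hp
  refine hq (LinearMap.ext fun x => e.injective ?_)
  have := DFunLike.congr_fun (h.2 (e.toLinearMap ∘ₗ L.mkQ)) x
  simpa using this

/-- Over a selfinjective artinian ring, the indecomposable projective modules have simple socles,
which are permuted tops. -/
theorem exists_nakayama [IsArtinianRing R] [Module.Injective R R] {ι : Type} [Finite ι]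
    {P : ι → ModuleCat.{u} R} (hP : IsCompleteSetOfIndecProj P) :
    ∃ (σ : Equiv.Perm ι) (ζ : ∀ i, P (σ i) →ₗ[R] P i), (∀ i, ζ i ≠ 0) ∧
      ∀ (i : ι) (N : Submodule R (P i)), N ≠ ⊥ → LinearMap.range (ζ i) ≤ N := by
  have hfin := hP.finite
  have hproj := hP.projective
  have hinj (i : ι) : Module.Injective R (P i) := injective_of_finite_projective (P i)
  have hloc (i : ι) : IsLocalRing (Module.End R (P i)) :=
    isLocalRing_end_of_indecomposable (hP.indecomposable i)
  have hsoc (i : ι) : ∃ A : Submodule R (P i), IsAtom A ∧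
      ∀ N : Submodule R (P i), N ≠ ⊥ → A ≤ N := by
    have := nontrivial_of_indecomposable (hP.indecomposable i)
    obtain ⟨A, hA, -⟩ :=
      (eq_bot_or_exists_atom_le (⊤ : Submodule R (P i))).resolve_left top_ne_bot
    refine ⟨A, hA, fun N hN => ?_⟩
    have h1 := inf_ne_bot_of_injective hA.1 hN
    exact (hA.le_iff_eq h1).mp inf_le_left ▸ inf_le_right
  choose A hA hAle using hsoc
  have hsimple (i : ι) : IsSimpleModule R (A i) := isSimpleModule_iff_isAtom.mpr (hA i)
  choose τ p hp using fun i => hP.exists_hom_ne_zero (A i)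
  -- Isomorphic socles give isomorphic modules: extend the isomorphism to `P i → P k`. The extension
  -- is injective because it is so on the smallest submodule, and it splits. The index `j` in `key`
  -- allows the equality `τ i = τ k` to be substituted.
  have hτ : Function.Injective τ := by
    intro i k hik
    have key : ∀ (j : ι) (q : P j →ₗ[R] A k), q ≠ 0 → τ i = j → i = k := by
      rintro j q hq rfl
      obtain ⟨e⟩ := exists_equiv_of_simple (hp i) hq
      obtain ⟨g, hg⟩ := Module.Injective.out (A i).subtype (A i).injective_subtype
        ((A k).subtype ∘ₗ e.toLinearMap)
      have hginj : Function.Injective g := by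
        rw [← LinearMap.ker_eq_bot]
        by_contra hne
        obtain ⟨x, hx, hx0⟩ := (Submodule.ne_bot_iff _).mp (hA i).1
        have h0 : g x = 0 := hAle i _ hne hx
        have h1 : g x = e ⟨x, hx⟩ := hg ⟨x, hx⟩
        rw [h0] at h1
        have h2 : e ⟨x, hx⟩ = 0 := Subtype.ext h1.symm
        rw [LinearEquiv.map_eq_zero_iff] at h2
        exact hx0 (congrArg Subtype.val h2)
      obtain ⟨r, hr⟩ := Module.Injective.out g hginj LinearMap.id
      have hrb := bijective_of_retraction (hP.indecomposable k)
        (nontrivial_of_indecomposable (hP.indecomposable i)) g r (LinearMap.ext hr)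
      exact (hP.nonisomorphic k i ⟨(LinearEquiv.ofBijective r hrb).toModuleIso⟩).symm
    exact key (τ k) (p k) (hp k) hik
  refine ⟨Equiv.ofBijective τ (Finite.injective_iff_bijective.mp hτ),
    fun i => (A i).subtype ∘ₗ p i, fun i h0 => hp i ?_, fun i N hN => ?_⟩
  · exact LinearMap.ext fun x => Subtype.ext (DFunLike.congr_fun h0 x)
  · exact ((LinearMap.range_comp_le_range _ _).trans (Submodule.range_subtype _).le).trans
      (hAle i N hN)

/-- Over a selfinjective artinian ring, finitely generated injective modules are projective. -/
theorem projective_of_finite_injective [IsArtinianRing R] [Module.Injective R R] {ι : Type}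
    [Finite ι] {P : ι → ModuleCat.{u} R} (hP : IsCompleteSetOfIndecProj P) (M : Type u)
    [AddCommGroup M] [Module R M] [Module.Finite R M] [Module.Injective R M] :
    Module.Projective R M := by
  have hfin := hP.finite
  have hproj := hP.projective
  have hinj (i : ι) : Module.Injective R (P i) := injective_of_finite_projective (P i)
  have hloc (i : ι) : IsLocalRing (Module.End R (P i)) :=
    isLocalRing_end_of_indecomposable (hP.indecomposable i)
  obtain ⟨σ, ζ, hζ, hζle⟩ := exists_nakayama hP
  -- Take a map from `M` to a projective module with minimal kernel `K`. If `K` were nonzero, a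
  -- simple quotient of it would embed as the socle of some `P i`, since `σ` is surjective;
  -- extending `K → P i` to `M` and adding it to the map would shrink the kernel. So `M` embeds in a
  -- projective module, and splits off.
  let 𝒦 : Set (Submodule R M) := {K | ∃ (X : ModuleCat.{u} R) (_ : Module.Projective R X)
    (g : M →ₗ[R] X), LinearMap.ker g = K}
  have hne : 𝒦.Nonempty := ⟨⊤, ModuleCat.of R PUnit, inferInstance, 0, LinearMap.ker_zero⟩
  obtain ⟨K, ⟨X, hX, g, hg⟩, hmin⟩ := IsArtinian.set_has_minimal 𝒦 hne
  have hK : K = ⊥ := by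
    by_contra hK0
    have : Nontrivial K := Submodule.nontrivial_iff_ne_bot.mpr hK0
    obtain ⟨L, hL, -⟩ := (eq_top_or_exists_le_coatom (⊥ : Submodule R K)).resolve_left bot_ne_top
    have : IsSimpleModule R (K ⧸ L) := isSimpleModule_iff_isCoatom.mpr hL
    obtain ⟨j, p, hp⟩ := hP.exists_hom_ne_zero (K ⧸ L)
    obtain ⟨i, rfl⟩ := σ.surjective j
    have hs : IsSimpleModule R (LinearMap.range (ζ i)) := by
      rw [isSimpleModule_iff_isAtom]
      refine ⟨fun h1 => hζ i (LinearMap.range_eq_bot.mp h1), fun N hN => ?_⟩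
      by_contra hne
      exact absurd (hζle i N hne) (not_le_of_gt hN)
    have hζ' : (ζ i).rangeRestrict ≠ 0 := fun h0 => hζ i (by
      ext x; exact congrArg Subtype.val (DFunLike.congr_fun h0 x))
    obtain ⟨e⟩ := exists_equiv_of_simple hp hζ'
    obtain ⟨b, hb⟩ := Module.Injective.out K.subtype K.injective_subtype
      ((LinearMap.range (ζ i)).subtype ∘ₗ e.toLinearMap ∘ₗ L.mkQ)
    refine hmin (LinearMap.ker (g.prod b)) ⟨ModuleCat.of R (X × P i), inferInstanceAs
      (Module.Projective R (X × P i)), g.prod b, rfl⟩ ?_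
    rw [LinearMap.ker_prod, hg]
    refine inf_le_left.lt_of_ne fun h0 => ?_
    refine hL.1 ((Submodule.eq_top_iff').mpr fun x => ?_)
    have hx : b x = 0 := (inf_eq_left.mp h0) x.2
    rw [← Submodule.Quotient.mk_eq_zero]
    have h1 := hb x
    rw [show b (K.subtype x) = 0 from hx] at h1
    have h2 : e (L.mkQ x) = 0 := Subtype.ext h1.symm
    rwa [LinearEquiv.map_eq_zero_iff] at h2
  have hginj : Function.Injective g := LinearMap.ker_eq_bot.mp (hg.trans hK)
  obtain ⟨r, hr⟩ := Module.Injective.out g hginj LinearMap.id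
  exact Module.Projective.of_split g r (LinearMap.ext hr)

end SelfInjective

/-! ### The minimal injective presentation of the simple module -/

/-- A minimal injective presentation `0 → S → E₀ → E₁` of a simple module by finitely generated
projective-injective modules such that `E₀` is a nonsimple local module with top `S`, and
`S` is not a quotient of `E₁`. -/
structure IsReflectionPresentation {R : Type u} [Ring R] {S E₀ E₁ : Type u} [AddCommGroup S]
    [Module R S] [AddCommGroup E₀] [Module R E₀] [AddCommGroup E₁] [Module R E₁]
    (s : S →ₗ[R] E₀) (f : E₀ →ₗ[R] E₁) (p : E₀ →ₗ[R] S) : Prop where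
  simple : IsSimpleModule R S
  finite₀ : Module.Finite R E₀
  finite₁ : Module.Finite R E₁
  projective₀ : Module.Projective R E₀
  projective₁ : Module.Projective R E₁
  injective₀ : Module.Injective R E₀
  injective₁ : Module.Injective R E₁
  local_end : IsLocalRing (Module.End R E₀)
  exact : Function.Exact s f
  inj : Function.Injective s
  range_le : ∀ N : Submodule R E₀, N ≠ ⊥ → LinearMap.range s ≤ N
  essential : ∀ N : Submodule R E₁, N ⊓ LinearMap.range f = ⊥ → N = ⊥
  ne_zero : p ≠ 0
  comp_eq_zero : p ∘ₗ s = 0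
  hom_eq_zero : ∀ g : E₁ →ₗ[R] S, g = 0

namespace IsReflectionPresentation

variable {R : Type u} [Ring R] {S E₀ E₁ : Type u} [AddCommGroup S]
  [Module R S] [AddCommGroup E₀] [Module R E₀] [AddCommGroup E₁] [Module R E₁]
  {s : S →ₗ[R] E₀} {f : E₀ →ₗ[R] E₁} {p : E₀ →ₗ[R] S} (H : IsReflectionPresentation s f p)
include H

theorem ker_eq : LinearMap.ker f = LinearMap.range s := LinearMap.exact_iff.mp H.exact

theorem ker_ne_bot : LinearMap.ker f ≠ ⊥ := by
  have := H.simple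
  have := IsSimpleModule.nontrivial R S
  rw [H.ker_eq]
  intro h
  obtain ⟨x, hx⟩ := exists_ne (0 : S)
  exact hx (H.inj (by rw [LinearMap.range_eq_bot.mp h]; simp))

/-- Homomorphisms to `E₀` that are annihilated by `f` factor through `S`. -/
theorem eq_zero_of_comp_eq_zero {M : Type u} [AddCommGroup M] [Module R M]
    (hM : ∀ g : M →ₗ[R] S, g = 0) (a : M →ₗ[R] E₀) (ha : f ∘ₗ a = 0) : a = 0 := by
  have h (x : M) : a x ∈ LinearMap.range s := by
    rw [← H.ker_eq]; exact DFunLike.congr_fun ha x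
  let e := LinearEquiv.ofInjective s H.inj
  have h0 := hM (e.symm.toLinearMap ∘ₗ a.codRestrict (LinearMap.range s) h)
  ext x
  have h1 : e.symm ⟨a x, h x⟩ = 0 := DFunLike.congr_fun h0 x
  rw [LinearEquiv.map_eq_zero_iff] at h1
  exact congrArg Subtype.val h1

/-- A map that is not injective kills the socle of `E₀`, which is the kernel of `f`; injectivity of
`I` does the rest. -/
theorem exists_extension {I : Type u} [AddCommGroup I] [Module R I] [Module.Injective R I]
    (g : E₀ →ₗ[R] I) (hg : ¬ Function.Injective g) : ∃ b : E₁ →ₗ[R] I, b ∘ₗ f = g := by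
  refine exists_factor_of_ker_le f g ?_
  rw [H.ker_eq]
  exact H.range_le _ fun h => hg (LinearMap.ker_eq_bot.mp h)

theorem not_injective_f_comp {M : Type u} [AddCommGroup M] [Module R M] (g : E₁ →ₗ[R] M) :
    ¬ Function.Injective (g ∘ₗ f) := fun h =>
  H.ker_ne_bot (LinearMap.ker_eq_bot.mpr (Function.Injective.of_comp (f := g) h))

/-- The image of `f` is essential in `E₁`, so injectivity on it is injectivity; finite length turns
this into bijectivity. -/
theorem bijective_of_injOn_range [IsArtinianRing R] (g : E₁ →ₗ[R] E₁)
    (hg : ∀ x, g (f x) = 0 → f x = 0) : Function.Bijective g := by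
  have := H.finite₁
  refine IsArtinian.bijective_of_injective_endomorphism g ?_
  rw [← LinearMap.ker_eq_bot]
  apply H.essential
  rw [Submodule.eq_bot_iff]
  rintro _ ⟨h0, x, rfl⟩
  exact hg x h0

theorem bijective_of_injective [IsArtinianRing R] (g : E₀ →ₗ[R] E₀) (hg : Function.Injective g) :
    Function.Bijective g :=
  have := H.finite₀
  IsArtinian.bijective_of_injective_endomorphism g hg

/-- If `a` is an automorphism of `E₀`, then any compatible endomorphism of `E₁` is bijective. -/
theorem bijective_of_comp_eq [IsArtinianRing R] {a : E₀ →ₗ[R] E₀}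
    (ha : Function.Bijective a) {b : E₁ →ₗ[R] E₁}
    (h : b ∘ₗ f = f ∘ₗ a) : Function.Bijective b := by
  have := H.injective₁
  refine H.bijective_of_injOn_range b fun x hx => ?_
  let e := LinearEquiv.ofBijective a ha
  -- `c` plays the role of an inverse of `b` on the image of `f`: it satisfies `f = c f a`, and `f a
  -- = b f`.
  obtain ⟨c, hc⟩ := H.exists_extension (f ∘ₗ e.symm.toLinearMap) fun hi => by
    refine H.not_injective_f_comp LinearMap.id fun x y hxy => ?_
    have h1 : (f ∘ₗ e.symm.toLinearMap) (e x) = (f ∘ₗ e.symm.toLinearMap) (e y) := by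
      simpa using hxy
    exact e.injective (hi h1)
  have h1 : f x = c (f (a x)) := by
    have := DFunLike.congr_fun hc (a x)
    rw [LinearMap.comp_apply] at this
    rw [this]
    simp only [LinearMap.comp_apply, LinearEquiv.coe_coe]
    rw [show e.symm (a x) = x from e.symm_apply_apply x]
  have h2 : f (a x) = 0 := by rw [← LinearMap.comp_apply, ← h]; exact hx
  rw [h1, h2, map_zero]

/-- A homomorphism from `E₀` to the radical of a finitely generated module extends to `E₁`. -/
theorem exists_extension_of_range_le_jacobson [IsArtinianRing R] [Module.Injective R R]
    {Y : Type u} [AddCommGroup Y] [Module R Y]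
    [Module.Finite R Y] (g : E₀ →ₗ[R] Y) (hg : LinearMap.range g ≤ Module.jacobson R Y) :
    ∃ b : E₁ →ₗ[R] Y, b ∘ₗ f = g := by
  have := H.projective₀
  have := H.injective₀
  have := H.finite₀
  have := H.local_end
  obtain ⟨m, q, hq⟩ := Module.Finite.exists_fin' R Y
  obtain ⟨g', hg'⟩ := exists_factor_of_range_le (q ∘ₗ (Module.jacobson R (Fin m → R)).subtype) g
    (by
      rw [LinearMap.range_comp, Submodule.range_subtype]
      exact hg.trans (jacobson_le_map_of_surjective q hq))
  -- If the lift of `g` into the free module were injective, it would split. The retraction maps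
  -- radical to radical, so `E₀` would equal its own radical.
  have hni : ¬ Function.Injective ((Module.jacobson R (Fin m → R)).subtype ∘ₗ g') := by
    intro hi
    obtain ⟨r, hr⟩ := Module.Injective.out _ hi (LinearMap.id (R := R) (M := E₀))
    refine (isCoatom_jacobson (R := R) (M := E₀)).1 (Submodule.eq_top_iff'.mpr fun x => ?_)
    have h1 : r (g' x) ∈ Module.jacobson R E₀ :=
      Module.map_jacobson_le r ⟨_, (g' x).2, rfl⟩
    have h2 : r (g' x) = x := hr x
    rwa [h2] at h1
  have hI : Module.Injective R (Fin m → R) := inferInstance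
  obtain ⟨b, hb⟩ := H.exists_extension _ hni
  exact ⟨q ∘ₗ b, by rw [LinearMap.comp_assoc, hb, ← LinearMap.comp_assoc, hg']⟩

/-- A nonzero homomorphism from the cokernel of `f` can be continued to a homomorphism of the form
`f w` with `w f ≠ 0`. -/
theorem exists_of_hom_to_injective [IsArtinianRing R] [Module.Injective R R] {I : Type u}
    [AddCommGroup I] [Module R I] (x : E₁ →ₗ[R] I) (hx : x ≠ 0) (hxf : x ∘ₗ f = 0) :
    ∃ (g : I →ₗ[R] E₁) (w : E₁ →ₗ[R] E₀), g ∘ₗ x = f ∘ₗ w ∧ w ∘ₗ f ≠ 0 := by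
  have := H.projective₀
  have := H.injective₀
  have := H.injective₁
  have := H.finite₁
  have := H.local_end
  have := H.simple
  let K := LinearMap.ker x
  let g : E₀ →ₗ[R] K := f.codRestrict K fun y => DFunLike.congr_fun hxf y
  -- Otherwise `f`, as a map to the kernel of `x`, has image in the radical and extends to `E₁`. The
  -- extension fixes the image of `f`, so it is an automorphism of `E₁` with values in the kernel of
  -- `x`, and `x = 0`.
  have hκ : ∃ κ : K →ₗ[R] S, κ ∘ₗ g ≠ 0 := by
    refine (range_le_jacobson_or_exists H.ne_zero g).resolve_left fun hle => ?_
    obtain ⟨b, hb⟩ := H.exists_extension_of_range_le_jacobson g hle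
    have hb' (y : E₀) : (b (f y) : E₁) = f y := congrArg Subtype.val (DFunLike.congr_fun hb y)
    have hbij := H.bijective_of_injOn_range (K.subtype ∘ₗ b) fun y hy => by
      rw [← hb' y]; exact hy
    apply hx
    ext y
    obtain ⟨z, rfl⟩ := hbij.2 y
    exact (b z).2
  obtain ⟨κ, hκ⟩ := hκ
  obtain ⟨w, hw⟩ := Module.Injective.out K.subtype K.injective_subtype (s ∘ₗ κ)
  obtain ⟨c, hc⟩ := exists_factor_of_ker_le x (f ∘ₗ w) (by
    intro y hy
    have h1 : w y = s (κ ⟨y, hy⟩) := hw ⟨y, hy⟩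
    rw [LinearMap.mem_ker, LinearMap.comp_apply, h1]
    exact H.exact.apply_apply_eq_zero _)
  refine ⟨c, w, hc, fun h0 => hκ ?_⟩
  ext y
  apply H.inj
  have h1 : w (f y) = s (κ (g y)) := hw (g y)
  rw [LinearMap.zero_apply, map_zero, LinearMap.comp_apply, ← h1]
  exact DFunLike.congr_fun h0 y

/-- A homomorphism to `E₁` that does not factor through `f` can be preceded by a homomorphism from
the cokernel of `f` to obtain one of the form `f w` with `w f ≠ 0`. -/
theorem exists_of_hom_from_projective [IsArtinianRing R] [Module.Injective R R] {Q : Type u}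
    [AddCommGroup Q] [Module R Q] [Module.Finite R Q]
    (x : Q →ₗ[R] E₁) (hx : ∀ a : Q →ₗ[R] E₀, f ∘ₗ a ≠ x) :
    ∃ (h : E₁ →ₗ[R] Q) (w : E₁ →ₗ[R] E₀), x ∘ₗ h = f ∘ₗ w ∧ h ∘ₗ f = 0 ∧ w ∘ₗ f ≠ 0 := by
  have := H.projective₀
  have := H.injective₀
  have := H.injective₁
  have := H.finite₀
  have := H.finite₁
  have := H.local_end
  have := H.simple
  -- `Y` is the pullback of `x` and `f`: a map `E₁ → Y` is a pair `h`, `w` with `x h = f w`. The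
  -- desired pair is an extension along `f` of the top-to-socle map of `E₀`, placed in the second
  -- component.
  let d : Q × E₀ →ₗ[R] E₁ := x.coprod (-f)
  let Y := LinearMap.ker d
  let g : E₀ →ₗ[R] Y := (LinearMap.inr R Q E₀ ∘ₗ s ∘ₗ p).codRestrict Y fun y => by
    change d (0, s (p y)) = 0
    simp [d, H.exact.apply_apply_eq_zero]
  have hsp : s ∘ₗ p ≠ 0 := by
    intro h0
    apply H.ne_zero
    ext y
    exact H.inj (by simpa using DFunLike.congr_fun h0 y)
  rcases range_le_jacobson_or_exists H.ne_zero g with hle | ⟨κ, hκ⟩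
  · obtain ⟨b, hb⟩ := H.exists_extension_of_range_le_jacobson g hle
    have hb' (y : E₀) : (b (f y) : Q × E₀) = (0, s (p y)) :=
      congrArg Subtype.val (DFunLike.congr_fun hb y)
    refine ⟨LinearMap.fst R Q E₀ ∘ₗ Y.subtype ∘ₗ b, LinearMap.snd R Q E₀ ∘ₗ Y.subtype ∘ₗ b,
      ?_, ?_, ?_⟩
    · ext y
      have h1 : d (b y : Q × E₀) = 0 := (b y).2
      rw [LinearMap.coprod_apply, LinearMap.neg_apply, ← sub_eq_add_neg, sub_eq_zero] at h1
      exact h1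
    · ext y
      exact congrArg Prod.fst (hb' y)
    · intro h0
      apply hsp
      ext y
      exact (congrArg Prod.snd (hb' y)).symm.trans (DFunLike.congr_fun h0 y)
  · exfalso
    -- If the extension is obstructed by a map `κ` to `S`, extend `s κ` to `φ = (α, β)`. Then `β`
    -- does not kill the socle, so it is an automorphism; and `f φ` vanishes on `Y`, so it factors
    -- through `d` by some `ψ`. Comparing components gives `x = -f β⁻¹ α`, a factorization excluded
    -- by `hx`.
    obtain ⟨φ, hφ⟩ := Module.Injective.out Y.subtype Y.injective_subtype (s ∘ₗ κ)
    set β := φ ∘ₗ LinearMap.inr R Q E₀ with hβ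
    set α := φ ∘ₗ LinearMap.inl R Q E₀ with hα
    have hφαβ (q : Q) (e : E₀) : φ (q, e) = α q + β e := by
      rw [hα, hβ, LinearMap.comp_apply, LinearMap.comp_apply, ← map_add]; simp
    have hβi : Function.Injective β := by
      rw [← LinearMap.ker_eq_bot]
      by_contra hne
      apply hκ
      ext y
      apply H.inj
      have h1 : φ (0, s (p y)) = s (κ (g y)) := hφ (g y)
      have h2 : β (s (p y)) = 0 := H.range_le _ hne ⟨_, rfl⟩
      rw [LinearMap.comp_apply, ← h1, hφαβ, h2]; simp
    have hβb := H.bijective_of_injective β hβi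
    obtain ⟨ψ, hψ⟩ := exists_factor_of_ker_le d (f ∘ₗ φ) (by
      intro y hy
      have h1 : φ y = s (κ ⟨y, hy⟩) := hφ ⟨y, hy⟩
      rw [LinearMap.mem_ker, LinearMap.comp_apply, h1]
      exact H.exact.apply_apply_eq_zero _)
    have hψx (q : Q) : ψ (x q) = f (α q) := by
      have := DFunLike.congr_fun hψ (q, 0)
      simpa [d, hφαβ] using this
    have hψf (e : E₀) : ψ (f e) = - f (β e) := by
      have := DFunLike.congr_fun hψ (0, e)
      simp only [LinearMap.comp_apply, hφαβ] at this
      simp [d] at this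
      rw [← this, neg_neg]
    have hψb : Function.Bijective (-ψ) := by
      refine H.bijective_of_comp_eq hβb ?_
      ext e
      simp [hψf]
    let e := LinearEquiv.ofBijective β hβb
    refine hx (-(e.symm.toLinearMap ∘ₗ α)) (LinearMap.ext fun q => hψb.1 ?_)
    have h1 : β (e.symm (α q)) = α q := e.apply_symm_apply (α q)
    simp [hψf, hψx, h1]

/-- The endomorphisms `w f` of `E₀` with `f w f = 0` have their image in the socle. -/
theorem range_le_range {u : E₀ →ₗ[R] E₀} (hu : f ∘ₗ u = 0) :
    LinearMap.range u ≤ LinearMap.range s := by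
  rintro _ ⟨y, rfl⟩
  rw [← H.ker_eq]
  exact DFunLike.congr_fun hu y

theorem ker_socle_endo {u : E₀ →ₗ[R] E₀} (hu : f ∘ₗ u = 0) (hu0 : u ≠ 0) :
    LinearMap.ker u = Module.jacobson R E₀ := by
  have := H.projective₀
  have := H.local_end
  have := H.simple
  let e := LinearEquiv.ofInjective s H.inj
  have : IsSimpleModule R (LinearMap.range s) := IsSimpleModule.congr e.symm
  let u' := u.codRestrict (LinearMap.range s) fun y => H.range_le_range hu ⟨y, rfl⟩
  have hu' : u' ≠ 0 := fun h0 => hu0 (by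
    ext y; exact congrArg Subtype.val (DFunLike.congr_fun h0 y))
  rw [← ker_eq_jacobson hu', LinearMap.ker_codRestrict]

/-- Any two nonzero endomorphisms of `E₀` with image in the socle differ by automorphisms. -/
theorem exists_comp_eq {u u' : E₀ →ₗ[R] E₀} (hu : f ∘ₗ u = 0) (hu0 : u ≠ 0)
    (hu' : f ∘ₗ u' = 0) (hu0' : u' ≠ 0) :
    (∃ k : E₀ →ₗ[R] E₀, k ∘ₗ u = u') ∧ ∃ k : E₀ →ₗ[R] E₀, u ∘ₗ k = u' := by
  have := H.projective₀
  have := H.injective₀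
  refine ⟨exists_factor_of_ker_le u u' ?_, exists_factor_of_range_le u u' ?_⟩
  · rw [H.ker_socle_endo hu hu0, H.ker_socle_endo hu' hu0']
  · exact (H.range_le_range hu').trans (H.range_le _ fun h => hu0 (LinearMap.range_eq_bot.mp h))

/-- There is a homomorphism `w` such that `w f` is a nonzero map from the top of `E₀` to
its socle. -/
theorem exists_socle_hom : ∃ w : E₁ →ₗ[R] E₀, f ∘ₗ w ∘ₗ f = 0 ∧ w ∘ₗ f ≠ 0 := by
  have := H.injective₀
  -- `w` extends the map `s p` from the top to the socle; this map is not injective because `p s =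
  -- 0`.
  obtain ⟨w, hw⟩ := H.exists_extension (s ∘ₗ p) (by
    intro hi
    have := H.simple
    have := IsSimpleModule.nontrivial R S
    obtain ⟨x, hx⟩ := exists_ne (0 : S)
    refine hx (H.inj (hi ?_))
    have := DFunLike.congr_fun H.comp_eq_zero x
    simp at this
    simp [this])
  refine ⟨w, ?_, ?_⟩
  · rw [hw]
    ext y
    exact H.exact.apply_apply_eq_zero _
  · rw [hw]
    intro h0
    apply H.ne_zero
    ext y
    exact H.inj (by simpa using DFunLike.congr_fun h0 y)

/-- A homomorphism from `E₁` to a nonzero projective module which annihilates the image of `f` is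
not surjective. -/
theorem not_surjective {Q : Type u} [AddCommGroup Q] [Module R Q] [Module.Projective R Q]
    [Nontrivial Q] (x : E₁ →ₗ[R] Q) (hx : x ∘ₗ f = 0) : ¬ Function.Surjective x := by
  intro hs
  obtain ⟨i, hi⟩ := Module.projective_lifting_property x LinearMap.id hs
  have hi' (y : Q) : x (i y) = y := DFunLike.congr_fun hi y
  -- The image of a section of `x` meets the image of `f` trivially, against essentiality.
  have h0 : LinearMap.range i = ⊥ := by
    apply H.essential
    rw [Submodule.eq_bot_iff]
    rintro _ ⟨⟨y, rfl⟩, z, hz⟩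
    have h1 : x (f z) = 0 := DFunLike.congr_fun hx z
    rw [hz, hi'] at h1
    rw [h1, map_zero]
  obtain ⟨y, hy⟩ := exists_ne (0 : Q)
  apply hy
  rw [← hi' y, LinearMap.range_eq_bot.mp h0]; simp

/-- Simple submodules of `E₁` are contained in the image of `f`. -/
theorem le_range_of_isAtom {A : Submodule R E₁} (hA : IsAtom A) : A ≤ LinearMap.range f := by
  have h1 : A ⊓ LinearMap.range f ≠ ⊥ := fun h => hA.1 (H.essential A h)
  exact (hA.le_iff_eq h1).mp inf_le_left ▸ inf_le_right

end IsReflectionPresentation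

/-! ### Cones of morphisms between stalk complexes -/

section Cone

variable {𝒜 : Type*} [Category* 𝒜] [Preadditive 𝒜] {C : Type*} [Category* C] [HasZeroObject C]
  [HasShift C ℤ] [Preadditive C] [∀ n : ℤ, (shiftFunctor C n).Additive] [Pretriangulated C]

/-- There are no morphisms between different shifts of objects in the image of `F`. -/
def HomShiftVanishes (F : 𝒜 ⥤ C) : Prop :=
  ∀ (M N : 𝒜) (k : ℤ), k ≠ 0 → ∀ g : F.obj M ⟶ (F.obj N)⟦k⟧, g = 0

/-- `E` is a cone of `F.map f`. -/
structure IsConeOf (F : 𝒜 ⥤ C) {E₀ E₁ : 𝒜} (f : E₀ ⟶ E₁) {E : C} (j : F.obj E₁ ⟶ E)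
    (δ : E ⟶ (F.obj E₀)⟦(1 : ℤ)⟧) : Prop where
  distinguished : Triangle.mk (F.map f) j δ ∈ distTriang C

theorem eq_zero_of_shift_hom {X Y : C} {a b c : ℤ} (hc : b - a = c)
    (h : ∀ g : X ⟶ Y⟦c⟧, g = 0) (g : X⟦a⟧ ⟶ Y⟦b⟧) : g = 0 := by
  apply (shiftFunctor C (-a)).map_injective
  rw [Functor.map_zero]
  have h1 := h ((shiftFunctorCompIsoId C a (-a) (by lia)).inv.app X ≫ g⟦-a⟧' ≫
    (shiftFunctorAdd' C b (-a) c (by lia)).inv.app Y)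
  rw [← cancel_mono ((shiftFunctorAdd' C b (-a) c (by lia)).inv.app Y),
    ← cancel_epi ((shiftFunctorCompIsoId C a (-a) (by lia)).inv.app X), h1]
  simp

theorem eq_zero_of_hom_shift {X Y : C} {a b c : ℤ} (hc : b - a = c)
    (h : ∀ g : X⟦a⟧ ⟶ Y⟦b⟧, g = 0) (g : X ⟶ Y⟦c⟧) : g = 0 := by
  have h1 := h (g⟦a⟧' ≫ (shiftFunctorAdd' C c a b (by lia)).inv.app Y)
  apply (shiftFunctor C a).map_injective
  rw [← cancel_mono ((shiftFunctorAdd' C c a b (by lia)).inv.app Y), h1]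
  simp

theorem eq_zero_of_hom_shift_zero {X Y : C} (h : ∀ g : X ⟶ Y, g = 0) (g : X ⟶ Y⟦(0 : ℤ)⟧) :
    g = 0 := by
  rw [← cancel_mono ((shiftFunctorZero C ℤ).hom.app Y), zero_comp]
  exact h _

variable {F : 𝒜 ⥤ C} (hF : HomShiftVanishes F) {E₀ E₁ : 𝒜} {f : E₀ ⟶ E₁} {E : C}
  {j : F.obj E₁ ⟶ E} {δ : E ⟶ (F.obj E₀)⟦(1 : ℤ)⟧} (hE : IsConeOf F f j δ)

include hF in
theorem HomShiftVanishes.shift {M N : 𝒜} {a b : ℤ} (hab : a ≠ b)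
    (g : (F.obj M)⟦a⟧ ⟶ (F.obj N)⟦b⟧) : g = 0 :=
  eq_zero_of_shift_hom rfl (hF M N (b - a) (by lia)) g

include hF in
theorem HomShiftVanishes.shift_left {M N : 𝒜} {a : ℤ} (ha : a ≠ 0)
    (g : (F.obj M)⟦a⟧ ⟶ F.obj N) : g = 0 := by
  have h1 := hF.shift ha (g ≫ (shiftFunctorZero C ℤ).inv.app (F.obj N))
  rw [← cancel_mono ((shiftFunctorZero C ℤ).inv.app (F.obj N)), h1, zero_comp]

namespace IsConeOf

include hE

theorem map_comp : F.map f ≫ j = 0 := comp_distTriang_mor_zero₁₂ _ hE.distinguished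

theorem δ_comp : δ ≫ (F.map f)⟦(1 : ℤ)⟧' = 0 := comp_distTriang_mor_zero₃₁ _ hE.distinguished

/-- Morphisms to the cone that vanish in `E₀[1]` come from `E₁`. -/
theorem exists_lift {X : C} (x : X ⟶ E) (hx : x ≫ δ = 0) : ∃ y : X ⟶ F.obj E₁, x = y ≫ j :=
  Triangle.coyoneda_exact₃ _ hE.distinguished x hx

theorem exists_lift₂ {X : C} (x : X ⟶ F.obj E₁) (hx : x ≫ j = 0) :
    ∃ y : X ⟶ F.obj E₀, x = y ≫ F.map f :=
  Triangle.coyoneda_exact₂ _ hE.distinguished x hx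

theorem exists_desc₃ {X : C} (x : E ⟶ X) (hx : j ≫ x = 0) :
    ∃ y : (F.obj E₀)⟦(1 : ℤ)⟧ ⟶ X, x = δ ≫ y :=
  Triangle.yoneda_exact₃ _ hE.distinguished x hx

theorem exists_desc {X : C} (x : F.obj E₁ ⟶ X) (hx : F.map f ≫ x = 0) :
    ∃ y : E ⟶ X, x = j ≫ y :=
  Triangle.yoneda_exact₂ _ hE.distinguished x hx

include hF in
theorem exists_of_hom_from_stalk [F.Full] {M : 𝒜} (x : F.obj M ⟶ E) :
    ∃ x₀ : M ⟶ E₁, x = F.map x₀ ≫ j := by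
  obtain ⟨y, rfl⟩ := hE.exists_lift x (hF _ _ 1 one_ne_zero _)
  obtain ⟨x₀, rfl⟩ := F.map_surjective y
  exact ⟨x₀, rfl⟩

theorem map_comp_eq_zero_iff [F.Full] [F.Faithful] {M : 𝒜} (x₀ : M ⟶ E₁) :
    F.map x₀ ≫ j = 0 ↔ ∃ a : M ⟶ E₀, a ≫ f = x₀ := by
  constructor
  · intro h
    obtain ⟨y, hy⟩ := hE.exists_lift₂ _ h
    obtain ⟨a, rfl⟩ := F.map_surjective y
    exact ⟨a, F.map_injective (by rw [hy, F.map_comp])⟩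
  · rintro ⟨a, rfl⟩
    rw [F.map_comp, Category.assoc, hE.map_comp, comp_zero]

include hF in
-- A morphism from the cone that vanishes on `E₁` factors through `E₀[1]`, from which there is
-- nothing to an unshifted stalk. So morphisms from the cone to a stalk are just maps on `E₁` that
-- kill `f`.
theorem hom_to_stalk_ext {N : 𝒜} {x y : E ⟶ F.obj N} (h : j ≫ x = j ≫ y) : x = y := by
  rw [← sub_eq_zero] at h ⊢
  rw [← Preadditive.comp_sub] at h
  obtain ⟨z, hz⟩ := hE.exists_desc₃ _ h
  rw [hz, hF.shift_left one_ne_zero z, comp_zero]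

/-- The morphism from the cone to a stalk complex that is induced by a morphism which
annihilates `f`. -/
def desc [F.Additive] {N : 𝒜} (x₀ : E₁ ⟶ N) (h : f ≫ x₀ = 0) : E ⟶ F.obj N :=
  (hE.exists_desc (F.map x₀) (by rw [← F.map_comp, h, F.map_zero])).choose

theorem comp_desc [F.Additive] {N : 𝒜} (x₀ : E₁ ⟶ N) (h : f ≫ x₀ = 0) :
    j ≫ hE.desc x₀ h = F.map x₀ :=
  (hE.exists_desc (F.map x₀) (by rw [← F.map_comp, h, F.map_zero])).choose_spec.symm

include hF in
theorem exists_of_hom_to_stalk [F.Additive] [F.Full] [F.Faithful] {N : 𝒜} (x : E ⟶ F.obj N) :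
    ∃ (x₀ : E₁ ⟶ N) (h : f ≫ x₀ = 0), x = hE.desc x₀ h := by
  obtain ⟨x₀, hx₀⟩ := F.map_surjective (j ≫ x)
  have h : f ≫ x₀ = 0 := F.map_injective (by
    rw [F.map_comp, hx₀, ← Category.assoc, hE.map_comp, zero_comp, F.map_zero])
  exact ⟨x₀, h, hE.hom_to_stalk_ext hF (by rw [hE.comp_desc, hx₀])⟩

include hF in
theorem desc_comp_map [F.Additive] {N N' : 𝒜} (x₀ : E₁ ⟶ N) (h : f ≫ x₀ = 0) (g : N ⟶ N') :
    hE.desc x₀ h ≫ F.map g = hE.desc (x₀ ≫ g) (by rw [← Category.assoc, h, zero_comp]) :=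
  hE.hom_to_stalk_ext hF (by rw [← Category.assoc, comp_desc, comp_desc, F.map_comp])

/-- The endomorphism of the cone determined by `w : E₁ ⟶ E₀` with `f w f = 0`: it factors through
`E₁`, and is homotopic to a morphism concentrated in degree `-1`. -/
def socleEndo [F.Additive] (w : E₁ ⟶ E₀) (h : f ≫ w ≫ f = 0) : E ⟶ E := hE.desc (w ≫ f) h ≫ j

include hF in
-- The difference `w - w'` kills `f`, hence itself descends to the cone; followed by `f` and then by
-- `j` it becomes zero. Only the component `f w` in degree `-1` matters.
theorem socleEndo_congr [F.Additive] {w w' : E₁ ⟶ E₀} (h : f ≫ w ≫ f = 0)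
    (h' : f ≫ w' ≫ f = 0) (heq : f ≫ w = f ≫ w') : hE.socleEndo w h = hE.socleEndo w' h' := by
  have h0 : f ≫ (w - w') = 0 := by rw [Preadditive.comp_sub, heq, sub_self]
  have h1 : hE.desc (w ≫ f) h = hE.desc (w' ≫ f) h' + hE.desc (w - w') h0 ≫ F.map f := by
    apply hE.hom_to_stalk_ext hF
    rw [Preadditive.comp_add, ← Category.assoc, comp_desc, comp_desc, comp_desc, ← F.map_comp,
      ← F.map_add, Preadditive.sub_comp, add_sub_cancel]
  rw [socleEndo, h1, Preadditive.add_comp, Category.assoc, hE.map_comp, comp_zero, add_zero]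
  rfl

theorem comp_socleEndo [F.Additive] (w : E₁ ⟶ E₀) (h : f ≫ w ≫ f = 0) :
    j ≫ hE.socleEndo w h = 0 := by
  rw [socleEndo, ← Category.assoc, comp_desc, F.map_comp, Category.assoc, hE.map_comp, comp_zero]

theorem socleEndo_comp_desc [F.Additive] (w : E₁ ⟶ E₀) (h : f ≫ w ≫ f = 0)
    {N : 𝒜} (x₀ : E₁ ⟶ N) (hx : f ≫ x₀ = 0) (hF : HomShiftVanishes F) :
    hE.socleEndo w h ≫ hE.desc x₀ hx = 0 := by
  rw [socleEndo, Category.assoc, comp_desc]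
  apply hE.hom_to_stalk_ext hF
  rw [← Category.assoc, comp_desc, ← F.map_comp, Category.assoc, hx, comp_zero, F.map_zero,
    comp_zero]

include hF in
-- If the endomorphism vanished, its part `E ⟶ E₁` would factor through `f` by some `b` with `f b =
-- 0`. Cancelling `f` in `w f = b f` gives `w = b`, so `f w = 0`.
theorem socleEndo_ne_zero [F.Additive] [F.Full] [F.Faithful] (w : E₁ ⟶ E₀) (h : f ≫ w ≫ f = 0)
    (hf : ∀ a : E₁ ⟶ E₀, a ≫ f = 0 → a = 0) (hw : f ≫ w ≠ 0) : hE.socleEndo w h ≠ 0 := by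
  intro h0
  obtain ⟨y, hy⟩ := hE.exists_lift₂ _ h0
  obtain ⟨b, hb, rfl⟩ := hE.exists_of_hom_to_stalk hF y
  have h1 : w ≫ f = b ≫ f := F.map_injective (by
    rw [← hE.comp_desc (w ≫ f) h, hy, ← Category.assoc, comp_desc, F.map_comp])
  have h2 : w = b := by
    rw [← sub_eq_zero]
    exact hf _ (by rw [Preadditive.sub_comp, h1, sub_self])
  exact hw (by rw [h2, hb])

/-- Endomorphisms of `f` induce endomorphisms of the cone. -/
theorem exists_endo {a : E₀ ⟶ E₀} {b : E₁ ⟶ E₁} (h : f ≫ b = a ≫ f) :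
    ∃ x : E ⟶ E, j ≫ x = F.map b ≫ j ∧ x ≫ δ = δ ≫ (F.map a)⟦(1 : ℤ)⟧' := by
  obtain ⟨x, h1, h2⟩ := complete_distinguished_triangle_morphism _ _ hE.distinguished
    hE.distinguished (F.map a) (F.map b) (by
      change F.map f ≫ F.map b = F.map a ≫ F.map f
      rw [← F.map_comp, ← F.map_comp, h])
  exact ⟨x, h1, h2.symm⟩

include hF in
/-- Endomorphisms of the cone are induced by endomorphisms of `f`. -/
theorem exists_of_endo [F.Full] [F.Faithful] (x : E ⟶ E) :
    ∃ (a : E₀ ⟶ E₀) (b : E₁ ⟶ E₁), f ≫ b = a ≫ f ∧ j ≫ x = F.map b ≫ j ∧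
      x ≫ δ = δ ≫ (F.map a)⟦(1 : ℤ)⟧' := by
  obtain ⟨b, hb⟩ := hE.exists_of_hom_from_stalk hF (j ≫ x)
  obtain ⟨a', h1, h2⟩ := complete_distinguished_triangle_morphism₁ _ _ hE.distinguished
    hE.distinguished (F.map b) x hb
  obtain ⟨a, rfl⟩ := F.map_surjective a'
  refine ⟨a, b, F.map_injective ?_, hb, h2.symm⟩
  rw [F.map_comp, F.map_comp]
  exact h1

theorem isIso_endo {a : E₀ ⟶ E₀} {b : E₁ ⟶ E₁} [IsIso a] [IsIso b] (h : f ≫ b = a ≫ f)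
    {x : E ⟶ E} (h₁ : j ≫ x = F.map b ≫ j) (h₂ : x ≫ δ = δ ≫ (F.map a)⟦(1 : ℤ)⟧') :
    IsIso x := by
  let φ : Triangle.mk (F.map f) j δ ⟶ Triangle.mk (F.map f) j δ :=
    { hom₁ := F.map a
      hom₂ := F.map b
      hom₃ := x
      comm₁ := by
        change F.map f ≫ F.map b = F.map a ≫ F.map f
        rw [← F.map_comp, ← F.map_comp, h]
      comm₂ := h₁
      comm₃ := h₂.symm }
  exact isIso₃_of_isIso₁₂ φ hE.distinguished hE.distinguished
    (inferInstanceAs (IsIso (F.map a))) (inferInstanceAs (IsIso (F.map b)))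

include hF in
theorem comp_socleEndo_of_endo [F.Additive] {b : E₁ ⟶ E₁}
    {x : E ⟶ E} (h₁ : j ≫ x = F.map b ≫ j) (w : E₁ ⟶ E₀) (h : f ≫ w ≫ f = 0)
    (h' : f ≫ (b ≫ w) ≫ f = 0) : x ≫ hE.socleEndo w h = hE.socleEndo (b ≫ w) h' := by
  rw [socleEndo, socleEndo, ← Category.assoc]
  congr 1
  apply hE.hom_to_stalk_ext hF
  rw [← Category.assoc, h₁, Category.assoc, comp_desc, comp_desc, ← F.map_comp, Category.assoc]

include hF in
theorem socleEndo_comp_endo [F.Additive] {a : E₀ ⟶ E₀} {b : E₁ ⟶ E₁} (hab : f ≫ b = a ≫ f)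
    {x : E ⟶ E} (h₁ : j ≫ x = F.map b ≫ j) (w : E₁ ⟶ E₀) (h : f ≫ w ≫ f = 0)
    (h' : f ≫ (w ≫ a) ≫ f = 0) : hE.socleEndo w h ≫ x = hE.socleEndo (w ≫ a) h' := by
  rw [socleEndo, socleEndo, Category.assoc, h₁, ← Category.assoc]
  congr 1
  apply hE.hom_to_stalk_ext hF
  rw [← Category.assoc, comp_desc, comp_desc, ← F.map_comp, Category.assoc, hab, Category.assoc]

include hF in
/-- Endomorphisms of the cone which factor through `f` in degree `-1` factor through `E₁`. -/
theorem exists_desc_of_endo [F.Additive] [F.Full] [F.Faithful] {x : E ⟶ E} {c : E₁ ⟶ E₀}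
    (h₂ : x ≫ δ = δ ≫ (F.map (f ≫ c))⟦(1 : ℤ)⟧') :
    ∃ (x₀ : E₁ ⟶ E₁) (h : f ≫ x₀ = 0), x = hE.desc x₀ h ≫ j := by
  obtain ⟨y, rfl⟩ := hE.exists_lift x (by
    rw [h₂, F.map_comp, Functor.map_comp, ← Category.assoc, hE.δ_comp, zero_comp])
  obtain ⟨x₀, h, rfl⟩ := hE.exists_of_hom_to_stalk hF y
  exact ⟨x₀, h, rfl⟩

/-! #### Morphisms between shifts -/

include hF in
-- Such a morphism comes from `E₀[1]`, so only `k = 1` is left; there it is given by a map on `E₀`,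
-- which dies if it extends along `f`.
theorem hom_shift_stalk_eq_zero {N : 𝒜} {k : ℤ} (hk : k ≠ 0) [F.Full]
    (h : k = 1 → ∀ a : E₀ ⟶ N, ∃ b : E₁ ⟶ N, f ≫ b = a) (x : E ⟶ (F.obj N)⟦k⟧) : x = 0 := by
  obtain ⟨y, rfl⟩ := hE.exists_desc₃ x (hF _ _ k hk _)
  by_cases hk1 : k = 1
  · subst hk1
    obtain ⟨y', rfl⟩ := (shiftFunctor C (1 : ℤ)).map_surjective y
    obtain ⟨a, rfl⟩ := F.map_surjective y'
    obtain ⟨b, rfl⟩ := h rfl a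
    rw [F.map_comp, Functor.map_comp, ← Category.assoc, hE.δ_comp, zero_comp]
  · rw [hF.shift (Ne.symm hk1) y, comp_zero]

include hF in
theorem shift_stalk_hom_eq_zero [F.Full] [F.Faithful] [F.Additive] {M : 𝒜} {k : ℤ} (hk : k ≠ 0)
    (h : k = 1 → ∀ a : M ⟶ E₀, a ≫ f = 0 → a = 0) (x : (F.obj M)⟦k⟧ ⟶ E) : x = 0 := by
  have h1 : x ≫ δ = 0 := by
    by_cases hk1 : k = 1
    · subst hk1
      obtain ⟨y', hy'⟩ := (shiftFunctor C (1 : ℤ)).map_surjective (x ≫ δ)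
      obtain ⟨a, rfl⟩ := F.map_surjective y'
      have h0 : a ≫ f = 0 := by
        apply F.map_injective
        apply (shiftFunctor C (1 : ℤ)).map_injective
        rw [F.map_comp, Functor.map_comp, hy', Category.assoc, hE.δ_comp, comp_zero, F.map_zero,
          Functor.map_zero]
      rw [← hy', h rfl a h0, F.map_zero, Functor.map_zero]
    · exact hF.shift hk1 _
  obtain ⟨y, rfl⟩ := hE.exists_lift x h1
  rw [hF.shift_left hk y, zero_comp]

include hF in
theorem hom_stalk_shift_eq_zero [F.Full] [F.Faithful] [F.Additive] {M : 𝒜} {k : ℤ} (hk : k ≠ 0)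
    (h : k = -1 → ∀ a : M ⟶ E₀, a ≫ f = 0 → a = 0) (x : F.obj M ⟶ E⟦k⟧) : x = 0 :=
  eq_zero_of_hom_shift (a := -k) (b := 0) (by lia) (eq_zero_of_hom_shift_zero
    (hE.shift_stalk_hom_eq_zero hF (by lia) fun hk => h (by lia))) x

include hF in
theorem hom_shift_eq_zero [F.Full] [F.Faithful] [F.Additive] {k : ℤ} (hk : k ≠ 0)
    (h₁ : ∀ a : E₁ ⟶ E₀, a ≫ f = 0 → a = 0) (h₂ : ∀ a : E₀ ⟶ E₁, ∃ b : E₁ ⟶ E₁, f ≫ b = a)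
    (x : E ⟶ E⟦k⟧) : x = 0 := by
  obtain ⟨y, rfl⟩ := hE.exists_desc₃ x (hE.hom_stalk_shift_eq_zero hF hk (fun _ => h₁) _)
  by_cases hk1 : k = 1
  · subst hk1
    obtain ⟨y, rfl⟩ := (shiftFunctor C (1 : ℤ)).map_surjective y
    obtain ⟨y₀, rfl⟩ := hE.exists_of_hom_from_stalk hF y
    obtain ⟨b, rfl⟩ := h₂ y₀
    rw [F.map_comp, Functor.map_comp, Functor.map_comp, ← Category.assoc, ← Category.assoc,
      hE.δ_comp, zero_comp, zero_comp]
  -- The morphism now goes from `E₀` to the shift of the cone by `k - 1`; the critical shift `-1`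
  -- would mean `k = 0`.
  · rw [eq_zero_of_shift_hom rfl (hE.hom_stalk_shift_eq_zero hF (by lia) fun h => by lia) y,
      comp_zero]

end IsConeOf

end Cone

/-! ### Nakayama families from universal socle maps -/

section UniversalSocle

variable {C : Type*} [Category.{u} C] [Preadditive C]

/-- `ζ` is a nonzero morphism, annihilated by nonisomorphisms from and to objects in `𝒪`, through
which the nonzero morphisms from its source and to its target are detected. -/
structure IsUniversalSocleMap (𝒪 : ObjectProperty C) {X Y : C} (ζ : X ⟶ Y) : Prop where
  ne_zero : ζ ≠ 0
  comp_left : ∀ (Z : C), 𝒪 Z → ∀ h : Z ⟶ X, ¬ IsIso h → h ≫ ζ = 0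
  comp_right : ∀ (Z : C), 𝒪 Z → ∀ g : Y ⟶ Z, ¬ IsIso g → ζ ≫ g = 0
  exists_left : ∀ (Z : C), 𝒪 Z → ∀ x : Z ⟶ Y, x ≠ 0 → ∃ h : X ⟶ Z, h ≫ x = ζ
  exists_right : ∀ (Z : C), 𝒪 Z → ∀ x : X ⟶ Z, x ≠ 0 → ∃ g : Z ⟶ Y, x ≫ g = ζ

/-- A nonzero socle map can be completed to `ζ i`, and the completing endomorphism must be
invertible, since otherwise it would annihilate the socle map. So any two nonzero socle maps differ
by automorphisms, on either side. -/
theorem isNakayamaFamily_of_isUniversalSocleMap {ι : Type} (T : ι → C) (σ : Equiv.Perm ι)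
    (𝒪 : ObjectProperty C) (hT : ∀ i, 𝒪 (T i)) (h_local : ∀ i, IsLocalRing (End (T i)))
    (h_iso : ∀ i j, Nonempty (T i ≅ T j) → i = j)
    (h : ∀ i, ∃ ζ : T (σ i) ⟶ T i, IsUniversalSocleMap 𝒪 ζ) : IsNakayamaFamily T σ := by
  choose ζ hζ using h
  have hsoc (i : ι) : IsSocleMap T (ζ i) :=
    ⟨fun k h hh => (hζ i).comp_left _ (hT k) h hh, fun k g hg => (hζ i).comp_right _ (hT k) g hg⟩
  have hl {i : ι} (x : T (σ i) ⟶ T i) (hx : IsSocleMap T x) (hx0 : x ≠ 0) :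
      ∃ h : T (σ i) ⟶ T (σ i), IsIso h ∧ h ≫ x = ζ i := by
    obtain ⟨h, hh⟩ := (hζ i).exists_left _ (hT _) x hx0
    refine ⟨h, ?_, hh⟩
    by_contra hiso
    exact (hζ i).ne_zero (hh ▸ hx.comp_left _ h hiso)
  have hr {i : ι} (x : T (σ i) ⟶ T i) (hx : IsSocleMap T x) (hx0 : x ≠ 0) :
      ∃ g : T i ⟶ T i, IsIso g ∧ x ≫ g = ζ i := by
    obtain ⟨g, hg⟩ := (hζ i).exists_right _ (hT _) x hx0
    refine ⟨g, ?_, hg⟩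
    by_contra hiso
    exact (hζ i).ne_zero (hg ▸ hx.comp_right _ g hiso)
  refine ⟨h_local, h_iso, ?_, ?_, ?_, ?_⟩
  · intro i j x hx
    obtain ⟨h, hh⟩ := (hζ i).exists_left _ (hT j) x hx
    exact ⟨h, hh ▸ (hζ i).ne_zero, hh ▸ hsoc i⟩
  · intro i j x hx
    obtain ⟨g, hg⟩ := (hζ j).exists_right _ (hT i) x hx
    exact ⟨g, hg ▸ (hζ j).ne_zero, hg ▸ hsoc j⟩
  · intro i x y hx hy hx0
    by_cases hy0 : y = 0
    · exact ⟨0, by rw [hy0, zero_comp]⟩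
    obtain ⟨h, -, hh⟩ := hl x hx hx0
    obtain ⟨k, hk, hk'⟩ := hl y hy hy0
    exact ⟨inv k ≫ h, by rw [Category.assoc, hh, ← hk', IsIso.inv_hom_id_assoc]⟩
  · intro i x y hx hy hx0
    by_cases hy0 : y = 0
    · exact ⟨0, by rw [hy0, comp_zero]⟩
    obtain ⟨g, -, hg⟩ := hr x hx hx0
    obtain ⟨k, hk, hk'⟩ := hr y hy hy0
    exact ⟨g ≫ inv k, by rw [← Category.assoc, hg, ← hk', Category.assoc, IsIso.hom_inv_id,
      Category.comp_id]⟩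

end UniversalSocle

/-! ### The family of stalk complexes and the cone -/

section Family

variable {R : Type u} [Ring R]

/-- A linear map, as a morphism of finitely generated modules. -/
def toHom {M N : FGModuleCat.{u} R} (g : M →ₗ[R] N) : M ⟶ N :=
  ObjectProperty.homMk (ModuleCat.ofHom g)

theorem comp_eq_iff {M N N' L : FGModuleCat.{u} R} (g : M ⟶ N) (h : N ⟶ L) (g' : M ⟶ N')
    (h' : N' ⟶ L) :
    g ≫ h = g' ≫ h' ↔ h.hom.hom ∘ₗ g.hom.hom = h'.hom.hom ∘ₗ g'.hom.hom :=
  ⟨fun e => congrArg (fun k => k.hom.hom) e, fun e => FGModuleCat.hom_ext e⟩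

theorem eq_zero_iff {M N : FGModuleCat.{u} R} (g : M ⟶ N) : g = 0 ↔ g.hom.hom = 0 :=
  ⟨fun e => congrArg (fun k => k.hom.hom) e, fun e => FGModuleCat.hom_ext e⟩

theorem comp_eq_zero_iff' {M N L : FGModuleCat.{u} R} (g : M ⟶ N) (h : N ⟶ L) :
    g ≫ h = 0 ↔ h.hom.hom ∘ₗ g.hom.hom = 0 := eq_zero_iff _

theorem isIso_iff_bijective' {M N : FGModuleCat.{u} R} (g : M ⟶ N) :
    IsIso g ↔ Function.Bijective g.hom.hom := by
  rw [← ObjectProperty.isIso_hom_iff]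
  exact ConcreteCategory.isIso_iff_bijective g.hom

/-- The modules `P i` with `i ≠ t`, together with a reflection presentation `0 → S → E₀ → E₁`
which behaves with respect to them as the one with `E₀ ≅ P t` does. -/
structure IsReflectionFamily {ι : Type} (P : ι → FGModuleCat.{u} R) (t : ι) (σ : Equiv.Perm ι)
    (ζ : ∀ i, P (σ i) →ₗ[R] P i) {S : Type u} [AddCommGroup S] [Module R S]
    {E₀ E₁ : FGModuleCat.{u} R} (s : S →ₗ[R] E₀) (f : E₀ ⟶ E₁) (p : E₀ →ₗ[R] S) : Prop where
  presentation : IsReflectionPresentation s f.hom.hom p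
  apply_t : σ t = t
  projective : ∀ i, Module.Projective R (P i)
  injective : ∀ i, Module.Injective R (P i)
  local_end : ∀ i, IsLocalRing (Module.End R (P i))
  nonisomorphic : ∀ i j, Nonempty (P i ≅ P j) → i = j
  hom_eq_zero : ∀ i, i ≠ t → ∀ g : P i →ₗ[R] S, g = 0
  not_injective : ∀ i, i ≠ t → ∀ g : E₀ →ₗ[R] P i, ¬ Function.Injective g
  exists_hom : ∀ L : Submodule R E₁, L ≠ ⊤ →
    ∃ i, i ≠ t ∧ ∃ h : P i →ₗ[R] E₁, ¬ LinearMap.range h ≤ L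
  ne_zero : ∀ i, ζ i ≠ 0
  range_le : ∀ i (N : Submodule R (P i)), N ≠ ⊥ → LinearMap.range (ζ i) ≤ N

namespace IsReflectionFamily

variable {ι : Type} {P : ι → FGModuleCat.{u} R} {t : ι} {σ : Equiv.Perm ι}
    {ζ : ∀ i, P (σ i) →ₗ[R] P i} {S : Type u} [AddCommGroup S] [Module R S]
    {E₀ E₁ : FGModuleCat.{u} R} {s : S →ₗ[R] E₀} {f : E₀ ⟶ E₁} {p : E₀ →ₗ[R] S}
    (H : IsReflectionFamily P t σ ζ s f p)
include H

theorem apply_ne {i : ι} (hi : i ≠ t) : σ i ≠ t := fun h =>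
  hi (σ.injective (h.trans H.apply_t.symm))

theorem isAtom_range (i : ι) : IsAtom (LinearMap.range (ζ i)) := by
  refine ⟨fun h1 => H.ne_zero i (LinearMap.range_eq_bot.mp h1), fun N hN => ?_⟩
  by_contra hne
  exact absurd (H.range_le i N hne) (not_le_of_gt hN)

theorem ker_eq_jacobson (i : ι) : LinearMap.ker (ζ i) = Module.jacobson R (P (σ i)) := by
  have := H.projective (σ i)
  have := H.local_end (σ i)
  have : IsSimpleModule R (LinearMap.range (ζ i)) :=
    isSimpleModule_iff_isAtom.mpr (H.isAtom_range i)
  have h0 : (ζ i).rangeRestrict ≠ 0 := fun h0 => H.ne_zero i (by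
    ext x; exact congrArg Subtype.val (DFunLike.congr_fun h0 x))
  rw [← Reflection.ker_eq_jacobson h0, LinearMap.ker_rangeRestrict]

/-- Homomorphisms to `P (σ i)` that are not surjective are annihilated by `ζ i`. -/
theorem ζ_comp_eq_zero {i : ι} {M : Type u} [AddCommGroup M] [Module R M]
    {h : M →ₗ[R] P (σ i)} (hh : ¬ Function.Surjective h) : ζ i ∘ₗ h = 0 := by
  have := H.projective (σ i)
  have := H.local_end (σ i)
  rw [← LinearMap.range_le_ker_iff, H.ker_eq_jacobson]
  exact le_jacobson_of_ne_top fun h => hh (LinearMap.range_eq_top.mp h)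

theorem comp_ζ_eq_zero {i : ι} {M : Type u} [AddCommGroup M] [Module R M]
    {g : P i →ₗ[R] M} (hg : ¬ Function.Injective g) : g ∘ₗ ζ i = 0 := by
  rw [← LinearMap.range_le_ker_iff]
  exact H.range_le i _ fun h => hg (LinearMap.ker_eq_bot.mp h)

theorem exists_comp_eq_ζ {i : ι} {M : Type u} [AddCommGroup M] [Module R M]
    {x : M →ₗ[R] P i} (hx : x ≠ 0) : ∃ h : P (σ i) →ₗ[R] M, x ∘ₗ h = ζ i := by
  have := H.projective (σ i)
  exact exists_factor_of_range_le x (ζ i)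
    (H.range_le i _ fun h => hx (LinearMap.range_eq_bot.mp h))

theorem exists_comp_eq_ζ' {i : ι} {M : Type u} [AddCommGroup M] [Module R M]
    {x : P (σ i) →ₗ[R] M} (hx : x ≠ 0) : ∃ g : M →ₗ[R] P i, g ∘ₗ x = ζ i := by
  have := H.projective (σ i)
  have := H.local_end (σ i)
  have := H.injective i
  refine exists_factor_of_ker_le x (ζ i) ?_
  rw [H.ker_eq_jacobson]
  exact le_jacobson_of_ne_top fun h => hx (LinearMap.ker_eq_top.mp h)

/-- Homomorphisms `P (σ i) → E₁` that do not factor through `f` are detected by homomorphisms from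
the cokernel of `f`. -/
theorem exists_comp_eq_ζ_of_not_le {i : ι} {x : P (σ i) →ₗ[R] E₁}
    (hx : ¬ LinearMap.range x ≤ LinearMap.range f.hom.hom) :
    ∃ g : E₁ →ₗ[R] P i, g ∘ₗ f.hom.hom = 0 ∧ g ∘ₗ x = ζ i := by
  have h0 : (LinearMap.range f.hom.hom).mkQ ∘ₗ x ≠ 0 := by
    intro h0
    apply hx
    have := LinearMap.range_le_ker_iff.mpr h0
    rwa [Submodule.ker_mkQ] at this
  obtain ⟨g, hg⟩ := H.exists_comp_eq_ζ' h0
  refine ⟨g ∘ₗ (LinearMap.range f.hom.hom).mkQ, ?_, hg⟩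
  rw [LinearMap.comp_assoc, LinearMap.range_mkQ_comp, LinearMap.comp_zero]

theorem range_le_of_exists {M : FGModuleCat.{u} R} (x : M ⟶ E₁)
    (hx : ∀ a : M ⟶ E₀, a ≫ f ≠ x) (hM : Module.Projective R M) :
    ¬ LinearMap.range x.hom.hom ≤ LinearMap.range f.hom.hom := by
  intro hle
  obtain ⟨a, ha⟩ := exists_factor_of_range_le _ _ hle
  exact hx (toHom a) (FGModuleCat.hom_ext ha)

theorem isIso_of_surjective {i j : ι} {h : P i ⟶ P j} (hh : Function.Surjective h.hom.hom) :
    IsIso h := by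
  have := H.projective j
  have := H.local_end i
  have hP : Indecomposable (P i).obj := indecomposable_of_isLocalRing_module_end _
  obtain ⟨r, hr⟩ := Module.projective_lifting_property _ LinearMap.id hh
  rw [isIso_iff_bijective']
  exact bijective_of_retraction hP (nontrivial_of_isLocalRing_end (H.local_end j)) r _ hr

theorem isIso_of_injective {i j : ι} {h : P i ⟶ P j} (hh : Function.Injective h.hom.hom) :
    IsIso h := by
  have := H.injective i
  have := H.local_end j
  have hP : Indecomposable (P j).obj := indecomposable_of_isLocalRing_module_end _
  obtain ⟨r, hr⟩ := Module.Injective.out _ hh LinearMap.id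
  have hr' : r ∘ₗ h.hom.hom = LinearMap.id := LinearMap.ext hr
  have hb := bijective_of_retraction hP (nontrivial_of_isLocalRing_end (H.local_end i)) _ r hr'
  have h1 : IsIso (h ≫ toHom r) := by
    have : h ≫ toHom r = 𝟙 _ := FGModuleCat.hom_ext hr'
    rw [this]; infer_instance
  have h2 : IsIso (toHom r) := (isIso_iff_bijective' _).mpr hb
  exact IsIso.of_isIso_comp_right h (toHom r)

end IsReflectionFamily

end Family

/-! ### The reflected family is a Nakayama family -/

section ReflectedFamily

variable {R : Type u} [Ring R] {C : Type*} [Category.{u} C] [HasZeroObject C]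
  [HasShift C ℤ] [Preadditive C] [∀ n : ℤ, (shiftFunctor C n).Additive] [Pretriangulated C]
  {F : FGModuleCat.{u} R ⥤ C} [F.Full] [F.Faithful] [F.Additive] (hF : HomShiftVanishes F)
  {ι : Type} {P : ι → FGModuleCat.{u} R} {t : ι} {σ : Equiv.Perm ι}
  {ζ : ∀ i, P (σ i) →ₗ[R] P i} {S : Type u} [AddCommGroup S] [Module R S]
  {E₀ E₁ : FGModuleCat.{u} R} {s : S →ₗ[R] E₀} {f : E₀ ⟶ E₁} {p : E₀ →ₗ[R] S}
  {E : C} {j : F.obj E₁ ⟶ E} {δ : E ⟶ (F.obj E₀)⟦(1 : ℤ)⟧}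
  (hE : IsConeOf F f j δ) (H : IsReflectionFamily P t σ ζ s f p)

/-- The objects `F (P i)` with `i ≠ t`, and `E`. -/
def reflected (F : FGModuleCat.{u} R ⥤ C) (P : ι → FGModuleCat.{u} R) (t : ι) (E : C) :
    ObjectProperty C := fun Z => Z = E ∨ ∃ i, i ≠ t ∧ Z = F.obj (P i)

theorem isLocalRing_end_of_isIso_or_isIso {X : C} [Nontrivial (End X)]
    (h : ∀ x : X ⟶ X, IsIso x ∨ IsIso (𝟙 X - x)) : IsLocalRing (End X) :=
  IsLocalRing.of_isUnit_or_isUnit_one_sub_self fun x =>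
    (h x).imp (isUnit_iff_isIso _).mpr (isUnit_iff_isIso _).mpr

namespace IsConeOf

include hF hE in
theorem desc_eq_zero_iff {N : FGModuleCat.{u} R} (x₀ : E₁ ⟶ N) (h : f ≫ x₀ = 0) :
    hE.desc x₀ h = 0 ↔ x₀ = 0 := by
  constructor
  · intro h0
    apply F.map_injective
    rw [← hE.comp_desc x₀ h, h0, comp_zero, F.map_zero]
  · rintro rfl
    exact hE.hom_to_stalk_ext hF (by rw [comp_desc, F.map_zero, comp_zero])

end IsConeOf

namespace IsReflectionFamily

include H

theorem comp_f_eq_zero (a : E₁ ⟶ E₀) (ha : a ≫ f = 0) : a = 0 := by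
  rw [comp_eq_zero_iff'] at ha
  exact FGModuleCat.hom_ext (H.presentation.eq_zero_of_comp_eq_zero H.presentation.hom_eq_zero _ ha)

theorem exists_extension {N : FGModuleCat.{u} R} (hN : Module.Injective R N) (g : E₀ ⟶ N)
    (hg : ¬ Function.Injective g.hom.hom) : ∃ b : E₁ ⟶ N, f ≫ b = g := by
  obtain ⟨b, hb⟩ := H.presentation.exists_extension _ hg
  exact ⟨toHom b, FGModuleCat.hom_ext hb⟩

theorem isIso_of_comp_eq [IsArtinianRing R] {a : E₀ ⟶ E₀} {b : E₁ ⟶ E₁} (hab : f ≫ b = a ≫ f)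
    (ha : Function.Bijective a.hom.hom) : IsIso b :=
  (isIso_iff_bijective' _).mpr
    (H.presentation.bijective_of_comp_eq ha ((comp_eq_iff _ _ _ _).mp hab))

include hF hE in
/-- Endomorphisms of the cone are automorphisms or factor through `E₁`. -/
theorem isIso_or_exists_desc [IsArtinianRing R] (x : E ⟶ E) :
    IsIso x ∨ ∃ (x₀ : E₁ ⟶ E₁) (h : f ≫ x₀ = 0), x = hE.desc x₀ h ≫ j := by
  obtain ⟨a, b, hab, h₁, h₂⟩ := hE.exists_of_endo hF x
  -- The component in degree `-1` decides: if injective it is an automorphism, and so is `b`;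
  -- otherwise it factors through `f` and can be removed by a homotopy.
  by_cases ha : Function.Injective a.hom.hom
  · left
    have ha' := H.presentation.bijective_of_injective _ ha
    have := (isIso_iff_bijective' a).mpr ha'
    have := H.isIso_of_comp_eq hab ha'
    exact hE.isIso_endo hab h₁ h₂
  · right
    obtain ⟨c, rfl⟩ := H.exists_extension H.presentation.injective₀ a ha
    exact hE.exists_desc_of_endo hF h₂

theorem exists_socle_hom : ∃ w : E₁ ⟶ E₀, f ≫ w ≫ f = 0 ∧ f ≫ w ≠ 0 := by
  obtain ⟨w, h1, h2⟩ := H.presentation.exists_socle_hom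
  refine ⟨toHom w, FGModuleCat.hom_ext h1, fun h => h2 ?_⟩
  exact (comp_eq_zero_iff' _ _).mp h

include hF hE in
theorem nontrivial_cone_end : Nontrivial (End E) := by
  obtain ⟨w, h1, h2⟩ := H.exists_socle_hom
  exact ⟨hE.socleEndo w h1, 0, hE.socleEndo_ne_zero hF w h1 H.comp_f_eq_zero h2⟩

-- Locality is inherited from `E₀`: an endomorphism of the cone comes from a pair `(a, b)`, and
-- bijectivity of `a` forces that of `b`. The same applies to `1 - a`.
include hF hE in
theorem isLocalRing_cone_end [IsArtinianRing R] : IsLocalRing (End E) := by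
  have := H.nontrivial_cone_end hF hE
  have := H.presentation.local_end
  refine isLocalRing_end_of_isIso_or_isIso fun x => ?_
  obtain ⟨a, b, hab, h₁, h₂⟩ := hE.exists_of_endo hF x
  rcases bijective_or_bijective_one_sub a.hom.hom with ha | ha
  · left
    have := (isIso_iff_bijective' a).mpr ha
    have := H.isIso_of_comp_eq hab ha
    exact hE.isIso_endo hab h₁ h₂
  · right
    have hab' : f ≫ (𝟙 _ - b) = (𝟙 _ - a) ≫ f := by
      rw [Preadditive.comp_sub, Preadditive.sub_comp, hab, Category.comp_id, Category.id_comp]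
    have ha' : Function.Bijective (𝟙 E₀ - a).hom.hom := ha
    have := (isIso_iff_bijective' (𝟙 E₀ - a)).mpr ha'
    have := H.isIso_of_comp_eq hab' ha'
    refine hE.isIso_endo hab' ?_ ?_
    · rw [Preadditive.comp_sub, h₁, F.map_sub, Preadditive.sub_comp, Category.comp_id, F.map_id,
        Category.id_comp]
    · rw [Preadditive.sub_comp, h₂, F.map_sub, Functor.map_sub, Preadditive.comp_sub,
        F.map_id, CategoryTheory.Functor.map_id, Category.comp_id, Category.id_comp]

theorem isLocalRing_end (i : ι) : IsLocalRing (End (F.obj (P i))) := by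
  have := H.local_end i
  have hid : (𝟙 (F.obj (P i))) ≠ 0 := by
    rw [← F.map_id, ← F.map_zero, F.map_injective.ne_iff]
    intro h0
    apply one_ne_zero (α := Module.End R (P i))
    exact (eq_zero_iff _).mp h0
  have : Nontrivial (End (F.obj (P i))) := ⟨𝟙 _, 0, hid⟩
  refine isLocalRing_end_of_isIso_or_isIso fun x => ?_
  obtain ⟨a, rfl⟩ := F.map_surjective x
  rcases bijective_or_bijective_one_sub a.hom.hom with ha | ha
  · left
    have := (isIso_iff_bijective' a).mpr ha
    infer_instance
  · right
    have := (isIso_iff_bijective' (𝟙 _ - a)).mpr ha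
    have h : IsIso (F.map (𝟙 _ - a)) := inferInstance
    rw [F.map_sub, F.map_id] at h
    exact h

-- If the cone were a stalk complex, its connecting morphism would vanish and `f` would be a
-- monomorphism, which `exists_socle_hom` excludes.
include hF hE in
theorem not_iso_cone (i : ι) (e : E ≅ F.obj (P i)) : False := by
  have h0 : δ = 0 := by
    rw [← Iso.cancel_iso_inv_left e, comp_zero]; exact hF _ _ 1 one_ne_zero _
  have h1 : Mono (F.map f) := (Triangle.mor₃_eq_zero_iff_mono₁ _ hE.distinguished).mp h0
  have h2 : Mono f := F.mono_of_mono_map h1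
  obtain ⟨w, h3, h4⟩ := H.exists_socle_hom
  apply h4
  rw [← cancel_mono f, Category.assoc, h3, zero_comp]

omit H in
theorem not_isIso_of_not_isIso_map {M N : FGModuleCat.{u} R} {g : M ⟶ N} (h : ¬ IsIso (F.map g)) :
    ¬ IsIso g := fun _ => h inferInstance

include hF hE in
/-- The socle maps of the stalk complexes. -/
theorem isUniversalSocleMap_stalk (i : ι) :
    IsUniversalSocleMap (reflected F P t E) (F.map (toHom (ζ i))) := by
  have := nontrivial_of_isLocalRing_end (H.local_end (σ i))
  have := H.projective (σ i)
  refine ⟨?_, ?_, ?_, ?_, ?_⟩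
  · rw [← F.map_zero, F.map_injective.ne_iff]
    exact fun h => H.ne_zero i ((eq_zero_iff _).mp h)
  · rintro Z (rfl | ⟨k, hk, rfl⟩) h hh
    · obtain ⟨x₀, h0, rfl⟩ := hE.exists_of_hom_to_stalk hF h
      rw [hE.desc_comp_map hF, hE.desc_eq_zero_iff hF, comp_eq_zero_iff']
      exact H.ζ_comp_eq_zero (H.presentation.not_surjective _ ((comp_eq_zero_iff' _ _).mp h0))
    · obtain ⟨h, rfl⟩ := F.map_surjective h
      rw [← F.map_comp, (comp_eq_zero_iff' _ _).mpr, F.map_zero]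
      exact H.ζ_comp_eq_zero fun hs => not_isIso_of_not_isIso_map hh (H.isIso_of_surjective hs)
  · rintro Z (rfl | ⟨k, hk, rfl⟩) g hg
    · obtain ⟨x₀, rfl⟩ := hE.exists_of_hom_from_stalk hF g
      rw [← Category.assoc, ← F.map_comp, hE.map_comp_eq_zero_iff]
      -- The image of the simple socle is zero or simple, so it lies in the essential submodule `im
      -- f`. Hence the map factors through `f` and becomes zero in the cone.
      have hle : LinearMap.range (x₀.hom.hom ∘ₗ ζ i) ≤ LinearMap.range f.hom.hom := by
        by_cases h0 : x₀.hom.hom ∘ₗ ζ i = 0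
        · rw [h0, LinearMap.range_zero]; exact bot_le
        apply H.presentation.le_range_of_isAtom
        have hs := isSimpleModule_iff_isAtom.mpr (H.isAtom_range i)
        rw [← isSimpleModule_iff_isAtom, LinearMap.range_comp]
        have hinj : Function.Injective (x₀.hom.hom ∘ₗ (LinearMap.range (ζ i)).subtype) := by
          refine (LinearMap.injective_or_eq_zero _).resolve_right fun h1 => h0 ?_
          ext y
          exact DFunLike.congr_fun h1 ⟨ζ i y, y, rfl⟩
        have e := LinearEquiv.ofInjective _ hinj
        rw [LinearMap.range_comp, Submodule.range_subtype] at e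
        exact IsSimpleModule.congr e.symm
      obtain ⟨a, ha⟩ := exists_factor_of_range_le _ _ hle
      exact ⟨toHom a, FGModuleCat.hom_ext ha⟩
    · obtain ⟨g, rfl⟩ := F.map_surjective g
      rw [← F.map_comp, (comp_eq_zero_iff' _ _).mpr, F.map_zero]
      exact H.comp_ζ_eq_zero fun hs => not_isIso_of_not_isIso_map hg (H.isIso_of_injective hs)
  · rintro Z (rfl | ⟨k, hk, rfl⟩) x hx
    · obtain ⟨x₀, h0, rfl⟩ := hE.exists_of_hom_to_stalk hF x
      rw [Ne, hE.desc_eq_zero_iff hF, eq_zero_iff] at hx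
      obtain ⟨h, hh⟩ := H.exists_comp_eq_ζ hx
      refine ⟨F.map (toHom h) ≫ j, ?_⟩
      rw [Category.assoc, hE.comp_desc, ← F.map_comp]
      exact congrArg F.map (FGModuleCat.hom_ext hh)
    · obtain ⟨x, rfl⟩ := F.map_surjective x
      rw [← F.map_zero, F.map_injective.ne_iff, Ne, eq_zero_iff] at hx
      obtain ⟨h, hh⟩ := H.exists_comp_eq_ζ hx
      exact ⟨F.map (toHom h), by
        rw [← F.map_comp]; exact congrArg F.map (FGModuleCat.hom_ext hh)⟩
  · rintro Z (rfl | ⟨k, hk, rfl⟩) x hx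
    · obtain ⟨x₀, rfl⟩ := hE.exists_of_hom_from_stalk hF x
      have h1 (a : P (σ i) ⟶ E₀) : a ≫ f ≠ x₀ := fun ha =>
        hx ((hE.map_comp_eq_zero_iff _).mpr ⟨a, ha⟩)
      obtain ⟨g, hg0, hg⟩ :=
        H.exists_comp_eq_ζ_of_not_le (H.range_le_of_exists x₀ h1 (H.projective _))
      refine ⟨hE.desc (toHom g) (FGModuleCat.hom_ext hg0), ?_⟩
      rw [Category.assoc, hE.comp_desc, ← F.map_comp]
      exact congrArg F.map (FGModuleCat.hom_ext hg)
    · obtain ⟨x, rfl⟩ := F.map_surjective x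
      rw [← F.map_zero, F.map_injective.ne_iff, Ne, eq_zero_iff] at hx
      obtain ⟨h, hh⟩ := H.exists_comp_eq_ζ' hx
      exact ⟨F.map (toHom h), by
        rw [← F.map_comp]; exact congrArg F.map (FGModuleCat.hom_ext hh)⟩

-- Both `f w` and `f w'` are nonzero maps from `E₀` to its simple socle, so endomorphisms of `E₀`
-- carry one to the other on either side. These extend along `f` and induce endomorphisms of the
-- cone.
include hF in
theorem exists_comp_socleEndo {w w' : E₁ ⟶ E₀} (h : f ≫ w ≫ f = 0) (h' : f ≫ w' ≫ f = 0)
    (hw : f ≫ w ≠ 0) (hw' : f ≫ w' ≠ 0) :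
    (∃ k : E ⟶ E, k ≫ hE.socleEndo w h = hE.socleEndo w' h') ∧
      ∃ k : E ⟶ E, hE.socleEndo w h ≫ k = hE.socleEndo w' h' := by
  have hmem {w : E₁ ⟶ E₀} (h : f ≫ w ≫ f = 0) : f.hom.hom ∘ₗ (f ≫ w).hom.hom = 0 := by
    rw [← comp_eq_zero_iff', Category.assoc, h]
  obtain ⟨⟨k, hk⟩, k', hk'⟩ := H.presentation.exists_comp_eq (hmem h)
    (fun h0 => hw ((eq_zero_iff _).mpr h0)) (hmem h') (fun h0 => hw' ((eq_zero_iff _).mpr h0))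
  replace hk : (f ≫ w) ≫ toHom k = f ≫ w' := FGModuleCat.hom_ext hk
  replace hk' : toHom k' ≫ f ≫ w = f ≫ w' := FGModuleCat.hom_ext hk'
  -- `a` followed by `f` is never injective: an injective `a` has an image containing the socle,
  -- which is the kernel of `f`.
  have hext (a : E₀ ⟶ E₀) : ∃ b : E₁ ⟶ E₁, f ≫ b = a ≫ f := by
    refine H.exists_extension H.presentation.injective₁ _ fun hi => ?_
    have hi' : Function.Injective (f.hom.hom ∘ a.hom.hom) := hi
    have ha : Function.Injective a.hom.hom := Function.Injective.of_comp hi'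
    have hs := H.presentation.range_le (LinearMap.range a.hom.hom) fun h0 => by
      have : a.hom.hom = 0 := LinearMap.range_eq_bot.mp h0
      obtain ⟨w, h3, h4⟩ := H.exists_socle_hom
      apply h4
      apply FGModuleCat.hom_ext
      ext y
      apply ha
      simp [this]
    rw [← H.presentation.ker_eq] at hs
    apply H.presentation.ker_ne_bot
    rw [Submodule.eq_bot_iff]
    intro y hy
    obtain ⟨z, rfl⟩ := hs hy
    have hz : z = 0 := hi (by rw [map_zero]; exact hy)
    rw [hz, map_zero]
  constructor
  · obtain ⟨b, hb⟩ := hext (toHom k')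
    obtain ⟨x, h₁, h₂⟩ := hE.exists_endo hb
    have h0 : f ≫ b ≫ w = f ≫ w' := by rw [← Category.assoc, hb, Category.assoc, hk']
    have h3 : f ≫ (b ≫ w) ≫ f = 0 := by
      rw [← Category.assoc, h0, Category.assoc, h']
    refine ⟨x, ?_⟩
    rw [hE.comp_socleEndo_of_endo hF h₁ w h h3]
    exact hE.socleEndo_congr hF _ _ h0
  · obtain ⟨b, hb⟩ := hext (toHom k)
    obtain ⟨x, h₁, h₂⟩ := hE.exists_endo hb
    have h0 : f ≫ w ≫ toHom k = f ≫ w' := by rw [← Category.assoc, hk]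
    have h3 : f ≫ (w ≫ toHom k) ≫ f = 0 := by
      rw [← Category.assoc, h0, Category.assoc, h']
    refine ⟨x, ?_⟩
    rw [hE.socleEndo_comp_endo hF hb h₁ w h h3]
    exact hE.socleEndo_congr hF _ _ h0

include hF in
/-- If `x₀ : E₁ ⟶ E₁` factors through `f` and induces a nonzero endomorphism of the cone, then this
is a nonzero socle endomorphism. -/
theorem comp_ne_zero_of_desc_ne_zero {a : E₁ ⟶ E₀} (h : f ≫ a ≫ f = 0)
    (hx : hE.desc (a ≫ f) h ≫ j ≠ 0) : f ≫ a ≠ 0 := by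
  intro h0
  apply hx
  have h1 : f ≫ (0 : E₁ ⟶ E₀) ≫ f = 0 := by rw [zero_comp, comp_zero]
  have h2 := hE.socleEndo_congr hF h h1 (by rw [h0, comp_zero])
  have h3 : hE.desc ((0 : E₁ ⟶ E₀) ≫ f) h1 = 0 :=
    (hE.desc_eq_zero_iff hF _ _).mpr zero_comp
  rw [IsConeOf.socleEndo, IsConeOf.socleEndo, h3, zero_comp] at h2
  exact h2

/-- The preimage of `im f` under `x₀` is a proper submodule of `E₁`, and maps from the `P k` with `k
≠ t` detect proper submodules. This reduces endomorphisms of the cone to morphisms from or to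
stalks. -/
theorem exists_not_factor (x₀ : E₁ ⟶ E₁) (hx : ∀ a : E₁ ⟶ E₀, a ≫ f ≠ x₀) :
    ∃ k, k ≠ t ∧ ∃ h : P k ⟶ E₁,
      ¬ LinearMap.range (h ≫ x₀).hom.hom ≤ LinearMap.range f.hom.hom := by
  have h1 := H.range_le_of_exists x₀ hx H.presentation.projective₁
  obtain ⟨k, hk, h, hh⟩ := H.exists_hom (Submodule.comap x₀.hom.hom (LinearMap.range f.hom.hom))
    fun h => h1 (by
      rintro _ ⟨y, rfl⟩
      have : y ∈ (⊤ : Submodule R E₁) := trivial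
      rwa [← h] at this)
  refine ⟨k, hk, toHom h, fun hle => hh ?_⟩
  rintro _ ⟨y, rfl⟩
  exact hle ⟨y, rfl⟩

variable [IsArtinianRing R] [Module.Injective R R]

-- `exists_of_hom_from_projective` completes `x` to some nonzero socle endomorphism of the cone, and
-- `exists_comp_socleEndo` corrects it to the given one.
include hF in
theorem exists_left_stalk {w : E₁ ⟶ E₀} (hw : f ≫ w ≫ f = 0) (hw0 : f ≫ w ≠ 0)
    {N : FGModuleCat.{u} R} (x : F.obj N ⟶ E) (hx : x ≠ 0) :
    ∃ h : E ⟶ F.obj N, h ≫ x = hE.socleEndo w hw := by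
  obtain ⟨x₀, rfl⟩ := hE.exists_of_hom_from_stalk hF x
  have : Module.Finite R N := N.2
  obtain ⟨h, w', h1, h2, h3⟩ := H.presentation.exists_of_hom_from_projective x₀.hom.hom
    fun a ha => hx ((hE.map_comp_eq_zero_iff _).mpr ⟨toHom a, FGModuleCat.hom_ext ha⟩)
  replace h1 : toHom h ≫ x₀ = toHom w' ≫ f := FGModuleCat.hom_ext h1
  replace h2 : f ≫ toHom h = 0 := FGModuleCat.hom_ext h2
  replace h3 : f ≫ toHom w' ≠ 0 := fun h0 => h3 ((comp_eq_zero_iff' _ _).mp h0)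
  have h4 : f ≫ toHom w' ≫ f = 0 := by rw [← h1, ← Category.assoc, h2, zero_comp]
  obtain ⟨⟨k, hk⟩, -⟩ := H.exists_comp_socleEndo hF hE h4 hw h3 hw0
  refine ⟨k ≫ hE.desc (toHom h) h2, ?_⟩
  rw [← hk, Category.assoc, IsConeOf.socleEndo, ← Category.assoc (hE.desc _ _),
    hE.desc_comp_map hF]
  congr 3

include hF in
theorem exists_right_stalk {w : E₁ ⟶ E₀} (hw : f ≫ w ≫ f = 0) (hw0 : f ≫ w ≠ 0)
    {N : FGModuleCat.{u} R} (x : E ⟶ F.obj N) (hx : x ≠ 0) :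
    ∃ g : F.obj N ⟶ E, x ≫ g = hE.socleEndo w hw := by
  obtain ⟨x₀, h0, rfl⟩ := hE.exists_of_hom_to_stalk hF x
  rw [Ne, hE.desc_eq_zero_iff hF, eq_zero_iff] at hx
  obtain ⟨g, w', h1, h3⟩ := H.presentation.exists_of_hom_to_injective x₀.hom.hom hx
    ((comp_eq_zero_iff' _ _).mp h0)
  replace h1 : x₀ ≫ toHom g = toHom w' ≫ f := FGModuleCat.hom_ext h1
  replace h3 : f ≫ toHom w' ≠ 0 := fun h0 => h3 ((comp_eq_zero_iff' _ _).mp h0)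
  have h4 : f ≫ toHom w' ≫ f = 0 := by rw [← h1, ← Category.assoc, h0, zero_comp]
  obtain ⟨-, k, hk⟩ := H.exists_comp_socleEndo hF hE h4 hw h3 hw0
  refine ⟨F.map (toHom g) ≫ j ≫ k, ?_⟩
  rw [← hk, IsConeOf.socleEndo, ← Category.assoc, hE.desc_comp_map hF, Category.assoc _ j]
  congr 2

include hF in
/-- The socle map of the cone. -/
theorem isUniversalSocleMap_cone {w : E₁ ⟶ E₀} (hw : f ≫ w ≫ f = 0) (hw0 : f ≫ w ≠ 0) :
    IsUniversalSocleMap (reflected F P t E) (hE.socleEndo w hw) := by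
  refine ⟨hE.socleEndo_ne_zero hF w hw H.comp_f_eq_zero hw0, ?_, ?_, ?_, ?_⟩
  · rintro Z (rfl | ⟨k, hk, rfl⟩) h hh
    · obtain ⟨x₀, h0, rfl⟩ := (H.isIso_or_exists_desc hF hE h).resolve_left hh
      rw [Category.assoc, hE.comp_socleEndo, comp_zero]
    · obtain ⟨x₀, rfl⟩ := hE.exists_of_hom_from_stalk hF h
      rw [Category.assoc, hE.comp_socleEndo, comp_zero]
  · rintro Z (rfl | ⟨k, hk, rfl⟩) g hg
    · obtain ⟨x₀, h0, rfl⟩ := (H.isIso_or_exists_desc hF hE g).resolve_left hg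
      rw [← Category.assoc, hE.socleEndo_comp_desc w hw x₀ h0 hF, zero_comp]
    · obtain ⟨x₀, h0, rfl⟩ := hE.exists_of_hom_to_stalk hF g
      rw [hE.socleEndo_comp_desc w hw x₀ h0 hF]
  · rintro Z (rfl | ⟨k, hk, rfl⟩) x hx
    · rcases H.isIso_or_exists_desc hF hE x with hiso | ⟨x₀, h0, rfl⟩
      · exact ⟨hE.socleEndo w hw ≫ inv x, by simp⟩
      -- If `x₀` factors through `f`, then `x` is itself a nonzero socle endomorphism. Otherwise it
      -- stays nonzero after composition with a morphism from some stalk `P k`, to which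
      -- `exists_left_stalk` applies.
      by_cases hfac : ∃ a : E₁ ⟶ E₀, a ≫ f = x₀
      · obtain ⟨a, rfl⟩ := hfac
        exact (H.exists_comp_socleEndo hF hE h0 hw
          (H.comp_ne_zero_of_desc_ne_zero hF hE h0 hx) hw0).1
      · push Not at hfac
        obtain ⟨k, hk, h, hh⟩ := H.exists_not_factor x₀ hfac
        have hne : F.map (h ≫ x₀) ≫ j ≠ 0 := fun h1 => by
          obtain ⟨a, ha⟩ := (hE.map_comp_eq_zero_iff _).mp h1
          apply hh
          rw [← ha]
          exact LinearMap.range_comp_le_range a.hom.hom f.hom.hom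
        obtain ⟨y, hy⟩ := H.exists_left_stalk hF hE hw hw0 _ hne
        refine ⟨y ≫ F.map h ≫ j, ?_⟩
        rw [← hy, Category.assoc, Category.assoc, ← Category.assoc j, hE.comp_desc,
          F.map_comp, Category.assoc]
    · exact H.exists_left_stalk hF hE hw hw0 x hx
  · rintro Z (rfl | ⟨k, hk, rfl⟩) x hx
    · rcases H.isIso_or_exists_desc hF hE x with hiso | ⟨x₀, h0, rfl⟩
      · exact ⟨inv x ≫ hE.socleEndo w hw, by simp⟩
      by_cases hfac : ∃ a : E₁ ⟶ E₀, a ≫ f = x₀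
      · obtain ⟨a, rfl⟩ := hfac
        exact (H.exists_comp_socleEndo hF hE h0 hw
          (H.comp_ne_zero_of_desc_ne_zero hF hE h0 hx) hw0).2
      · push Not at hfac
        obtain ⟨k, hk, h, hh⟩ := H.exists_not_factor x₀ hfac
        -- Writing `k` as `σ i` makes the socle map of `P i` available: it shows that `x₀` followed
        -- by a suitable map to `P i` is nonzero.
        obtain ⟨i, rfl⟩ := σ.surjective k
        obtain ⟨g, hg0, hg⟩ := H.exists_comp_eq_ζ_of_not_le hh
        have hg0' : f ≫ toHom g = 0 := FGModuleCat.hom_ext hg0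
        have hne : x₀ ≫ toHom g ≠ 0 := fun h1 => H.ne_zero i (by
          have : (h ≫ x₀) ≫ toHom g = 0 := by rw [Category.assoc, h1, comp_zero]
          exact hg.symm.trans ((comp_eq_zero_iff' _ _).mp this))
        have h2 : hE.desc (x₀ ≫ toHom g) (by rw [← Category.assoc, h0, zero_comp]) ≠ 0 :=
          fun h3 => hne ((hE.desc_eq_zero_iff hF _ _).mp h3)
        obtain ⟨y, hy⟩ := H.exists_right_stalk hF hE hw hw0 _ h2
        refine ⟨hE.desc (toHom g) hg0' ≫ y, ?_⟩
        rw [← hy, Category.assoc, ← Category.assoc j, hE.comp_desc, ← Category.assoc,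
          hE.desc_comp_map hF]
    · exact H.exists_right_stalk hF hE hw hw0 x hx

include hF hE in
theorem isNakayamaFamily (T : ι → C) (ht : T t = E) (hT : ∀ i, i ≠ t → T i = F.obj (P i)) :
    IsNakayamaFamily T σ := by
  refine isNakayamaFamily_of_isUniversalSocleMap T σ (reflected F P t E) ?_ ?_ ?_ ?_
  · intro i
    by_cases hi : i = t
    · exact .inl (hi ▸ ht)
    · exact .inr ⟨i, hi, hT i hi⟩
  · intro i
    by_cases hi : i = t
    · rw [hi, ht]; exact H.isLocalRing_cone_end hF hE
    · rw [hT i hi]; exact H.isLocalRing_end i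
  · rintro i k ⟨e⟩
    by_cases hi : i = t <;> by_cases hk : k = t
    · rw [hi, hk]
    · rw [hi, ht, hT k hk] at e
      exact (H.not_iso_cone hF hE k e).elim
    · rw [hT i hi, hk, ht] at e
      exact (H.not_iso_cone hF hE i e.symm).elim
    · rw [hT i hi, hT k hk] at e
      exact H.nonisomorphic i k ⟨F.preimageIso e⟩
  · intro i
    by_cases hi : i = t
    · obtain ⟨w, hw, hw0⟩ := H.exists_socle_hom
      rw [hi, H.apply_t, ht]
      exact ⟨_, H.isUniversalSocleMap_cone hF hE hw hw0⟩
    · rw [hT i hi, hT _ (H.apply_ne hi)]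
      exact ⟨_, H.isUniversalSocleMap_stalk hF hE i⟩

end IsReflectionFamily

end ReflectedFamily

/-! ### Stalk complexes in the homotopy category -/

section Stalk

variable {𝒜 : Type*} [Category* 𝒜] [Preadditive 𝒜] [HasZeroObject 𝒜]

instance full_singleFunctor (n : ℤ) : (HomotopyCategory.singleFunctor 𝒜 n).Full :=
  inferInstanceAs (CochainComplex.singleFunctor 𝒜 n ⋙ HomotopyCategory.quotient _ _).Full

/-- With zero differentials, both terms of a homotopy relation vanish. -/
theorem eq_of_quotient_map_eq {X Y : CochainComplex 𝒜 ℤ} {g h : X ⟶ Y} {n : ℤ}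
    (hX : ∀ i j, X.d i j = 0) (hY : ∀ i j, Y.d i j = 0)
    (hgh : (HomotopyCategory.quotient 𝒜 (ComplexShape.up ℤ)).map g =
      (HomotopyCategory.quotient _ _).map h) : g.f n = h.f n := by
  have H := (HomotopyCategory.homotopyOfEq _ _ hgh).comm n
  rw [H]
  simp [dNext, prevD, hX, hY]

instance faithful_singleFunctor (n : ℤ) : (HomotopyCategory.singleFunctor 𝒜 n).Faithful where
  map_injective {M N g h} hgh := by
    apply (CochainComplex.singleFunctor 𝒜 n).map_injective
    ext i
    exact eq_of_quotient_map_eq (by simp) (by simp) hgh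

theorem hom_single_eq_zero {M N : 𝒜} {a b : ℤ} (hab : a ≠ b)
    (g : (HomotopyCategory.singleFunctor 𝒜 a).obj M ⟶
      (HomotopyCategory.singleFunctor 𝒜 b).obj N) : g = 0 := by
  obtain ⟨g, rfl⟩ := (HomotopyCategory.quotient 𝒜 (ComplexShape.up ℤ)).map_surjective g
  have : g = 0 := by
    ext i
    by_cases hi : i = a
    · exact (HomologicalComplex.isZero_single_obj_X (ComplexShape.up ℤ) b N i
        (hi ▸ hab)).eq_of_tgt _ _
    · exact (HomologicalComplex.isZero_single_obj_X (ComplexShape.up ℤ) a M i hi).eq_of_src _ _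
  rw [this, Functor.map_zero]
  rfl

theorem homShiftVanishes_singleFunctor :
    HomShiftVanishes (HomotopyCategory.singleFunctor 𝒜 0) := by
  intro M N k hk g
  have e := ((HomotopyCategory.singleFunctors 𝒜).shiftIso k (-k) 0 (by lia)).app N
  rw [← cancel_mono e.hom, zero_comp]
  exact hom_single_eq_zero (by lia) _

end Stalk

/-! ### The mapping cone triangle -/

section Cone

variable {A : Type u} [Ring A] {E₀ E₁ : FGModuleCat.{u} Aᵐᵒᵖ} (f : E₀ ⟶ E₁)

/-- The inclusion of the target of `f` into the mapping cone. -/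
def coneInr : stalk E₁ ⟶ coneComplex f :=
  (HomotopyCategory.quotient _ _).map (CochainComplex.mappingCone.inr _)

/-- The connecting morphism of the mapping cone. -/
def coneδ : coneComplex f ⟶ (stalk E₀)⟦(1 : ℤ)⟧ :=
  (CochainComplex.mappingCone.triangleh
    ((CochainComplex.singleFunctor (FGModuleCat.{u} Aᵐᵒᵖ) 0).map f)).mor₃

theorem isConeOf_coneComplex :
    IsConeOf (HomotopyCategory.singleFunctor (FGModuleCat.{u} Aᵐᵒᵖ) 0) f (coneInr f) (coneδ f) :=
  ⟨HomotopyCategory.mappingCone_triangleh_distinguished _⟩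

end Cone

/-! ### Bounded complexes are built from stalk complexes -/

section Brutal

variable {𝒜 : Type*} [Category* 𝒜] [Preadditive 𝒜] [HasZeroObject 𝒜]
  (Y : CochainComplex 𝒜 ℤ) (p : ℤ → Prop) [DecidablePred p]

open ZeroObject in
/-- The terms of the brutal truncation. -/
def brutalX (i : ℤ) : 𝒜 := if p i then Y.X i else 0

theorem brutalX_eq {i : ℤ} (h : p i) : brutalX Y p i = Y.X i := if_pos h

theorem isZero_brutalX {i : ℤ} (h : ¬ p i) : IsZero (brutalX Y p i) := by
  rw [brutalX, if_neg h]
  exact isZero_zero 𝒜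

/-- The inclusion of a term of the brutal truncation. -/
def brutalι (i : ℤ) : brutalX Y p i ⟶ Y.X i :=
  if h : p i then eqToHom (brutalX_eq Y p h) else 0

/-- The projection to a term of the brutal truncation. -/
def brutalπ (i : ℤ) : Y.X i ⟶ brutalX Y p i :=
  if h : p i then eqToHom (brutalX_eq Y p h).symm else 0

theorem brutalι_π (i : ℤ) : brutalι Y p i ≫ brutalπ Y p i = 𝟙 _ := by
  by_cases h : p i
  · simp [brutalι, brutalπ, h]
  · exact (isZero_brutalX Y p h).eq_of_src _ _

theorem brutalπ_ι {i : ℤ} (h : p i) : brutalπ Y p i ≫ brutalι Y p i = 𝟙 _ := by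
  simp [brutalι, brutalπ, h]

theorem brutalπ_eq_zero {i : ℤ} (h : ¬ p i) : brutalπ Y p i = 0 :=
  (isZero_brutalX Y p h).eq_of_tgt _ _

theorem brutalι_eq_zero {i : ℤ} (h : ¬ p i) : brutalι Y p i = 0 :=
  (isZero_brutalX Y p h).eq_of_src _ _

/-- The brutal truncation of a complex to the degrees that satisfy `p`. -/
def brutal : CochainComplex 𝒜 ℤ where
  X := brutalX Y p
  d i j := brutalι Y p i ≫ Y.d i j ≫ brutalπ Y p j
  shape i j h := by rw [Y.shape i j h, zero_comp, comp_zero]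
  d_comp_d' i j k _ _ := by
    by_cases h : p j
    · simp only [Category.assoc]
      rw [← Category.assoc (brutalπ Y p j), brutalπ_ι Y p h, Category.id_comp,
        ← Category.assoc (Y.d i j), Y.d_comp_d, zero_comp, comp_zero]
    · rw [brutalπ_eq_zero Y p h, comp_zero, comp_zero, zero_comp]

/-- The inclusion of a brutal truncation to an upward closed set of degrees. -/
def brutalInc (hp : ∀ i, p i → p (i + 1)) : brutal Y p ⟶ Y where
  f := brutalι Y p
  comm' i j hij := by
    obtain rfl : i + 1 = j := hij
    change brutalι Y p i ≫ Y.d i (i + 1) =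
      (brutalι Y p i ≫ Y.d i (i + 1) ≫ brutalπ Y p (i + 1)) ≫ brutalι Y p (i + 1)
    by_cases h : p i
    · rw [Category.assoc, Category.assoc, brutalπ_ι Y p (hp i h), Category.comp_id]
    · simp only [brutalι_eq_zero Y p h, zero_comp]

/-- The projection to a brutal truncation to a downward closed set of degrees. -/
def brutalProj (hp : ∀ i, p (i + 1) → p i) : Y ⟶ brutal Y p where
  f := brutalπ Y p
  comm' i j hij := by
    obtain rfl : i + 1 = j := hij
    change brutalπ Y p i ≫ brutalι Y p i ≫ Y.d i (i + 1) ≫ brutalπ Y p (i + 1) =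
      Y.d i (i + 1) ≫ brutalπ Y p (i + 1)
    by_cases h : p (i + 1)
    · rw [← Category.assoc, brutalπ_ι Y p (hp i h), Category.id_comp]
    · simp only [brutalπ_eq_zero Y p h, comp_zero]

/-- The brutal truncations form a short complex. -/
def brutalShortComplex (hp : ∀ i, p i → p (i + 1)) : ShortComplex (CochainComplex 𝒜 ℤ) :=
  ShortComplex.mk (brutalInc Y p hp)
    (brutalProj Y (fun i => ¬ p i) fun i h h' => h (hp i h')) (by
      ext i
      change brutalι Y p i ≫ brutalπ Y (fun i => ¬ p i) i = 0
      by_cases h : p i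
      · rw [brutalπ_eq_zero Y _ (not_not.mpr h), comp_zero]
      · rw [brutalι_eq_zero Y _ h, zero_comp])

/-- The short complex of brutal truncations is degreewise split. -/
def brutalSplitting (hp : ∀ i, p i → p (i + 1)) (n : ℤ) :
    ((brutalShortComplex Y p hp).map (HomologicalComplex.eval 𝒜 _ n)).Splitting where
  r := brutalπ Y p n
  s := brutalι Y (fun i => ¬ p i) n
  f_r := brutalι_π Y p n
  s_g := brutalι_π Y _ n
  id := by
    change brutalπ Y p n ≫ brutalι Y p n +
      brutalπ Y (fun i => ¬ p i) n ≫ brutalι Y (fun i => ¬ p i) n = 𝟙 _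
    by_cases h : p n
    · rw [brutalπ_ι Y p h, brutalπ_eq_zero Y _ (not_not.mpr h), zero_comp, add_zero]
    · rw [brutalπ_ι Y (fun i => ¬ p i) h, brutalπ_eq_zero Y p h, zero_comp, zero_add]

variable [HasBinaryBiproducts 𝒜]

theorem exists_brutal_triangle (hp : ∀ i, p i → p (i + 1)) :
    ∃ (f : (HomotopyCategory.quotient 𝒜 _).obj (brutal Y p) ⟶ (HomotopyCategory.quotient 𝒜 _).obj Y)
      (g : (HomotopyCategory.quotient 𝒜 _).obj Y ⟶
        (HomotopyCategory.quotient 𝒜 _).obj (brutal Y fun i => ¬ p i))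
      (h : _ ⟶ _), Triangle.mk f g h ∈ distTriang (HomotopyCategory 𝒜 (ComplexShape.up ℤ)) :=
  ⟨_, _, _, (HomotopyCategory.distinguished_iff_iso_trianglehOfDegreewiseSplit _).mpr
    ⟨brutalShortComplex Y p hp, brutalSplitting Y p hp, ⟨Iso.refl _⟩⟩⟩

variable {Y}

theorem mem_of_single (Q : ObjectProperty (HomotopyCategory 𝒜 (ComplexShape.up ℤ)))
    [Q.IsStableUnderShift ℤ] [Q.IsClosedUnderIsomorphisms] {a : ℤ}
    (hY : Q ((HomotopyCategory.singleFunctor 𝒜 0).obj (Y.X a)))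
    (h0 : ∀ i, i ≠ a → IsZero (Y.X i)) : Q ((HomotopyCategory.quotient _ _).obj Y) := by
  have h1 : Y.IsStrictlyGE a := (Y.isStrictlyGE_iff a).mpr fun i hi => h0 i (by lia)
  have h2 : Y.IsStrictlyLE a := (Y.isStrictlyLE_iff a).mpr fun i hi => h0 i (by lia)
  obtain ⟨M, ⟨e⟩⟩ := Y.exists_iso_single a
  have e1 : Y.X a ≅ M := (HomologicalComplex.eval _ _ a).mapIso e ≪≫
    HomologicalComplex.singleObjXSelf (ComplexShape.up ℤ) _ _
  have e2 : (HomotopyCategory.quotient _ _).obj Y ≅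
      (HomotopyCategory.singleFunctor 𝒜 a).obj M := (HomotopyCategory.quotient _ _).mapIso e
  have e3 := ((HomotopyCategory.singleFunctors 𝒜).shiftIso (-a) a 0 (by lia)).app M
  refine Q.prop_of_iso (e3 ≪≫ e2.symm) ?_
  exact Q.le_shift (-a) _ (Q.prop_of_iso ((HomotopyCategory.singleFunctor 𝒜 0).mapIso e1) hY)

/-- A triangulated subcategory that contains the stalk complexes of the terms of a bounded complex
contains the complex. -/
theorem mem_of_stalks (Q : ObjectProperty (HomotopyCategory 𝒜 (ComplexShape.up ℤ)))
    [Q.IsTriangulated] [Q.IsClosedUnderIsomorphisms] (n : ℕ) (a : ℤ) (Y : CochainComplex 𝒜 ℤ)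
    (hY : ∀ i, Q ((HomotopyCategory.singleFunctor 𝒜 0).obj (Y.X i)))
    (h0 : ∀ i, i < a ∨ a + n ≤ i → IsZero (Y.X i)) :
    Q ((HomotopyCategory.quotient _ _).obj Y) := by
  induction n generalizing a Y with
  | zero =>
    -- All terms vanish here; degree 0 is an arbitrary choice.
    refine mem_of_single Q (hY 0) fun i _ => h0 i ?_
    rw [Nat.cast_zero, add_zero]
    exact lt_or_ge i a
  | succ n ih =>
    -- Split off the lowest degree: the subcomplex in degrees above `a` is shorter, and the quotient
    -- is concentrated in degree `a`.
    let p : ℤ → Prop := fun i => a < i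
    obtain ⟨f, g, h, hT⟩ :=
      exists_brutal_triangle Y p fun i (hi : a < i) => by change a < i + 1; lia
    have hb (q : ℤ → Prop) [DecidablePred q] (i : ℤ) :
        Q ((HomotopyCategory.singleFunctor 𝒜 0).obj ((brutal Y q).X i)) := by
      by_cases hq : q i
      · change Q ((HomotopyCategory.singleFunctor 𝒜 0).obj (brutalX Y q i))
        rw [brutalX_eq Y q hq]
        exact hY i
      · exact Q.prop_of_isZero ((HomotopyCategory.singleFunctor 𝒜 0).map_isZero
          (isZero_brutalX Y q hq))
    have hz (q : ℤ → Prop) [DecidablePred q] (i : ℤ) (hi : ¬ q i ∨ IsZero (Y.X i)) :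
        IsZero ((brutal Y q).X i) := by
      by_cases hq : q i
      · change IsZero (brutalX Y q i)
        rw [brutalX_eq Y q hq]
        exact hi.resolve_left (not_not.mpr hq)
      · exact isZero_brutalX Y q hq
    refine Q.ext_of_isTriangulatedClosed₂ _ hT ?_ ?_
    · refine ih (a + 1) _ (hb p) fun i hi => hz p i ?_
      rcases hi with hi | hi
      · left; change ¬ a < i; lia
      · right; exact h0 i (.inr (by push_cast; lia))
    · refine mem_of_single Q (a := a) (hb _ a) fun i hi => hz _ i ?_
      by_cases h : a < i
      · exact .inl (not_not.mpr h)
      · exact .inr (h0 i (.inl (by lia)))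

end Brutal

/-! ### The bounded homotopy category of projectives is triangulated -/

section BoundedProjectives

variable {A : Type u} [Ring A]

/-- `X` is a retract of `M × N`. Zero maps are allowed when `𝟙 X = 0`, so zero objects are covered
as well. -/
theorem projective_of_split {R : Type u} [Ring R] {X M N : FGModuleCat.{u} R}
    (hM : Module.Projective R M) (hN : Module.Projective R N) {a : X ⟶ M} {b : M ⟶ X} {c : X ⟶ N}
    {d : N ⟶ X} (h : a ≫ b + c ≫ d = 𝟙 X) : Module.Projective R X := by
  refine Module.Projective.of_split (M := M × N) (a.hom.hom.prod c.hom.hom)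
    (b.hom.hom.coprod d.hom.hom) ?_
  ext x
  exact congrArg (fun k : X ⟶ X => k.hom.hom x) h

instance isClosedUnderIsomorphisms_boundedProjectives :
    (boundedProjectives A).IsClosedUnderIsomorphisms where
  of_iso := by
    rintro X X' e ⟨Y, h1, h2, ⟨e'⟩⟩
    exact ⟨Y, h1, h2, ⟨e.symm ≪≫ e'⟩⟩

theorem boundedProjectives_stalk (M : FGModuleCat.{u} Aᵐᵒᵖ) (hM : Module.Projective Aᵐᵒᵖ M) :
    boundedProjectives A (stalk M) := by
  refine ⟨(CochainComplex.singleFunctor _ 0).obj M, fun n => ?_, ⟨0, 0, fun n hn => ?_⟩,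
    ⟨Iso.refl _⟩⟩
  · by_cases hn : n = 0
    · subst hn
      have e : ((CochainComplex.singleFunctor (FGModuleCat.{u} Aᵐᵒᵖ) 0).obj M).X 0 ≅ M :=
        HomologicalComplex.singleObjXSelf _ _ _
      exact projective_of_split hM hM (a := e.hom) (b := e.inv) (c := 0) (d := 0) (by simp)
    · have h0 := HomologicalComplex.isZero_single_obj_X (ComplexShape.up ℤ) 0 M n hn
      exact projective_of_split hM hM (a := 0) (b := 0) (c := 0) (d := 0) (h0.eq_of_src _ _)
  · exact HomologicalComplex.isZero_single_obj_X (ComplexShape.up ℤ) 0 M n (by lia)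

instance containsZero_boundedProjectives : (boundedProjectives A).ContainsZero where
  exists_zero := by
    have h0 := isZero_zero (FGModuleCat.{u} Aᵐᵒᵖ)
    refine ⟨stalk _, Functor.map_isZero _ h0, boundedProjectives_stalk _ ?_⟩
    exact projective_of_split (M := FGModuleCat.of _ Aᵐᵒᵖ) (N := FGModuleCat.of _ Aᵐᵒᵖ)
      (Module.Projective.of_free) (Module.Projective.of_free)
      (a := 0) (b := 0) (c := 0) (d := 0) (h0.eq_of_src _ _)

instance isStableUnderShift_boundedProjectives :
    (boundedProjectives A).IsStableUnderShift ℤ where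
  isStableUnderShiftBy n :=
    { le_shift := by
        rintro X ⟨Y, h1, ⟨a, b, h2⟩, ⟨e⟩⟩
        refine ⟨Y⟦n⟧, fun i => h1 (i + n), ⟨a - n, b - n, fun i hi => h2 (i + n) (by lia)⟩,
          ⟨(shiftFunctor _ n).mapIso e ≪≫ eqToIso (HomotopyCategory.shift_quotient_obj Y n)⟩⟩ }

/-- The first map of the triangle is represented by a chain map between bounded complexes of
projectives, so the third vertex is its mapping cone. -/
instance isTriangulatedClosed₃_boundedProjectives :
    (boundedProjectives A).IsTriangulatedClosed₃ where
  ext₃' T hT := by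
    rintro ⟨Y₁, h1, ⟨a, b, h2⟩, ⟨e₁⟩⟩ ⟨Y₂, h1', ⟨a', b', h2'⟩, ⟨e₂⟩⟩
    obtain ⟨f, hf⟩ := (HomotopyCategory.quotient _ _).map_surjective (e₁.inv ≫ T.mor₁ ≫ e₂.hom)
    refine ⟨_, ?_, ⟨Triangle.π₃.mapIso (isoTriangleOfIso₁₂ T _ hT
      (HomotopyCategory.mappingCone_triangleh_distinguished f) e₁ e₂ ?_)⟩⟩
    -- In degree `n` the cone involves the source in degree `n + 1`, hence the lower bound `a - 1`.
    · refine ⟨CochainComplex.mappingCone f, fun n => ?_, ⟨min (a - 1) a', max b b', fun n hn => ?_⟩,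
        ⟨Iso.refl _⟩⟩
      · exact projective_of_split (h1 (n + 1)) (h1' n)
          (CochainComplex.mappingCone.id_X f n (n + 1) rfl)
      · rw [IsZero.iff_id_eq_zero, ← CochainComplex.mappingCone.id_X f n (n + 1) rfl,
          (h2 (n + 1) (by lia)).eq_of_tgt ((CochainComplex.mappingCone.fst f).1.v n (n + 1) rfl) 0,
          (h2' n (by lia)).eq_of_tgt ((CochainComplex.mappingCone.snd f).v n n (add_zero n)) 0,
          zero_comp, zero_comp, add_zero]
    · change T.mor₁ ≫ e₂.hom = e₁.hom ≫ (HomotopyCategory.quotient _ _).map f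
      rw [hf, e₁.hom_inv_id_assoc]

instance isTriangulated_boundedProjectives : (boundedProjectives A).IsTriangulated where
  toIsTriangulatedClosed₂ := .of_isTriangulatedClosed₃

theorem boundedProjectives_le (Q : ObjectProperty (KMod A)) [Q.IsTriangulated]
    [Q.IsClosedUnderIsomorphisms]
    (hQ : ∀ M : FGModuleCat.{u} Aᵐᵒᵖ, Module.Projective Aᵐᵒᵖ M → Q (stalk M)) :
    boundedProjectives A ≤ Q := by
  rintro X ⟨Y, h1, ⟨a, b, h2⟩, ⟨e⟩⟩
  refine Q.prop_of_iso e.symm (mem_of_stalks Q (b - a + 1).toNat a Y (fun i => hQ _ (h1 i))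
    fun i hi => h2 i (by lia))

theorem boundedProjectives_coneComplex {E₀ E₁ : FGModuleCat.{u} Aᵐᵒᵖ} (f : E₀ ⟶ E₁)
    (h₀ : Module.Projective Aᵐᵒᵖ E₀) (h₁ : Module.Projective Aᵐᵒᵖ E₁) :
    boundedProjectives A (coneComplex f) :=
  (boundedProjectives A).ext_of_isTriangulatedClosed₃ _ (isConeOf_coneComplex f).distinguished
    (boundedProjectives_stalk _ h₀) (boundedProjectives_stalk _ h₁)

end BoundedProjectives

/-! ### Finiteness of morphism modules -/

section FiniteHom

variable (K : Type v) [CommRing K] [IsNoetherianRing K]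

/-- Evaluation at generators of `M` embeds the morphisms into a finite power of `N`, which is a
noetherian `K`-module. -/
theorem finite_hom {R : Type u} [Ring R] [Algebra K R] [Module.Finite K R]
    (M N : FGModuleCat.{u} R) : Module.Finite K (M ⟶ N) := by
  let _ : Module K N := Module.restrictScalars K R N
  have : IsScalarTower K R N := IsScalarTower.restrictScalars K R N
  have hM : Module.Finite R M := M.2
  have hN : Module.Finite R N := N.2
  have hN' : Module.Finite K N := Module.Finite.trans R N
  obtain ⟨m, q, hq⟩ := Module.Finite.exists_fin' R M
  let φ : (M ⟶ N) →ₗ[K] (Fin m → N) :=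
    { toFun g i := g.hom.hom (q (Pi.single i 1))
      map_add' _ _ := rfl
      map_smul' _ _ := rfl }
  refine Module.Finite.of_injective φ fun g h hgh => ?_
  apply FGModuleCat.hom_ext
  rw [← LinearMap.cancel_right hq]
  refine LinearMap.pi_ext' fun i => LinearMap.ext_ring ?_
  exact congrFun hgh i

variable {𝒜 : Type*} [Category* 𝒜] [Preadditive 𝒜] [Linear K 𝒜]

theorem finite_quotient_hom (h : ∀ M N : 𝒜, Module.Finite K (M ⟶ N)) (X Y : CochainComplex 𝒜 ℤ)
    {a b : ℤ} (hX : ∀ n, n < a ∨ b < n → IsZero (X.X n)) :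
    Module.Finite K ((HomotopyCategory.quotient 𝒜 _).obj X ⟶
      (HomotopyCategory.quotient 𝒜 _).obj Y) := by
  let φ : (X ⟶ Y) →ₗ[K] (∀ i : Finset.Icc a b, (X.X i ⟶ Y.X i)) :=
    { toFun g i := g.f i
      map_add' _ _ := rfl
      map_smul' _ _ := rfl }
  have : Module.Finite K (X ⟶ Y) := by
    refine Module.Finite.of_injective φ fun g h hgh => ?_
    ext i
    by_cases hi : i ∈ Finset.Icc a b
    · exact congrFun hgh ⟨i, hi⟩
    · refine (hX i ?_).eq_of_src _ _
      rw [Finset.mem_Icc] at hi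
      lia
  exact Module.Finite.of_surjective
    ((HomotopyCategory.quotient 𝒜 (ComplexShape.up ℤ)).mapLinearMap K (X := X) (Y := Y))
    (HomotopyCategory.quotient 𝒜 (ComplexShape.up ℤ)).map_surjective

theorem finite_end_of_boundedProjectives {A : Type u} [Ring A] [Algebra K A] [Module.Finite K A]
    {X : KMod A} (hX : boundedProjectives A X) : Module.Finite K (End X) := by
  obtain ⟨Y, -, ⟨a, b, h⟩, ⟨e⟩⟩ := hX
  have := finite_quotient_hom K (fun M N => finite_hom K M N) Y Y h
  exact Module.Finite.equiv (Linear.homCongr K e.symm e.symm)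

end FiniteHom

section ArtinianEnd

variable (K : Type v) [CommRing K] [IsArtinianRing K]

theorem isArtinianRing_of_finite (B : Type*) [Ring B] [Algebra K B] [Module.Finite K B] :
    IsArtinianRing B :=
  isArtinian_of_tower K inferInstance

end ArtinianEnd

/-! ### Objects in `add X` are direct sums of indecomposable summands of `X` -/

section AddClosure

variable {C : Type*} [Category.{u} C] [HasZeroObject C] [HasShift C ℤ] [Preadditive C]
  [∀ n : ℤ, (shiftFunctor C n).Additive] [Pretriangulated C] [HasFiniteBiproducts C]

theorem inAdd_of_addClosure {X Z : C} (h : addClosure X Z) : InAdd X Z := by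
  obtain ⟨m, Y, ⟨e⟩⟩ := h
  refine ⟨m, fun k => biprod.inl ≫ e.hom ≫ biproduct.π _ k,
    fun k => biproduct.ι (fun _ : Fin m => X) k ≫ e.inv ≫ biprod.fst, ?_⟩
  have h1 := biproduct.total (f := fun _ : Fin m => X)
  calc ∑ k, (biprod.inl ≫ e.hom ≫ biproduct.π _ k) ≫ biproduct.ι (fun _ : Fin m => X) k ≫
        e.inv ≫ biprod.fst
      = biprod.inl ≫ e.hom ≫ (∑ k, biproduct.π (fun _ : Fin m => X) k ≫
        biproduct.ι (fun _ : Fin m => X) k) ≫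
        e.inv ≫ biprod.fst := by
        simp only [Preadditive.sum_comp, Preadditive.comp_sum, Category.assoc]
    _ = 𝟙 Z := by rw [h1]; simp

/-- The cone of a split monomorphism is a complement, because a triangle whose first map is a
monomorphism splits. -/
theorem addClosure_of_retract {X Z : C} (i : Z ⟶ X) (r : X ⟶ Z) (h : i ≫ r = 𝟙 Z) :
    addClosure X Z := by
  obtain ⟨Y, g, k, hT⟩ := distinguished_cocone_triangle i
  have hi : Mono i := mono_of_mono_fac h
  obtain ⟨e, -, -⟩ := exists_iso_binaryBiproduct_of_distTriang _ hT
    ((Triangle.mor₃_eq_zero_iff_mono₁ _ hT).mpr hi)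
  exact ⟨1, Y, ⟨e.symm ≪≫ (biproductUniqueIso fun _ : Fin 1 => X).symm⟩⟩

theorem prop_biprod (Q : ObjectProperty C) [Q.IsTriangulated] [Q.IsClosedUnderIsomorphisms]
    {X Y : C} (hX : Q X) (hY : Q Y) : Q (X ⊞ Y) :=
  Q.ext_of_isTriangulatedClosed₂ _ (binaryBiproductTriangle_distinguished X Y) hX hY

theorem InAdd.biprod {X Y Z : C} (hY : InAdd X Y) (hZ : InAdd X Z) : InAdd X (Y ⊞ Z) := by
  obtain ⟨m, s, r, h⟩ := hY
  obtain ⟨m', s', r', h'⟩ := hZ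
  refine ⟨m + m', Fin.append (fun k => biprod.fst ≫ s k) (fun k => biprod.snd ≫ s' k),
    Fin.append (fun k => r k ≫ biprod.inl) (fun k => r' k ≫ biprod.inr), ?_⟩
  rw [Fin.sum_univ_add, ← biprod.total]
  congr 1
  · have : biprod.fst ≫ (∑ k, s k ≫ r k) ≫ biprod.inl =
        (biprod.fst ≫ biprod.inl : Y ⊞ Z ⟶ Y ⊞ Z) := by
      rw [h, Category.id_comp]
    rw [← this]
    simp [Preadditive.sum_comp, Preadditive.comp_sum]
  · have : biprod.snd ≫ (∑ k, s' k ≫ r' k) ≫ biprod.inr =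
        (biprod.snd ≫ biprod.inr : Y ⊞ Z ⟶ Y ⊞ Z) := by
      rw [h', Category.id_comp]
    rw [← this]
    simp [Preadditive.sum_comp, Preadditive.comp_sum]

/-- The functor `Hom(X, -)` preserves binary direct sums. -/
def homBiprodEquiv (X Y Z : C) : (X ⟶ Y ⊞ Z) ≃ₗ[(End X)ᵐᵒᵖ] (X ⟶ Y) × (X ⟶ Z) where
  toFun g := (g ≫ biprod.fst, g ≫ biprod.snd)
  map_add' g h := by simp
  map_smul' a g := Prod.ext (Category.assoc _ _ _) (Category.assoc _ _ _)
  invFun g := biprod.lift g.1 g.2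
  left_inv g := by ext <;> simp
  right_inv g := by simp

variable {ι : Type} [Fintype ι] {X : C} {T : ι → C} {σ : Equiv.Perm ι}

/-- `Q` is not assumed closed under summands, so objects of `add X` must be decomposed into the `T
i`. This is done for their images under `Hom(X, -)`, which are finitely generated projective
modules, and carried back by full faithfulness on `add X`. -/
theorem IsNakayamaFamily.addClosure_le (hT : IsNakayamaFamily T σ) (D : Decomposition X T)
    [IsArtinianRing (End X)ᵐᵒᵖ] (Q : ObjectProperty C) [Q.IsTriangulated]
    [Q.IsClosedUnderIsomorphisms] (hQ : ∀ i, Q (T i)) : addClosure X ≤ Q := by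
  intro Z hZ
  replace hZ := inAdd_of_addClosure hZ
  have h1 (i : ι) : Module.Projective (End X)ᵐᵒᵖ ((preadditiveCoyonedaObj X).obj (T i)) :=
    (D.inAdd i).finite_and_projective.2
  have h2 := hT.isLocalRing_end_hom D
  have h3 : Module.Finite (End X)ᵐᵒᵖ ((preadditiveCoyonedaObj X).obj Z) :=
    hZ.finite_and_projective.1
  have h4 : Module.Projective (End X)ᵐᵒᵖ ((preadditiveCoyonedaObj X).obj Z) :=
    hZ.finite_and_projective.2
  have key := projective_induction (fun i => (preadditiveCoyonedaObj X).obj (T i))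
    (fun M => ∃ Z' : C, Q Z' ∧ InAdd X Z' ∧ Nonempty (M ≃ₗ[(End X)ᵐᵒᵖ] (X ⟶ Z'))) ?_ ?_
    ((preadditiveCoyonedaObj X).obj Z) ?_
  · obtain ⟨Z', h5, h6, ⟨e⟩⟩ := key
    obtain ⟨e'⟩ := hZ.nonempty_iso h6 e
    exact Q.prop_of_iso e'.symm h5
  · intro M hM
    obtain ⟨Z', h0, h0'⟩ := Q.exists_prop_of_containsZero
    have : Subsingleton (X ⟶ Z') := ⟨fun g h => h0.eq_of_tgt g h⟩
    exact ⟨Z', h0', ⟨0, 0, 0, h0.eq_of_src _ _⟩, ⟨LinearEquiv.ofSubsingleton M (X ⟶ Z')⟩⟩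
  · rintro i M N - - ⟨Z', h5, h6, ⟨e⟩⟩ e'
    refine ⟨T i ⊞ Z', prop_biprod Q (hQ i) h5, (D.inAdd i).biprod h6, ⟨?_⟩⟩
    exact e'.trans ((LinearEquiv.prodCongr (LinearEquiv.refl _ _) e).trans
      (homBiprodEquiv X (T i) Z').symm)
  · intro V _ _ _ q hq
    exact D.exists_hom_simple_ne_zero V

/-- Morphisms from a direct sum to a shift of it vanish if their components do. -/
theorem biprod_hom_shift_eq_zero {X Y : C} {k : ℤ} (h₁ : ∀ g : X ⟶ X⟦k⟧, g = 0)
    (h₂ : ∀ g : X ⟶ Y⟦k⟧, g = 0) (h₃ : ∀ g : Y ⟶ X⟦k⟧, g = 0) (h₄ : ∀ g : Y ⟶ Y⟦k⟧, g = 0)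
    (g : X ⊞ Y ⟶ (X ⊞ Y)⟦k⟧) : g = 0 := by
  have h (Z : C) (hX : ∀ g : Z ⟶ X⟦k⟧, g = 0) (hY : ∀ g : Z ⟶ Y⟦k⟧, g = 0)
      (g : Z ⟶ (X ⊞ Y)⟦k⟧) : g = 0 := by
    rw [← Category.comp_id g, ← CategoryTheory.Functor.map_id, ← biprod.total, Functor.map_add,
      Functor.map_comp, Functor.map_comp, Preadditive.comp_add, ← Category.assoc,
      ← Category.assoc, hX (g ≫ _), hY (g ≫ _), zero_comp, zero_comp, add_zero]
  ext
  · rw [comp_zero]; exact h X h₁ h₂ _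
  · rw [comp_zero]; exact h Y h₃ h₄ _

end AddClosure

/-! ### The tilting complex -/

section ReflectionComplex

variable {A : Type u} [Ring A] {n : ℕ} {P : Fin n → FGModuleCat.{u} Aᵐᵒᵖ} {t : Fin n}
  {σ : Equiv.Perm (Fin n)} {ζ : ∀ i, P (σ i) →ₗ[Aᵐᵒᵖ] P i} {S : Type u} [AddCommGroup S]
  [Module Aᵐᵒᵖ S] {E₀ E₁ : FGModuleCat.{u} Aᵐᵒᵖ} {s : S →ₗ[Aᵐᵒᵖ] E₀} {f : E₀ ⟶ E₁}
  {p : E₀ →ₗ[Aᵐᵒᵖ] S}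

theorem reflectionSummand_self : reflectionSummand P t f t = coneComplex f := if_pos rfl

theorem reflectionSummand_of_ne {i : Fin n} (hi : i ≠ t) :
    reflectionSummand P t f i = stalk (P i) := if_neg hi

/-- The members of `T` are known only up to equality of objects; with arbitrary `E` and `M` these
equalities can be substituted. -/
theorem nonempty_decomposition {C : Type*} [Category* C] [Preadditive C] {ι : Type} [Fintype ι]
    [DecidableEq ι] (T : ι → C) (t : ι) {X E : C} (M : {i : ι // i ≠ t} → C) (ht : T t = E)
    (hM : ∀ i : {i : ι // i ≠ t}, T i = M i) {a : E ⟶ X} {b : X ⟶ E} {c : ∀ i, M i ⟶ X}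
    {d : ∀ i, X ⟶ M i} (hab : a ≫ b = 𝟙 E) (hcd : ∀ i, c i ≫ d i = 𝟙 (M i))
    (h : b ≫ a + ∑ i, d i ≫ c i = 𝟙 X) : Nonempty (Decomposition X T) := by
  subst ht
  obtain rfl : M = fun i => T i.1 := (funext hM).symm
  refine ⟨⟨fun i => if h : i = t then eqToHom (by rw [h]) ≫ a else c ⟨i, h⟩,
    fun i => if h : i = t then b ≫ eqToHom (by rw [h]) else d ⟨i, h⟩, fun i => ?_, ?_⟩⟩
  · by_cases h : i = t
    · subst h; simpa using hab
    · simpa [h] using hcd ⟨i, h⟩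
  · rw [Fintype.sum_eq_add_sum_subtype_ne _ t, ← h]
    congr 1
    · simp
    · refine Finset.sum_congr rfl fun i _ => ?_
      rw [dif_neg i.2, dif_neg i.2]

variable (P t f) in
/-- The complex `T` is the direct sum of its indecomposable summands. -/
theorem nonempty_reflectionDecomposition :
    Nonempty (Decomposition (reflectionComplex P t f) (reflectionSummand P t f)) := by
  let F := HomotopyCategory.singleFunctor (FGModuleCat.{u} Aᵐᵒᵖ) 0
  let M : {i : Fin n // i ≠ t} → FGModuleCat.{u} Aᵐᵒᵖ := fun i => P i
  refine nonempty_decomposition (X := F.obj (⨁ M) ⊞ coneComplex f) (E := coneComplex f)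
    (reflectionSummand P t f) t (fun i => F.obj (M i)) reflectionSummand_self
    (fun i => reflectionSummand_of_ne i.2) (a := biprod.inr) (b := biprod.snd)
    (c := fun i => F.map (biproduct.ι M i) ≫ biprod.inl)
    (d := fun i => biprod.fst ≫ F.map (biproduct.π M i)) biprod.inr_snd (fun i => ?_) ?_
  · rw [Category.assoc, ← Category.assoc biprod.inl, biprod.inl_fst, Category.id_comp,
      ← Functor.map_comp, biproduct.ι_π_self, CategoryTheory.Functor.map_id]
  · have h2 : ∑ i, F.map (biproduct.π M i) ≫ F.map (biproduct.ι M i) = 𝟙 _ := by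
      simp only [← Functor.map_comp, ← Functor.map_sum]
      rw [biproduct.total, CategoryTheory.Functor.map_id]
    rw [← biprod.total, add_comm]
    congr 1
    have h3 := congrArg (fun k => (biprod.fst : F.obj (⨁ M) ⊞ coneComplex f ⟶ _) ≫ k ≫
      (biprod.inl : _ ⟶ F.obj (⨁ M) ⊞ coneComplex f)) h2
    simpa only [Preadditive.sum_comp, Preadditive.comp_sum, Category.assoc, Category.id_comp]
      using h3

/-- An object with a direct sum decomposition is isomorphic to the biproduct. -/
def isoBiprod {C : Type*} [Category* C] [Preadditive C] [HasBinaryBiproducts C] {X Y Z : C}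
    (a : X ⟶ Y) (b : X ⟶ Z) (c : Y ⟶ X) (d : Z ⟶ X) (hca : c ≫ a = 𝟙 Y) (hcb : c ≫ b = 0)
    (hda : d ≫ a = 0) (hdb : d ≫ b = 𝟙 Z) (h : a ≫ c + b ≫ d = 𝟙 X) : X ≅ Y ⊞ Z where
  hom := biprod.lift a b
  inv := biprod.desc c d
  hom_inv_id := by rw [biprod.lift_desc, h]
  inv_hom_id := by
    apply biprod.hom_ext' <;> apply biprod.hom_ext <;> simp [hca, hcb, hda, hdb]

theorem projective_biproduct {R : Type u} [Ring R] {J : Type} [Fintype J]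
    (M : J → FGModuleCat.{u} R) (hM : ∀ j, Module.Projective R (M j)) :
    Module.Projective R (⨁ M : FGModuleCat.{u} R) := by
  classical
  let a : (⨁ M : FGModuleCat.{u} R) →ₗ[R] ∀ j, M j :=
    LinearMap.pi fun j => (biproduct.π M j).hom.hom
  let b : (∀ j, M j) →ₗ[R] (⨁ M : FGModuleCat.{u} R) :=
    ∑ j, (biproduct.ι M j).hom.hom ∘ₗ LinearMap.proj j
  have : Module.Projective R (∀ j, M j) :=
    Module.Projective.of_equiv (DirectSum.linearEquivFunOnFintype R J fun j => M j)
  refine Module.Projective.of_split a b ?_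
  ext x
  let φ : ((⨁ M : FGModuleCat.{u} R) ⟶ ⨁ M) →+ (⨁ M : FGModuleCat.{u} R) :=
    { toFun g := g.hom.hom x
      map_zero' := rfl
      map_add' _ _ := rfl }
  have h := congrArg φ (biproduct.total (f := M))
  rw [map_sum] at h
  refine Eq.trans ?_ h
  rw [LinearMap.comp_apply, LinearMap.sum_apply]
  rfl

/-- A triangulated subcategory that contains the stalk complexes of projective modules `P i`
contains those of all projective modules that are direct sums of copies of them. -/
theorem stalk_mem [IsArtinianRing Aᵐᵒᵖ] {ι : Type} (P : ι → FGModuleCat.{u} Aᵐᵒᵖ)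
    (h_proj : ∀ i, Module.Projective Aᵐᵒᵖ (P i))
    (h_local : ∀ i, IsLocalRing (Module.End Aᵐᵒᵖ (P i)))
    (Q : ObjectProperty (KMod A)) [Q.IsTriangulated] [Q.IsClosedUnderIsomorphisms]
    (hQ : ∀ i, Q (stalk (P i))) (M : FGModuleCat.{u} Aᵐᵒᵖ) (hM : Module.Projective Aᵐᵒᵖ M)
    (h : ∀ (V : Type u) [AddCommGroup V] [Module Aᵐᵒᵖ V] [IsSimpleModule Aᵐᵒᵖ V]
      (q : M →ₗ[Aᵐᵒᵖ] V), q ≠ 0 → ∃ (i : ι) (p : P i →ₗ[Aᵐᵒᵖ] V), p ≠ 0) : Q (stalk M) := by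
  have : Module.Finite Aᵐᵒᵖ M := M.2
  refine projective_induction (fun i => (P i).obj)
    -- The induction runs over all modules, while stalks exist for finitely generated ones; hence
    -- the quantification over isomorphic copies `N`.
    (fun M => ∀ N : FGModuleCat.{u} Aᵐᵒᵖ, (N ≃ₗ[Aᵐᵒᵖ] M) → Q (stalk N)) ?_ ?_ M.obj h M
    (LinearEquiv.refl _ _)
  · intro M hM N e
    have h0 : IsZero N := by
      rw [IsZero.iff_id_eq_zero]
      apply FGModuleCat.hom_ext
      ext x
      exact e.injective (Subsingleton.elim _ _)
    exact Q.prop_of_isZero (Functor.map_isZero _ h0)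
  · intro i M N _ _ hN e X e'
    let N' : FGModuleCat.{u} Aᵐᵒᵖ := FGModuleCat.of Aᵐᵒᵖ N
    let e₁ : X ≃ₗ[Aᵐᵒᵖ] P i × N := e'.trans e
    let F := HomotopyCategory.singleFunctor (FGModuleCat.{u} Aᵐᵒᵖ) 0
    let a : X ⟶ P i := toHom (LinearMap.fst _ _ _ ∘ₗ e₁.toLinearMap)
    let b : X ⟶ N' := toHom (N := N') (LinearMap.snd _ _ _ ∘ₗ e₁.toLinearMap)
    let c : P i ⟶ X := toHom (e₁.symm.toLinearMap ∘ₗ LinearMap.inl _ _ _)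
    let d : N' ⟶ X := toHom (M := N') (e₁.symm.toLinearMap ∘ₗ LinearMap.inr _ _ _)
    have hca : c ≫ a = 𝟙 _ := FGModuleCat.hom_ext (LinearMap.ext fun x =>
      congrArg Prod.fst (e₁.apply_symm_apply (x, 0)))
    have hcb : c ≫ b = 0 := FGModuleCat.hom_ext (LinearMap.ext fun x =>
      congrArg Prod.snd (e₁.apply_symm_apply (x, 0)))
    have hda : d ≫ a = 0 := FGModuleCat.hom_ext (LinearMap.ext fun x =>
      congrArg Prod.fst (e₁.apply_symm_apply (0, x)))
    have hdb : d ≫ b = 𝟙 _ := FGModuleCat.hom_ext (LinearMap.ext fun x =>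
      congrArg Prod.snd (e₁.apply_symm_apply (0, x)))
    have hX : a ≫ c + b ≫ d = 𝟙 _ := FGModuleCat.hom_ext (LinearMap.ext fun x => by
      apply e₁.injective
      change e₁ (e₁.symm ((e₁ x).1, 0) + e₁.symm (0, (e₁ x).2)) = e₁ x
      simp)
    have e₂ : F.obj X ≅ F.obj (P i) ⊞ F.obj N' :=
      isoBiprod (F.map a) (F.map b) (F.map c) (F.map d)
        (by rw [← F.map_comp, hca, F.map_id]) (by rw [← F.map_comp, hcb, F.map_zero])
        (by rw [← F.map_comp, hda, F.map_zero]) (by rw [← F.map_comp, hdb, F.map_id])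
        (by rw [← F.map_comp, ← F.map_comp, ← F.map_add, hX, F.map_id])
    exact Q.prop_of_iso e₂.symm (prop_biprod Q (hQ i) (hN N' (LinearEquiv.refl _ _)))

variable (H : IsReflectionFamily P t σ ζ s f p)

namespace IsReflectionFamily

include H

theorem isNakayamaFamily_reflectionSummand [IsArtinianRing Aᵐᵒᵖ] [Module.Injective Aᵐᵒᵖ Aᵐᵒᵖ] :
    IsNakayamaFamily (reflectionSummand P t f) σ :=
  H.isNakayamaFamily homShiftVanishes_singleFunctor (isConeOf_coneComplex f) _
    reflectionSummand_self fun _ hi => reflectionSummand_of_ne hi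

theorem boundedProjectives_reflectionSummand (i : Fin n) :
    boundedProjectives A (reflectionSummand P t f i) := by
  by_cases hi : i = t
  · rw [hi, reflectionSummand_self]
    exact boundedProjectives_coneComplex f H.presentation.projective₀ H.presentation.projective₁
  · rw [reflectionSummand_of_ne hi]
    exact boundedProjectives_stalk _ (H.projective i)

theorem boundedProjectives_reflectionComplex :
    boundedProjectives A (reflectionComplex P t f) :=
  prop_biprod _ (boundedProjectives_stalk _ (projective_biproduct _ fun i => H.projective i))
    (boundedProjectives_coneComplex f H.presentation.projective₀ H.presentation.projective₁)

/-- An injective map from the injective module `E₀` splits, and its retraction followed by `p` would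
be a nonzero map to `S`. -/
theorem not_injective_of_hom_eq_zero {M : Type u} [AddCommGroup M] [Module Aᵐᵒᵖ M]
    (hM : ∀ g : M →ₗ[Aᵐᵒᵖ] S, g = 0) (a : E₀ →ₗ[Aᵐᵒᵖ] M) : ¬ Function.Injective a := by
  intro ha
  have := H.presentation.injective₀
  obtain ⟨r, hr⟩ := Module.Injective.out _ ha LinearMap.id
  apply H.presentation.ne_zero
  ext x
  have h0 := DFunLike.congr_fun (hM (p ∘ₗ r)) (a x)
  rw [LinearMap.comp_apply, hr] at h0
  exact h0

/-- The four blocks rest on different facts: stalks have no shifted maps; the `P i` with `i ≠ t`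
have no quotient `S`; maps from `E₀` to these `P i` are not injective; and `S` is not a quotient of
`E₁`. -/
theorem hom_shift_eq_zero {k : ℤ} (hk : k ≠ 0)
    (g : reflectionComplex P t f ⟶ (reflectionComplex P t f)⟦k⟧) : g = 0 := by
  have hF := homShiftVanishes_singleFunctor (𝒜 := FGModuleCat.{u} Aᵐᵒᵖ)
  have hE := isConeOf_coneComplex f
  refine biprod_hom_shift_eq_zero (hF _ _ k hk) (hE.hom_stalk_shift_eq_zero hF hk fun _ a ha => ?_)
    (hE.hom_shift_stalk_eq_zero hF hk fun _ a => ?_)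
    (hE.hom_shift_eq_zero hF hk H.comp_f_eq_zero fun a => ?_) g
  · refine biproduct.hom_ext' _ _ fun i => ?_
    rw [comp_zero, eq_zero_iff]
    refine H.presentation.eq_zero_of_comp_eq_zero (H.hom_eq_zero i i.2) _ ?_
    rw [← comp_eq_zero_iff', Category.assoc, ha, comp_zero]
  · have h (i : {i : Fin n // i ≠ t}) : ∃ b : E₁ ⟶ P i, f ≫ b = a ≫ biproduct.π _ i :=
      H.exists_extension (H.injective i) _ (H.not_injective i i.2 _)
    choose b hb using h
    refine ⟨biproduct.lift b, ?_⟩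
    refine biproduct.hom_ext _ _ fun i => ?_
    rw [Category.assoc, biproduct.lift_π, hb]
  · exact H.exists_extension H.presentation.injective₁ _
      (H.not_injective_of_hom_eq_zero H.presentation.hom_eq_zero _)

theorem generates [IsArtinianRing Aᵐᵒᵖ] [Module.Injective Aᵐᵒᵖ Aᵐᵒᵖ]
    [IsArtinianRing (End (reflectionComplex P t f))ᵐᵒᵖ]
    (hP : IsCompleteSetOfIndecProj fun i => (P i).obj) (e : E₀ ≅ P t) :
    triangulatedHull (addClosure (reflectionComplex P t f)) = boundedProjectives A := by
  obtain ⟨D⟩ := nonempty_reflectionDecomposition P t f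
  apply le_antisymm
  · intro X hX
    exact hX _ inferInstance inferInstance (H.isNakayamaFamily_reflectionSummand.addClosure_le D _
      H.boundedProjectives_reflectionSummand)
  · intro X hX Q _ _ hQ
    have hT (i : Fin n) : Q (reflectionSummand P t f i) :=
      hQ _ (addClosure_of_retract (D.inj i) (D.proj i) (D.inj_proj i))
    have hE : Q (coneComplex f) := by rw [← reflectionSummand_self (P := P) (t := t)]; exact hT t
    have hPi (i : Fin n) (hi : i ≠ t) : Q (stalk (P i)) := by
      rw [← reflectionSummand_of_ne (f := f) hi]; exact hT i
    -- Since `S` is not in its top, `E₁` is built from the `P i` with `i ≠ t`. The triangle of the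
    -- cone then returns `E₀`, which is the missing `P t`.
    have hE₁ : Q (stalk E₁) := by
      refine stalk_mem (fun i : {i : Fin n // i ≠ t} => P i) (fun i => H.projective i)
        (fun i => H.local_end i) Q (fun i => hPi i i.2) E₁ H.presentation.projective₁ ?_
      intro V _ _ _ q hq
      obtain ⟨i, hi, h, hh⟩ :=
        H.exists_hom (LinearMap.ker q) fun h => hq (LinearMap.ker_eq_top.mp h)
      exact ⟨⟨i, hi⟩, q ∘ₗ h, fun h0 => hh (LinearMap.range_le_ker_iff.mpr h0)⟩
    have hE₀ : Q (stalk E₀) :=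
      Q.ext_of_isTriangulatedClosed₁ _ (isConeOf_coneComplex f).distinguished hE₁ hE
    refine boundedProjectives_le Q (fun M hM => ?_) X hX
    refine stalk_mem P H.projective H.local_end Q (fun i => ?_) M hM ?_
    · by_cases hi : i = t
      · rw [hi]
        exact Q.prop_of_iso ((HomotopyCategory.singleFunctor _ 0).mapIso e) hE₀
      · exact hPi i hi
    · intro V _ _ _ q hq
      exact hP.exists_hom_ne_zero V

theorem isTiltingComplex [IsArtinianRing Aᵐᵒᵖ] [Module.Injective Aᵐᵒᵖ Aᵐᵒᵖ]
    [IsArtinianRing (End (reflectionComplex P t f))ᵐᵒᵖ]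
    (hP : IsCompleteSetOfIndecProj fun i => (P i).obj) (e : E₀ ≅ P t) :
    IsTiltingComplex (reflectionComplex P t f) where
  mem := H.boundedProjectives_reflectionComplex
  hom_shift_eq_zero _ hj := H.hom_shift_eq_zero hj
  generates := H.generates hP e

end IsReflectionFamily

end ReflectionComplex

/-! ### A projective and injective simple module gives a ring factor -/

section CentralIdempotent

variable {R : Type u} [Ring R] (S : Type u) [AddCommGroup S] [Module R S]

variable (R) in
/-- The sum of the images of all homomorphisms `S → R`. -/
def traceIdeal : Submodule R R := ⨆ g : S →ₗ[R] R, LinearMap.range g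

variable {S}

theorem apply_mem_traceIdeal (g : S →ₗ[R] R) (x : S) : g x ∈ traceIdeal R S :=
  le_iSup (fun g : S →ₗ[R] R => LinearMap.range g) g ⟨x, rfl⟩

theorem traceIdeal_induction {q : R → Prop} (h : ∀ (g : S →ₗ[R] R) (x : S), q (g x)) (h0 : q 0)
    (hadd : ∀ a b, q a → q b → q (a + b)) {a : R} (ha : a ∈ traceIdeal R S) : q a := by
  refine Submodule.iSup_induction _ (motive := q) ha ?_ h0 hadd
  rintro g _ ⟨x, rfl⟩
  exact h g x

theorem mul_eq_zero_of_mem_traceIdeal {a b : R} (ha : ∀ x : S, a • x = 0)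
    (hb : b ∈ traceIdeal R S) : a * b = 0 := by
  refine traceIdeal_induction (q := fun b => a * b = 0) (fun g x => ?_) (mul_zero a)
    (fun b c hb hc => by rw [mul_add, hb, hc, add_zero]) hb
  rw [← smul_eq_mul, ← map_smul, ha, map_zero]

/-- For `g : S → R`, the map `x ↦ g x * b` is injective or zero. If injective, it has a retraction
to `S` as `S` is an injective module; but the retraction sends `g x * b` to a multiple of an element
`b • y` with `y` in `S`, which is zero. -/
theorem traceIdeal_mul_eq_zero [IsSimpleModule R S] [Module.Injective R S] {a b : R}
    (ha : a ∈ traceIdeal R S) (hb : ∀ x : S, b • x = 0) : a * b = 0 := by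
  refine traceIdeal_induction (q := fun a => a * b = 0) (fun g x => ?_) (zero_mul b)
    (fun c d hc hd => by rw [add_mul, hc, hd, add_zero]) ha
  let h : S →ₗ[R] R := LinearMap.toSpanSingleton R R b ∘ₗ g
  have hh (x : S) : h x = g x * b := rfl
  rcases LinearMap.injective_or_eq_zero h with hi | h0
  · obtain ⟨r, hr⟩ := Module.Injective.out h hi LinearMap.id
    have h1 : r (h x) = 0 := by
      rw [hh, ← smul_eq_mul, map_smul, ← mul_one b, ← smul_eq_mul b, map_smul, hb, smul_zero]
    rw [hr] at h1
    rw [show x = 0 from h1, map_zero, zero_mul]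
  · exact DFunLike.congr_fun h0 x

/-- A minimal left ideal `L` among those that span the ring together with the trace must annihilate
`S`: a nonzero map `L → S` would split by projectivity, its section would map into the trace, and
its kernel would be a smaller choice. -/
theorem exists_le_annihilator [IsArtinianRing R] [IsSimpleModule R S] [Module.Projective R S] :
    ∃ e ∈ traceIdeal R S, ∃ e' : R, (∀ x : S, e' • x = 0) ∧ e + e' = 1 := by
  let 𝒮 : Set (Submodule R R) := {L | traceIdeal R S ⊔ L = ⊤}
  obtain ⟨L, hL, hmin⟩ := wellFounded_lt.has_min 𝒮 ⟨⊤, sup_top_eq _⟩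
  have hLx (x : S) (l : R) (hl : l ∈ L) : l • x = 0 := by
    by_contra hne
    let φ : L →ₗ[R] S := LinearMap.toSpanSingleton R S x ∘ₗ L.subtype
    have hφ : φ ≠ 0 := fun h0 => hne (DFunLike.congr_fun h0 ⟨l, hl⟩)
    obtain ⟨r, hr⟩ := Module.projective_lifting_property φ LinearMap.id
      (LinearMap.surjective_of_ne_zero hφ)
    have hr' (y : S) : φ (r y) = y := DFunLike.congr_fun hr y
    let L' := (LinearMap.ker φ).map L.subtype
    have hlt : L' < L := by
      refine lt_of_le_of_ne (Submodule.map_subtype_le _ _) fun heq => ?_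
      rw [← heq] at hl
      obtain ⟨z, hz, hzl⟩ := hl
      apply hne
      rw [← hzl]
      exact hz
    refine hmin L' ?_ hlt
    refine top_le_iff.mp (hL.symm.le.trans (sup_le le_sup_left fun z hz => ?_))
    refine Submodule.mem_sup.mpr ⟨(r (φ ⟨z, hz⟩) : L), ?_, z - r (φ ⟨z, hz⟩), ?_,
      add_sub_cancel _ _⟩
    · exact apply_mem_traceIdeal (L.subtype ∘ₗ r) _
    · refine ⟨⟨z, hz⟩ - r (φ ⟨z, hz⟩), ?_, rfl⟩
      change φ (⟨z, hz⟩ - r (φ ⟨z, hz⟩)) = 0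
      rw [map_sub, hr', sub_self]
  obtain ⟨e, he, e', he', h⟩ := Submodule.mem_sup.mp
    (show (1 : R) ∈ traceIdeal R S ⊔ L from hL ▸ Submodule.mem_top)
  exact ⟨e, he, e', fun x => hLx x e' he', h⟩

variable (S) in
/-- A projective and injective simple module over a ring without nontrivial central idempotents
maps nontrivially to every nonzero module. -/
theorem exists_hom_ne_zero_of_connected [IsArtinianRing R] [IsSimpleModule R S]
    [Module.Projective R S] [Module.Injective R S]
    (hR : ∀ e : R, IsIdempotentElem e → (∀ a, e * a = a * e) → e = 0 ∨ e = 1)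
    (M : Type u) [AddCommGroup M] [Module R M] [Nontrivial M] : ∃ g : S →ₗ[R] M, g ≠ 0 := by
  obtain ⟨e, he, e', he', h⟩ := exists_le_annihilator (R := R) (S := S)
  have h1 {a b : R} (ha : a ∈ traceIdeal R S) (hb : ∀ x : S, b • x = 0) : a * b = 0 :=
    traceIdeal_mul_eq_zero ha hb
  have h2 {a b : R} (ha : ∀ x : S, a • x = 0) (hb : b ∈ traceIdeal R S) : a * b = 0 :=
    mul_eq_zero_of_mem_traceIdeal ha hb
  have hee : e * e = e := by
    calc e * e = e * (e + e') := by rw [mul_add, h1 he he', add_zero]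
      _ = e := by rw [h, mul_one]
  -- The trace and the annihilator of `S` multiply to zero in both orders, so both sides equal `e *
  -- a * e`.
  have hc (a : R) : e * a = a * e := by
    calc e * a = e * (a * (e + e')) := by rw [h, mul_one]
      _ = e * (a * e) := by
        rw [mul_add, mul_add, h1 (b := a * e') he (fun x => by rw [mul_smul, he', smul_zero]),
          add_zero]
      _ = (e + e') * (a * e) := by
        rw [add_mul, h2 (b := a * e) he' ((traceIdeal R S).smul_mem a he), add_zero]
      _ = a * e := by rw [h, one_mul]
  rcases hR e hee hc with h0 | h0
  · have := IsSimpleModule.nontrivial R S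
    obtain ⟨x, hx⟩ := exists_ne (0 : S)
    rw [h0, zero_add] at h
    exact absurd ((one_smul R x).symm.trans (h ▸ he' x)) hx
  · obtain ⟨y, hy⟩ := exists_ne (0 : M)
    by_contra! hM
    apply hy
    rw [← one_smul R y, ← h0]
    refine traceIdeal_induction (q := fun a => a • y = 0) (fun g x => ?_) (zero_smul R y)
      (fun a b ha hb => by rw [add_smul, ha, hb, add_zero]) he
    exact DFunLike.congr_fun (hM (LinearMap.toSpanSingleton R M y ∘ₗ g)) x

end CentralIdempotent

/-! ### Splittings from the vanishing of `Ext` -/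

section Ext

variable {R : Type u} [Ring R]

/-- The obstruction to lifting the identity of `N` to `X` lies in `Ext¹(N, M)`. -/
theorem exists_section_of_ext {M N X : ModuleCat.{u} R} (h : Subsingleton (Abelian.Ext.{u} N M 1))
    (i : M →ₗ[R] X) (q : X →ₗ[R] N) (hi : Function.Injective i) (hq : Function.Surjective q)
    (hiq : Function.Exact i q) : ∃ r : N →ₗ[R] X, q ∘ₗ r = LinearMap.id := by
  let 𝒮 : ShortComplex (ModuleCat.{u} R) :=
    ShortComplex.mk (ModuleCat.ofHom i) (ModuleCat.ofHom q) (by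
      ext x; exact hiq.apply_apply_eq_zero x)
  have h𝒮 : 𝒮.ShortExact :=
    { exact := (ShortComplex.ShortExact.moduleCat_exact_iff_function_exact 𝒮).mpr hiq
      mono_f := (ModuleCat.mono_iff_injective _).mpr hi
      epi_g := (ModuleCat.epi_iff_surjective _).mpr hq }
  obtain ⟨x, hx⟩ := Abelian.Ext.covariant_sequence_exact₃ N h𝒮 (Abelian.Ext.mk₀ (𝟙 N)) (zero_add 1)
    (Subsingleton.elim (α := Abelian.Ext.{u} N M 1) _ _)
  obtain ⟨r, rfl⟩ := (Abelian.Ext.mk₀_bijective N X).2 x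
  rw [Abelian.Ext.mk₀_comp_mk₀] at hx
  have h1 : r ≫ ModuleCat.ofHom q = 𝟙 N := (Abelian.Ext.mk₀_bijective N N).1 hx
  exact ⟨r.hom, congrArg ModuleCat.Hom.hom h1⟩

end Ext

/-! ### Minimal injective presentations -/

section Presentation

variable {R : Type u} [Ring R] {S E₀ E₁ : Type u} [AddCommGroup S] [Module R S]
  [AddCommGroup E₀] [Module R E₀] [AddCommGroup E₁] [Module R E₁] {s : S →ₗ[R] E₀}
  {f : E₀ →ₗ[R] E₁}

theorem isAtom_range_of_injective [IsSimpleModule R S] {M : Type u} [AddCommGroup M] [Module R M]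
    {g : S →ₗ[R] M} (hg : Function.Injective g) : IsAtom (LinearMap.range g) := by
  rw [← isSimpleModule_iff_isAtom]
  exact IsSimpleModule.congr (LinearEquiv.ofInjective g hg).symm

theorem IsInjectiveEnvelope.range_le [IsSimpleModule R S] (h : IsInjectiveEnvelope s)
    (N : Submodule R E₀) (hN : N ≠ ⊥) : LinearMap.range s ≤ N := by
  have h1 : N ⊓ LinearMap.range s ≠ ⊥ := fun h0 => hN (h.essential N h0)
  have h2 := (isAtom_range_of_injective h.injective).le_iff_eq h1
  exact (h2.mp inf_le_right).symm.le.trans inf_le_left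

theorem IsMinimalInjectivePresentation.essential (h : IsMinimalInjectivePresentation s f)
    (N : Submodule R E₁) (hN : N ⊓ LinearMap.range f = ⊥) : N = ⊥ :=
  h.envelope₁.essential N (by rwa [Submodule.range_subtype])

/-- If `S` has no self-extensions, then the second term of its minimal injective presentation does
not contain `S`. -/
theorem IsMinimalInjectivePresentation.hom_eq_zero [IsSimpleModule R S]
    (h : IsMinimalInjectivePresentation s f)
    (h_ext : Subsingleton (Abelian.Ext.{u} (ModuleCat.of R S) (ModuleCat.of R S) 1))
    (g : S →ₗ[R] E₁) : g = 0 := by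
  by_contra hg
  have hg' : Function.Injective g := (LinearMap.injective_or_eq_zero g).resolve_right hg
  have hatom := isAtom_range_of_injective hg'
  have hle : LinearMap.range g ≤ LinearMap.range f := by
    have h1 : LinearMap.range g ⊓ LinearMap.range f ≠ ⊥ := fun h0 =>
      hatom.1 (h.essential _ h0)
    exact (hatom.le_iff_eq h1).mp inf_le_left ▸ inf_le_right
  -- `Y` is an extension of `S` by `S` inside `E₀`. A section has nonzero image, which contains the
  -- socle of `E₀`; but the socle is the kernel of `f`, and `f` is injective on the section.
  let Y : Submodule R E₀ := (LinearMap.range g).comap f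
  let e := LinearEquiv.ofInjective g hg'
  let q : Y →ₗ[R] S := e.symm.toLinearMap ∘ₗ (f ∘ₗ Y.subtype).codRestrict _ fun y => y.2
  have hq (y : Y) : g (q y) = f y :=
    congrArg Subtype.val (e.apply_symm_apply ⟨f y, y.2⟩)
  let i : S →ₗ[R] Y := s.codRestrict Y fun x => by
    change f (s x) ∈ LinearMap.range g
    rw [h.exact.apply_apply_eq_zero]
    exact Submodule.zero_mem _
  have hi : Function.Injective i := by
    intro x y hxy
    exact h.envelope₀.injective (congrArg Subtype.val hxy)
  have hqs : Function.Surjective q := by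
    intro x
    obtain ⟨z, hz⟩ := hle ⟨x, rfl⟩
    refine ⟨⟨z, x, hz.symm⟩, hg' ?_⟩
    rw [hq]
    exact hz
  have hiq : Function.Exact i q := by
    intro y
    constructor
    · intro hy
      have h1 : f y = 0 := by rw [← hq, hy, map_zero]
      obtain ⟨x, hx⟩ := (h.exact y).mp h1
      exact ⟨x, Subtype.ext hx⟩
    · rintro ⟨x, rfl⟩
      apply hg'
      rw [hq, map_zero]
      exact h.exact.apply_apply_eq_zero x
  obtain ⟨r, hr⟩ := exists_section_of_ext (X := ModuleCat.of R Y) h_ext i q hi hqs hiq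
  have hr' (x : S) : q (r x) = x := DFunLike.congr_fun hr x
  have := IsSimpleModule.nontrivial R S
  obtain ⟨x, hx⟩ := exists_ne (0 : S)
  have h1 : LinearMap.range (Y.subtype ∘ₗ r) ≠ ⊥ := fun h0 => by
    apply hx
    have h2 : r x = 0 := Subtype.ext (DFunLike.congr_fun (LinearMap.range_eq_bot.mp h0) x)
    rw [← hr' x, h2, map_zero]
  obtain ⟨y, hy⟩ := h.envelope₀.range_le _ h1 ⟨x, rfl⟩
  have h2 : g y = 0 := by
    rw [← hr' y, hq]
    change f ((Y.subtype ∘ₗ r) y) = 0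
    rw [hy, h.exact.apply_apply_eq_zero]
  have h3 : y = 0 := hg' (by rw [h2, map_zero])
  rw [h3, map_zero] at hy
  exact hx (h.envelope₀.injective (by rw [← hy, map_zero]))

/-- If `E₁` is projective and does not contain `S`, but the projective cover of `S` does, then
`S` is not a quotient of `E₁`. -/
theorem hom_eq_zero_of_isProjectiveCover [IsSimpleModule R S] [Module.Projective R E₁]
    {P : Type u} [AddCommGroup P] [Module R P] {π : P →ₗ[R] S} (hπ : IsProjectiveCover π)
    (i : S →ₗ[R] P) (hi : Function.Injective i) (h : ∀ g : S →ₗ[R] E₁, g = 0)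
    (g : E₁ →ₗ[R] S) : g = 0 := by
  by_contra hg
  have := hπ.projective_module
  have hgs := LinearMap.surjective_of_ne_zero hg
  -- The lift to the projective cover is onto because the kernel of `π` is superfluous, so it
  -- splits; then `S` embeds in `E₁` through `P`.
  obtain ⟨u, hu⟩ := Module.projective_lifting_property π g hπ.surjective
  have hu' (x : E₁) : π (u x) = g x := DFunLike.congr_fun hu x
  have hus : LinearMap.range u = ⊤ := by
    refine hπ.superfluous _ (top_le_iff.mp fun x _ => ?_)
    obtain ⟨y, hy⟩ := hgs (π x)
    refine Submodule.mem_sup.mpr ⟨u y, ⟨y, rfl⟩, x - u y, ?_, add_sub_cancel _ _⟩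
    rw [LinearMap.mem_ker, map_sub, hu', hy, sub_self]
  obtain ⟨r, hr⟩ :=
    Module.projective_lifting_property u LinearMap.id (LinearMap.range_eq_top.mp hus)
  have hr' (x : P) : u (r x) = x := DFunLike.congr_fun hr x
  have := IsSimpleModule.nontrivial R S
  obtain ⟨x, hx⟩ := exists_ne (0 : S)
  have h0 : r (i x) = 0 := DFunLike.congr_fun (h (r ∘ₗ i)) x
  exact hx (hi (by rw [← hr' (i x), h0, map_zero, map_zero]))

end Presentation

/-! ### The reflection family of a simple module without self-extensions -/

section Construction

variable {R : Type u} [Ring R]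

theorem nonempty_iso_of_retraction {M N : FGModuleCat.{u} R} (hM : Indecomposable M.obj)
    (hN : Nontrivial N) (α : N →ₗ[R] M) (β : M →ₗ[R] N) (h : β ∘ₗ α = LinearMap.id) :
    Nonempty (M ≅ N) :=
  have : IsIso (toHom β) :=
    (isIso_iff_bijective' _).mpr (bijective_of_retraction hM hN α β h)
  ⟨asIso (toHom β)⟩

variable [IsArtinianRing R] [Module.Injective R R] {ι : Type} [Finite ι]
  {P : ι → FGModuleCat.{u} R}

theorem IsCompleteSetOfIndecProj.eq_of_iso (hP : IsCompleteSetOfIndecProj fun i => (P i).obj)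
    {i j : ι} (h : Nonempty (P i ≅ P j)) : i = j :=
  hP.nonisomorphic i j (h.map fun e => (ModuleCat.isFG R).ι.mapIso e)

theorem IsCompleteSetOfIndecProj.isNakayamaPermutation
    (hP : IsCompleteSetOfIndecProj fun i => (P i).obj) {σ : Equiv.Perm ι}
    {ζ : ∀ i, P (σ i) →ₗ[R] P i} (hζ : ∀ i, ζ i ≠ 0)
    (h : ∀ i (N : Submodule R (P i)), N ≠ ⊥ → LinearMap.range (ζ i) ≤ N) :
    IsNakayamaPermutation (fun i => (P i).obj) σ := fun i =>
  have := hP.finite (σ i)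
  have := hP.projective (σ i)
  have := isLocalRing_end_of_indecomposable (hP.indecomposable (σ i))
  socle_equiv_top (ζ i) (hζ i) (h i)

theorem exists_isReflectionFamily (hP : IsCompleteSetOfIndecProj fun i => (P i).obj)
    (hR : ∀ e : R, IsIdempotentElem e → (∀ a, e * a = a * e) → e = 0 ∨ e = 1)
    {S E₀ E₁ : FGModuleCat.{u} R} (hS : IsSimpleModule R S)
    (h_ext : Subsingleton (Abelian.Ext.{u} S.obj S.obj 1)) {s : S ⟶ E₀} {f : E₀ ⟶ E₁}
    (h_pres : IsMinimalInjectivePresentation s.hom.hom f.hom.hom) {t i₀ : ι} (hi₀ : i₀ ≠ t)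
    {π : P t ⟶ S} (hπ : IsProjectiveCover π.hom.hom) (e : E₀ ≅ P t) :
    ∃ (σ : Equiv.Perm ι) (ζ : ∀ i, P (σ i) →ₗ[R] P i) (p : E₀ →ₗ[R] S),
      IsReflectionFamily P t σ ζ s.hom.hom f p := by
  have hSn := IsSimpleModule.nontrivial R S
  have hfin (i : ι) : Module.Finite R (P i) := (P i).2
  have hproj (i : ι) : Module.Projective R (P i) := hP.projective i
  have hinj (i : ι) : Module.Injective R (P i) := injective_of_finite_projective (P i)
  have hloc (i : ι) : IsLocalRing (Module.End R (P i)) :=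
    isLocalRing_end_of_indecomposable (hP.indecomposable i)
  have hnt (i : ι) : Nontrivial (P i) := nontrivial_of_isLocalRing_end (hloc i)
  have hE₀ : Module.Finite R E₀ := E₀.2
  have hE₁ : Module.Finite R E₁ := E₁.2
  have hE₀inj : Module.Injective R E₀ := h_pres.envelope₀.injective_module
  have hE₁inj : Module.Injective R E₁ := h_pres.envelope₁.injective_module
  have hE₁proj : Module.Projective R E₁ := projective_of_finite_injective hP E₁
  let ε : E₀ ≃ₗ[R] P t := ((ModuleCat.isFG R).ι.mapIso e).toLinearEquiv
  have hE₀proj : Module.Projective R E₀ := Module.Projective.of_equiv ε.symm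
  have hE₀ind : Indecomposable E₀.obj :=
    let e' : E₀.obj ≅ (P t).obj := (ModuleCat.isFG R).ι.mapIso e
    ⟨fun h0 => (hP.indecomposable t).1 (h0.of_iso e'.symm),
      fun Y Z k => (hP.indecomposable t).2 Y Z (e'.symm ≪≫ k)⟩
  have hE₀loc : IsLocalRing (Module.End R E₀) := isLocalRing_end_of_indecomposable hE₀ind
  have hE₀nt : Nontrivial E₀ := nontrivial_of_isLocalRing_end hE₀loc
  have hπ0 : π.hom.hom ≠ 0 := by
    obtain ⟨x, hx⟩ := exists_ne (0 : S)
    obtain ⟨y, hy⟩ := hπ.surjective x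
    rintro h0
    rw [h0] at hy
    exact hx hy.symm
  let p : E₀ →ₗ[R] S := π.hom.hom ∘ₗ ε.toLinearMap
  have hp : Function.Surjective p := hπ.surjective.comp ε.surjective
  have hs := h_pres.envelope₀.injective
  have hs0 : s.hom.hom ≠ 0 := by
    obtain ⟨x, hx⟩ := exists_ne (0 : S)
    exact fun h0 => hx (hs (by rw [h0]; rfl))
  have hSE₁ (g : S →ₗ[R] E₁) : g = 0 := h_pres.hom_eq_zero h_ext g
  have hE₁S (g : E₁ →ₗ[R] S) : g = 0 :=
    hom_eq_zero_of_isProjectiveCover hπ (ε.toLinearMap ∘ₗ s.hom.hom) (ε.injective.comp hs) hSE₁ g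
  have hPS (i : ι) (hi : i ≠ t) (g : P i →ₗ[R] S) : g = 0 := by
    by_contra hg
    obtain ⟨α, β, h⟩ := exists_retraction_of_simple π.hom.hom hπ0 g hg
    exact hi (hP.eq_of_iso (nonempty_iso_of_retraction (hP.indecomposable i) (hnt t) α β h))
  -- Otherwise `S` is a summand of `E₀`, hence all of it, and is projective and injective.
  -- Connectedness gives a nonzero map from `S` to `P i₀`, which splits, so `S` would be a quotient
  -- of `P i₀` although `i₀ ≠ t`.
  have hps : p ∘ₗ s.hom.hom = 0 := by
    by_contra hne
    let φ := LinearEquiv.ofBijective _ (LinearMap.bijective_of_ne_zero hne)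
    have hret : p ∘ₗ (s.hom.hom ∘ₗ φ.symm.toLinearMap) = LinearMap.id :=
      LinearMap.ext fun x => φ.apply_symm_apply x
    let ψ := LinearEquiv.ofBijective p (bijective_of_retraction hE₀ind hSn _ _ hret)
    have hSproj : Module.Projective R S := Module.Projective.of_equiv ψ
    have hSinj : Module.Injective R S :=
      injective_of_retract ψ.symm.toLinearMap ψ.toLinearMap (by ext x; simp)
    obtain ⟨g, hg⟩ := exists_hom_ne_zero_of_connected S hR (P i₀)
    have hgi : Function.Injective g := (LinearMap.injective_or_eq_zero g).resolve_right hg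
    obtain ⟨r, hr⟩ := Module.Injective.out g hgi LinearMap.id
    obtain ⟨x, hx⟩ := exists_ne (0 : S)
    apply hx
    have := hr x
    rw [hPS i₀ hi₀ r] at this
    exact this.symm
  obtain ⟨σ, ζ, hζ, hζ'⟩ := exists_nakayama hP
  refine ⟨σ, ζ, p, ⟨hS, hE₀, hE₁, hE₀proj, hE₁proj, hE₀inj, hE₁inj, hE₀loc, h_pres.exact, hs,
    h_pres.envelope₀.range_le, h_pres.essential, ?_, hps, hE₁S⟩, ?_, hproj, hinj, hloc,
    fun i j => hP.eq_of_iso, hPS, ?_, ?_, hζ, hζ'⟩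
  · obtain ⟨x, hx⟩ := exists_ne (0 : S)
    obtain ⟨y, hy⟩ := hp x
    rintro h0
    rw [h0] at hy
    exact hx hy.symm
  -- The socle map of `P t` factors through the copy of `S` in it, so `P (σ t)` has a nonzero map to
  -- `S`; only `P t` has one.
  · by_contra hσ
    let i := ε.toLinearMap ∘ₗ s.hom.hom
    have hi : Function.Injective i := ε.injective.comp hs
    have hle : LinearMap.range (ζ t) ≤ LinearMap.range i := hζ' t _ fun h0 => hs0 (by
      ext x
      exact ε.injective (by rw [LinearMap.zero_apply, map_zero]
                            exact DFunLike.congr_fun (LinearMap.range_eq_bot.mp h0) x))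
    obtain ⟨b, hb⟩ := exists_factor_of_range_le i (ζ t) hle
    apply hζ t
    rw [← hb, hPS _ hσ b, LinearMap.comp_zero]
  · intro i hi g hg
    obtain ⟨r, hr⟩ := Module.Injective.out g hg LinearMap.id
    obtain ⟨e'⟩ := nonempty_iso_of_retraction (hP.indecomposable i) hE₀nt g r (LinearMap.ext hr)
    exact hi (hP.eq_of_iso ⟨e' ≪≫ e⟩)
  · intro L hL
    obtain ⟨L', hL', hle⟩ := (eq_top_or_exists_le_coatom L).resolve_left hL
    have : IsSimpleModule R (E₁ ⧸ L') := isSimpleModule_iff_isCoatom.mpr hL'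
    obtain ⟨i, q, hq⟩ := hP.exists_hom_ne_zero (E₁ ⧸ L')
    have hi : i ≠ t := by
      rintro rfl
      obtain ⟨κ⟩ := exists_equiv_of_simple hq hπ0
      have h0 := hE₁S (κ.toLinearMap ∘ₗ L'.mkQ)
      obtain ⟨x, hx⟩ := exists_ne (0 : S)
      obtain ⟨y, hy⟩ := L'.mkQ_surjective (κ.symm x)
      apply hx
      have := DFunLike.congr_fun h0 y
      rw [LinearMap.comp_apply, hy] at this
      simpa using this
    obtain ⟨h, hh⟩ := Module.projective_lifting_property L'.mkQ q L'.mkQ_surjective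
    refine ⟨i, hi, h, fun hle' => hq ?_⟩
    rw [← hh]
    apply LinearMap.range_le_ker_iff.mp
    rw [Submodule.ker_mkQ]
    exact hle'.trans hle

end Construction

/-! ### Passing to the opposite ring -/

section SelfInjective

/-- The regular right module, as a module over the opposite ring. -/
def opEquiv (A : Type u) [Ring A] : A ≃ₗ[Aᵐᵒᵖ] Aᵐᵒᵖ where
  toFun := MulOpposite.op
  map_add' _ _ := rfl
  map_smul' _ _ := rfl
  invFun := MulOpposite.unop
  left_inv _ := rfl
  right_inv _ := rfl

theorem IsSelfInjective.injective_op {A : Type u} [Ring A] (h : IsSelfInjective A) :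
    Module.Injective Aᵐᵒᵖ Aᵐᵒᵖ :=
  have : Module.Injective Aᵐᵒᵖ A := h
  injective_of_retract (opEquiv A).symm.toLinearMap (opEquiv A).toLinearMap (by ext; simp)

theorem IsConnectedRing.op {A : Type u} [Ring A] (h : IsConnectedRing A) (e : Aᵐᵒᵖ)
    (he : IsIdempotentElem e) (hc : ∀ a, e * a = a * e) : e = 0 ∨ e = 1 := by
  have h1 : IsIdempotentElem e.unop := congrArg MulOpposite.unop he
  have h2 : e.unop ∈ Subring.center A := by
    rw [Subring.mem_center_iff]
    intro a
    exact congrArg MulOpposite.unop (hc (MulOpposite.op a))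
  rcases h.2 e.unop h1 h2 with h3 | h3
  · exact .inl (MulOpposite.unop_injective h3)
  · exact .inr (MulOpposite.unop_injective h3)

end SelfInjective

end Reflection

end

theorem theorem2p1
    {K : Type v} [CommRing K] [IsArtinianRing K] [IsLocalRing K]
    {Λ : Type u} [Ring Λ] [Algebra K Λ] [Module.Finite K Λ]
    (h_connected : Reflection.IsConnectedRing Λ)
    (h_basic : Reflection.IsBasicRing Λ)
    (h_not_simple : ¬ IsSimpleRing Λ)
    (h_selfinjective : Reflection.IsSelfInjective Λ)
    {n : ℕ} (hn : 1 < n)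
    (P : Fin n → FGModuleCat.{u} Λᵐᵒᵖ)
    (hP : Reflection.IsCompleteSetOfIndecProj fun i => (P i).obj)
    (S : FGModuleCat.{u} Λᵐᵒᵖ) (hS : IsSimpleModule Λᵐᵒᵖ S)
    (h_ext : Subsingleton (Abelian.Ext.{u} S.obj S.obj 1))
    (E₀ E₁ : FGModuleCat.{u} Λᵐᵒᵖ) (s : S ⟶ E₀) (f : E₀ ⟶ E₁)
    (h_pres : Reflection.IsMinimalInjectivePresentation s.hom.hom f.hom.hom)
    (t : Fin n) (π : P t ⟶ S)
    (hπ : Reflection.IsProjectiveCover π.hom.hom)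
    (h_iso : Nonempty (E₀ ≅ P t)) :
    Reflection.IsTiltingComplex (Reflection.reflectionComplex P t f) ∧
    Module.Finite K (End (Reflection.reflectionComplex P t f)) ∧
    Reflection.IsSelfInjective (End (Reflection.reflectionComplex P t f)) ∧
    Reflection.IsCompleteSetOfIndecProj (Reflection.reflectionProjective P t f) ∧
    ∃ σ : Equiv.Perm (Fin n),
      Reflection.IsNakayamaPermutation (fun i => (P i).obj) σ ∧
      Reflection.IsNakayamaPermutation (Reflection.reflectionProjective P t f) σ := by
  have : IsArtinianRing Λᵐᵒᵖ := Reflection.isArtinianRing_of_finite K Λᵐᵒᵖ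
  have := h_selfinjective.injective_op
  obtain ⟨e⟩ := h_iso
  have : Nontrivial (Fin n) := Fin.nontrivial_iff_two_le.mpr hn
  -- The assumption on `n` enters here: a second indecomposable projective is needed to see that
  -- `E₀` is not simple.
  obtain ⟨i₀, hi₀⟩ := exists_ne t
  obtain ⟨σ, ζ, p, H⟩ := Reflection.exists_isReflectionFamily hP h_connected.op hS h_ext h_pres hi₀
    hπ e
  have hfin : Module.Finite K (End (Reflection.reflectionComplex P t f)) :=
    Reflection.finite_end_of_boundedProjectives K H.boundedProjectives_reflectionComplex
  have := Reflection.isArtinianRing_of_finite K (End (Reflection.reflectionComplex P t f))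
  have := Reflection.isArtinianRing_of_finite K (End (Reflection.reflectionComplex P t f))ᵐᵒᵖ
  obtain ⟨D⟩ := Reflection.nonempty_reflectionDecomposition P t f
  have hT := H.isNakayamaFamily_reflectionSummand
  exact ⟨H.isTiltingComplex hP e, hfin, hT.isSelfInjective D, hT.isCompleteSetOfIndecProj D,
    σ, hP.isNakayamaPermutation H.ne_zero H.range_le, hT.isNakayamaPermutation D⟩
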